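/- **Setting.** A restless bandit has $n\ge 1$ arms, of which $m\le n$ are activated at each time. Arm $i$ has a finite non-empty state space $\mathcal S^i$ with a metric $d^i$, actions $\{0,1\}$ ($1$ = active), rewards $r^i:\mathcal S^i\times\{0,1\}\to[0,R_{\max}]$ with $R_{\max}>0$, and transition probabilities $P^i(\cdot\mid s,a;\theta^i)$ that depend measurably on an unknown parameter $\theta^i\in\Theta^i$. Put $\boldsymbol{\mathcal S}=\prod_i\mathcal S^i$, $\Theta=\prod_i\Theta^i$ and, for $\theta\in\Theta$, $\boldsymbol P_\theta(\boldsymbol s'\mid\boldsymbol s,\boldsymbol a)=\prod_iP^i(s'^i\mid s^i,a^i;\theta^i)$. In Model A the reward is $\boldsymbol r(\boldsymbol s,\boldsymbol a)=\sum_ir^i(s^i,a^i)$. In Model B only active arms yield reward, i.e. $r^i(s,0)$ is replaced by $0$. The true parameter $\theta_\star$ has independent components with priors $\phi_1^i$, and is independent of the initial state $\boldsymbol S_1$, whose components are independent with known laws. *Whittle policy.* For arm $i$, parameter $\theta^i$ and $\lambda\in\mathbb R$, let $\pi_\lambda$ be a policy $\mathcal S^i\to\{0,1\}$ that maximizes $\liminf_T\frac1T\mathbb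 E\sum_{t=1}^T[r^i(S_t,A_t)-\lambda A_t]$ from every initial state (any fixed choice), and $\mathcal W_\lambda=\{s:\pi_\lambda(s)=0\}$. The arm is indexable if $\mathcal W_\lambda$ is non-decreasing in $\lambda$. The Whittle index is $w(s)=\inf\{\lambda: s\in\mathcal W_\lambda\}\in[-\infty,\infty]$. The Whittle policy $\boldsymbol\mu_\theta$ activates $m$ arms with the largest indices at their current states (ties broken in any way that is measurable in $\theta$). $J_\theta$ is its long-run average reward in model $\theta$. *RB-TSDE.* Let $N^i_t(s,a)$ be the number of visits of arm $i$ to $(s,a)$ at times $1,\dots,t-1$, and $\phi^i_t$ the posterior of $\theta^i_\star$ given the states and actions of arm $i$ up to time $t$. Episode $1$ starts at $t_1=1$, with $T_0=0$. Episode $k+1$ starts at the first $t_{k+1}>t_k$ such that $t_{k+1}-t_k>T_{k-1}$ or $N^i_{t_{k+1}}(s,a)>2N^i_{t_k}(s,a)$ for some $(i,s,a)$, and $T_k=t_{k+1}-t_k$. At time $t_k$ the components $\theta^i_k$ are sampled independently from $\phi^i_{t_k}$, and $\boldsymbol\mu_{\theta_k}$ is used during episode $k$. The Bayesian regret is $\mathcal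 R(T)=\mathbb E\bigl[TJ_{\theta_\star}-\sum_{t=1}^T\boldsymbol r(\boldsymbol S_t,\boldsymbol A_t)\bigr]$. **Assumptions.** (1) Every arm is indexable for every parameter. (2) For every $\theta\in\Theta$, $J_\theta$ does not depend on the initial state, and there is $\boldsymbol V_\theta:\boldsymbol{\mathcal S}\to\mathbb R$ with $J_\theta+\boldsymbol V_\theta(\boldsymbol s)=\boldsymbol r(\boldsymbol s,\boldsymbol\mu_\theta(\boldsymbol s))+\sum_{\boldsymbol z}\boldsymbol P_\theta(\boldsymbol z\mid\boldsymbol s,\boldsymbol\mu_\theta(\boldsymbol s))\boldsymbol V_\theta(\boldsymbol z)$ for all $\boldsymbol s$. (3) There is $\lambda^*<1$ such that for all $\theta\in\Theta$ the matrix $Q(\boldsymbol z\mid\boldsymbol s)=\boldsymbol P_\theta(\boldsymbol z\mid\boldsymbol s,\boldsymbol\mu_\theta(\boldsymbol s))$ satisfies $1-\min_{\boldsymbol s,\boldsymbol s'}\sum_{\boldsymbol z}\min\{Q(\boldsymbol z\mid\boldsymbol s),Q(\boldsymbol z\mid\boldsymbol s')\}\le\lambda^*$. (4) For some $p\in[1,\infty)$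 and all $\theta\in\Theta$, $\boldsymbol V_\theta$ is Lipschitz with constant $L_v$ for the product metric $\bigl(\sum_id^i(s^i,s'^i)^p\bigr)^{1/p}$. **Theorem.** Let $\mathsf S^i=|\mathcal S^i|$, $\bar{\mathsf S}_n=\sum_{i=1}^n\mathsf S^i$ and $\mathsf D_{\max}=\max_i\operatorname{diam}(\mathcal S^i)$. For every $M\in\mathbb N$ there are constants $K_1,K_2>0$, depending only on $M$ (in particular not on $n$ and $T$), such that for every bandit as above in which each $\mathcal S^i$ has at most $M$ elements or is isometric to a subset of $\mathbb R$, for both reward models, and for every $T\ge1$, $$\mathcal R(T)<24\,n\,\max\Bigl\{\frac{R_{\max}}{1-\lambda^*},\ \mathsf D_{\max}L_v\Bigr\}\sqrt{K_1\,\bar{\mathsf S}_n\,T\log(K_2T)}.$$ Consequently, if all $\mathsf S^i\le b$, then $\mathcal R(T)<24\max\{\frac{R_{\max}}{1-\lambda^*},\mathsf D_{\max}L_v\}\,n^{3/2}\sqrt{K_1\,b\,T\log(K_2T)}$, so that the regret is of order $n^{1.5}\sqrt T$ up to a logarithmic factor. -/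

import Mathlib

open MeasureTheory Filter

universe u v

/-! ## Averages of finite Markov chains -/

/-- One step of the transition matrix `Q` applied to `f`: the value `(Q f)(x) = ∑ y, Q(y | x) f(y)`. -/
def expectNext {X : Type*} [Fintype X] (Q : X → X → ℝ) (f : X → ℝ) : X → ℝ :=
  fun x => ∑ y, Q x y * f y

/-- Long-run average reward `liminf_T (1/T) E[∑_{t=1}^T ρ(X_t)]` of the Markov chain with
transition matrix `Q` and reward `ρ`, started at `X_1 = x`; here `E[ρ(X_{t+1})] = (Q^t ρ)(x)`. -/
noncomputable def avgReward {X : Type*} [Fintype X] (Q : X → X → ℝ) (ρ : X → ℝ) (x : X) : ℝ :=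
  liminf (fun T : ℕ => (∑ t ∈ Finset.range T, (expectNext Q)^[t] ρ x) / (T : ℝ)) atTop

/-- The ergodicity coefficient `1 - min_{x, x'} ∑_z min (Q(z | x)) (Q(z | x'))`. -/
noncomputable def ergodicityCoeff {X : Type*} [Fintype X] (Q : X → X → ℝ) : ℝ :=
  1 - ⨅ x : X, ⨅ x' : X, ∑ z, min (Q x z) (Q x' z)

/-! ## One arm: Lagrangian problem, passive sets, Whittle index

Actions are Booleans: `true` is active, `false` is passive. -/

/-- Long-run average of `r(S_t, A_t) - lam * A_t` for one arm, under the stationary deterministic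
policy `π`, started at `s`. -/
noncomputable def armLagrangian {X : Type*} [Fintype X] (P : X → Bool → X → ℝ)
    (r : X → Bool → ℝ) (lam : ℝ) (π : X → Bool) (s : X) : ℝ :=
  avgReward (fun x y => P x (π x) y) (fun x => r x (π x) - if π x then lam else 0) s

/-- `π` is an optimal policy of the arm for activation cost `lam`. -/
def IsArmOptimal {X : Type*} [Fintype X] (P : X → Bool → X → ℝ)
    (r : X → Bool → ℝ) (lam : ℝ) (π : X → Bool) : Prop :=
  ∀ (π' : X → Bool) (s : X), armLagrangian P r lam π' s ≤ armLagrangian P r lam π s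

/-- The passive set of a family `π lam` of policies indexed by the activation cost `lam`. -/
def passiveSet {X : Type*} (π : ℝ → X → Bool) (lam : ℝ) : Set X :=
  {s | π lam s = false}

/-- Indexability: the passive set is non-decreasing in the activation cost. -/
def Indexable {X : Type*} (π : ℝ → X → Bool) : Prop :=
  ∀ lam₁ lam₂ : ℝ, lam₁ ≤ lam₂ → passiveSet π lam₁ ⊆ passiveSet π lam₂

/-- The Whittle index: the infimum of the activation costs for which `s` is passive. It is an
extended real number, so that the infimum always makes sense. -/
noncomputable def whittleIndex {X : Type*} (π : ℝ → X → Bool) (s : X) : EReal :=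
  sInf {w : EReal | ∃ lam : ℝ, w = (lam : EReal) ∧ s ∈ passiveSet π lam}

/-! ## Restless bandits with unknown parameters -/

/-- Model A: all arms yield rewards. Model B: only the active arms yield rewards. -/
inductive RewardModel where
  | A : RewardModel
  | B : RewardModel

/-- A restless bandit with `n` arms, state spaces `S i` and parameter spaces `Θ i`, together with
the distribution of the initial state and the priors. -/
structure RestlessBandit {n : ℕ} (S : Fin n → Type u) [∀ i, Fintype (S i)]
    (Θ : Fin n → Type v) [∀ i, MeasurableSpace (Θ i)] where
  /-- number of arms to be activated at each time -/
  m : ℕ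
  m_le : m ≤ n
  /-- `P i θ s b s'` is the probability that arm `i`, in state `s` and under action `b`, moves to
  state `s'` when its parameter is `θ` -/
  P : ∀ i, Θ i → S i → Bool → S i → ℝ
  P_nonneg : ∀ i θ s b s', 0 ≤ P i θ s b s'
  P_sum : ∀ i θ s b, ∑ s', P i θ s b s' = 1
  P_measurable : ∀ i s b s', Measurable fun θ => P i θ s b s'
  /-- per-step reward of each arm -/
  r : ∀ i, S i → Bool → ℝ
  model : RewardModel
  /-- distribution of the initial state of each arm -/
  init : ∀ i, S i → ℝ
  init_nonneg : ∀ i s, 0 ≤ init i s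
  init_sum : ∀ i, ∑ s, init i s = 1
  /-- prior on the parameter of each arm -/
  prior : ∀ i, Measure (Θ i)
  prior_prob : ∀ i, IsProbabilityMeasure (prior i)

/-- A history at time `t`: the list of the joint states and actions at times `t - 1, …, 1` (the
most recent one first), and the joint state at time `t`. -/
structure History {n : ℕ} (S : Fin n → Type u) where
  past : List ((∀ i, S i) × (Fin n → Bool))
  cur : ∀ i, S i

/-- Histories form a countable set; every set of histories is measurable. -/
instance {n : ℕ} (S : Fin n → Type u) : MeasurableSpace (History S) := ⊤

/-- Number of visits of arm `i` to the state-action pair `(x, b)` in a list of joint states and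
actions: `N^i_t(x, b)` if the list describes the times `1, …, t - 1`. -/
noncomputable def visits {n : ℕ} {S : Fin n → Type u}
    (h : List ((∀ i, S i) × (Fin n → Bool))) (i : Fin n) (x : S i) (b : Bool) : ℕ :=
  open Classical in h.countP (fun z => decide (z.1 i = x ∧ z.2 i = b))

/-- Data of an episode: its start `t_k`, the length `T_{k-1}` of the episode before, and the list
of the joint states and actions before time `t_k`. -/
structure Episode {n : ℕ} (S : Fin n → Type u) where
  start : ℕ
  prevLen : ℕ
  past : List ((∀ i, S i) × (Fin n → Bool))

/-- The stopping rule. If `e` is the episode in force and `h` the list of the joint states and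
actions before time `t = h.length + 1`, a new episode starts at time `t` when
`t_k + T_{k-1} < t` or when `2 N^i_{t_k}(x, b) < N^i_t(x, b)` for some arm and state-action pair. -/
def Episode.Stops {n : ℕ} {S : Fin n → Type u} (e : Episode S)
    (h : List ((∀ i, S i) × (Fin n → Bool))) : Prop :=
  e.start + e.prevLen < h.length + 1 ∨
    ∃ (i : Fin n) (x : S i) (b : Bool), 2 * visits e.past i x b < visits h i x b

/-- The episode in force at time `h.length + 1`, after the check of the stopping rule at that
time. The first episode starts at time `1`, with `T_0 = 0`. -/
noncomputable def episodeAt {n : ℕ} {S : Fin n → Type u} :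
    List ((∀ i, S i) × (Fin n → Bool)) → Episode S
  | [] => ⟨1, 0, []⟩
  | z :: h =>
    open Classical in
    if (episodeAt h).Stops (z :: h) then
      ⟨(z :: h).length + 1, (z :: h).length + 1 - (episodeAt h).start, z :: h⟩
    else episodeAt h

/-- Bayes' rule: the probability measure proportional to `L(θ) φ(dθ)`. -/
noncomputable def bayesUpdate {X : Type*} [MeasurableSpace X] (φ : Measure X) (L : X → ℝ) :
    Measure X :=
  (∫⁻ θ, ENNReal.ofReal (L θ) ∂φ)⁻¹ • φ.withDensity fun θ => ENNReal.ofReal (L θ)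

/-- The product metric `(∑ i, d^i(s^i, s'^i)^p)^{1/p}` on the joint state space. -/
noncomputable def productDist {n : ℕ} {S : Fin n → Type u} [∀ i, MetricSpace (S i)]
    (p : ℝ) (s s' : ∀ i, S i) : ℝ :=
  (∑ i, dist (s i) (s' i) ^ p) ^ (1 / p)

namespace RestlessBandit

variable {n : ℕ} {S : Fin n → Type u} [∀ i, Fintype (S i)]
  {Θ : Fin n → Type v} [∀ i, MeasurableSpace (Θ i)]

/-- The reward that arm `i` contributes: `r^i(s, a)` in Model A and `r^i(s, a) 1{a = 1}` in
Model B. -/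
def armReward (B : RestlessBandit S Θ) (i : Fin n) (s : S i) (b : Bool) : ℝ :=
  match B.model with
  | RewardModel.A => B.r i s b
  | RewardModel.B => if b then B.r i s b else 0

/-- The aggregated per-step reward. -/
def reward (B : RestlessBandit S Θ) (s : ∀ i, S i) (a : Fin n → Bool) : ℝ :=
  ∑ i, B.armReward i (s i) (a i)

/-- The joint transition probability `P_θ(s' | s, a)`: the arms move independently. -/
def jointP (B : RestlessBandit S Θ) (θ : ∀ i, Θ i) (s : ∀ i, S i) (a : Fin n → Bool)
    (s' : ∀ i, S i) : ℝ :=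
  ∏ i, B.P i (θ i) (s i) (a i) (s' i)

/-- The distribution of the initial joint state. -/
def jointInit (B : RestlessBandit S Θ) (s : ∀ i, S i) : ℝ :=
  ∏ i, B.init i (s i)

/-- `π i θ lam` is, for each arm, each parameter and each activation cost, a choice of
an optimal policy (the choice matters only when there is more than one). -/
def OptimalFamily (B : RestlessBandit S Θ) (π : ∀ i, Θ i → ℝ → S i → Bool) : Prop :=
  ∀ i θ lam, IsArmOptimal (B.P i θ) (B.armReward i) lam (π i θ lam)

/-- `μ θ` is, for every `θ`, a Whittle index policy of model `θ`: at each joint state it activates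
`m` arms with the largest Whittle indices (ties are broken in any way). -/
def IsWhittlePolicy (B : RestlessBandit S Θ) (π : ∀ i, Θ i → ℝ → S i → Bool)
    (μ : (∀ i, Θ i) → (∀ i, S i) → (Fin n → Bool)) : Prop :=
  ∀ θ s, (Finset.univ.filter fun i => μ θ s i = true).card = B.m ∧
    ∀ i j, μ θ s i = true → μ θ s j = false →
      whittleIndex (π j (θ j)) (s j) ≤ whittleIndex (π i (θ i)) (s i)

/-- The transition matrix of the joint state in model `θ` under the policy `μ θ`. -/
def chain (B : RestlessBandit S Θ) (μ : (∀ i, Θ i) → (∀ i, S i) → (Fin n → Bool))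
    (θ : ∀ i, Θ i) (s s' : ∀ i, S i) : ℝ :=
  B.jointP θ s (μ θ s) s'

/-- The per-step reward in model `θ` under the policy `μ θ`. -/
def chainReward (B : RestlessBandit S Θ) (μ : (∀ i, Θ i) → (∀ i, S i) → (Fin n → Bool))
    (θ : ∀ i, Θ i) (s : ∀ i, S i) : ℝ :=
  B.reward s (μ θ s)

/-- The performance `J_θ = liminf_T (1/T) E[∑_{t=1}^T r(S_t, A_t)]` of the policy `μ θ` in
model `θ`, where `S_1` has the given initial distribution. -/
noncomputable def J (B : RestlessBandit S Θ) (μ : (∀ i, Θ i) → (∀ i, S i) → (Fin n → Bool))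
    (θ : ∀ i, Θ i) : ℝ :=
  liminf (fun T : ℕ => (∑ t ∈ Finset.range T, ∑ s, B.jointInit s *
    (expectNext (B.chain μ θ))^[t] (B.chainReward μ θ) s) / (T : ℝ)) atTop

/-- The average reward does not depend on the initial state, and `V θ` is a differential value
function: `(J_θ, V θ)` satisfies the average reward Bellman equation. -/
def IsDifferentialValue (B : RestlessBandit S Θ)
    (μ : (∀ i, Θ i) → (∀ i, S i) → (Fin n → Bool)) (V : (∀ i, Θ i) → (∀ i, S i) → ℝ) : Prop :=
  ∀ θ s, avgReward (B.chain μ θ) (B.chainReward μ θ) s = B.J μ θ ∧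
    B.J μ θ + V θ s = B.chainReward μ θ s + expectNext (B.chain μ θ) (V θ) s

/-! ### The algorithm RB-TSDE and its Bayesian regret -/

/-- The posterior of arm `i` given the past (most recent first) and the current state. -/
noncomputable def posterior (B : RestlessBandit S Θ) (i : Fin n) :
    List ((∀ i, S i) × (Fin n → Bool)) → (∀ i, S i) → Measure (Θ i)
  | [], _ => B.prior i
  | (s, a) :: h, s' => bayesUpdate (B.posterior i h s) fun θ => B.P i θ (s i) (a i) (s' i)

/-- The law of the parameter in force at the time of the history `h` (a time after the first),
when `ϑ` was in force one step before: if an episode starts at this time, all arms are sampled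
independently from their posteriors; otherwise the parameter stays the same. -/
noncomputable def nextParam (B : RestlessBandit S Θ) (h : History S) (ϑ : ∀ i, Θ i) :
    Measure (∀ i, Θ i) :=
  open Classical in
  if (episodeAt h.past).start = h.past.length + 1 then
    Measure.pi fun i => B.posterior i h.past h.cur
  else Measure.dirac ϑ

/-- One step of RB-TSDE. The triple consists of the true parameter, the history, and
the parameter of the current episode. The arms are activated by the Whittle index policy of the
latter, and move according to the true parameter. -/
noncomputable def step (B : RestlessBandit S Θ)
    (μ : (∀ i, Θ i) → (∀ i, S i) → (Fin n → Bool))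
    (x : (∀ i, Θ i) × History S × (∀ i, Θ i)) :
    Measure ((∀ i, Θ i) × History S × (∀ i, Θ i)) :=
  ∑ s' : (∀ i, S i),
    ENNReal.ofReal (B.jointP x.1 x.2.1.cur (μ x.2.2 x.2.1.cur) s') •
      (B.nextParam ⟨(x.2.1.cur, μ x.2.2 x.2.1.cur) :: x.2.1.past, s'⟩ x.2.2).map
        fun ϑ' => (x.1, ⟨(x.2.1.cur, μ x.2.2 x.2.1.cur) :: x.2.1.past, s'⟩, ϑ')

/-- `B.law μ t` is the joint law at time `t + 1` of the true parameter, the history, and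
the parameter in force, under RB-TSDE. At time `1` the true parameter, the initial state and the
first sampled parameter are independent. -/
noncomputable def law (B : RestlessBandit S Θ)
    (μ : (∀ i, Θ i) → (∀ i, S i) → (Fin n → Bool)) :
    ℕ → Measure ((∀ i, Θ i) × History S × (∀ i, Θ i))
  | 0 =>
      ∑ s : (∀ i, S i), ENNReal.ofReal (B.jointInit s) •
        ((Measure.pi B.prior).prod (Measure.pi B.prior)).map fun q => (q.1, ⟨[], s⟩, q.2)
  | t + 1 => (B.law μ t).bind (B.step μ)

/-- The Bayesian regret `E[T J_{θ⋆} - ∑_{t=1}^T r(S_t, A_t)]` of RB-TSDE with respect to the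
Whittle index policy. -/
noncomputable def regret (B : RestlessBandit S Θ)
    (μ : (∀ i, Θ i) → (∀ i, S i) → (Fin n → Bool)) (T : ℕ) : ℝ :=
  (T : ℝ) * ∫ θ, B.J μ θ ∂(Measure.pi B.prior) -
    ∑ t ∈ Finset.range T, ∫ x, B.reward x.2.1.cur (μ x.2.2 x.2.1.cur) ∂(B.law μ t)

end RestlessBandit

/-!
The regret is split along the posterior-sampling identity and the Bellman equation of the sampled
model. With `θ⋆` the true parameter, `θ` the one in force and `V θ` its differential value,

`J θ⋆ - r(s, a) = (J θ⋆ - J θ) + (P_θ V θ - P_θ⋆ V θ)(s, a) + (P_θ⋆ V θ (s, a) - V θ s)`.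

* First term. Given the history at the start of an episode, the sample and the true parameter have
  the same law (`exists_lintegral_law_history`, `integral_sample_eq`), so the sample can be replaced
  by the true parameter in expectations. The length of the episode is not known at its start, but it
  is at most the previous length plus one, so the term costs at most the maximal reward per episode
  (`sum_integral_param_le`).
* Third term. It telescopes inside an episode and costs an oscillation of `V` per episode
  (`sum_integral_J_sub_reward_le`). The oscillation is at most `n R_max / (1 - λ*)`, because the
  transition matrix contracts oscillations by its ergodicity coefficient (`bellman_sub_le`). The same
  contraction shows that the differences of `V θ` are measurable in `θ` (`measurable_value_sub`).
* The number of episodes is of order `√(S̄ T log T)` (`numStarts_le_sqrt`): an episode that ends without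
  a doubling of a visit count is longer than the one before, and there are `O(S̄ log T)` doublings.
* Second term. Exchanging the arms one after the other (`abs_sum_prod_sub_le`) reduces it to the error
  of one arm in integrating a Lipschitz function. Such a function is controlled by `[0, 1]`-valued
  test functions of total weight at most `M + 1` diameters, whatever the number of states if the arm
  lies on the line (`exists_testFunctions`). Each test function is a scalar estimation problem: an
  exponential supermartingale (`integral_exp_deviation_le`) puts the true parameter into a confidence
  set around the empirical mean, the sampled parameter lies in it with the same probability, and the
  confidence radii along a trajectory add up to `O(√(S^i T log T))` (`sum_integral_armMean_sub_le`).
  Summing over test functions instead of states keeps the number of states out of the bound, up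
  to the square root.

Expectations are handled through the laws at consecutive times: the inequality `integral_step_le`
turns a pathwise comparison over one step into a comparison of expectations, so that no probability
space of trajectories is needed, and quantities that refer to earlier times enter through potentials.
-/

/-! ### Scalar inequalities -/

theorem exp_le_add_exp_sq (x : ℝ) : Real.exp x ≤ x + Real.exp (x ^ 2) := by
  have h1 := Real.add_one_le_exp (x ^ 2)
  rcases le_or_gt x (-1) with hx | hx
  · have : Real.exp x ≤ 1 := Real.exp_le_one_iff.2 (by linarith)
    nlinarith
  rcases le_or_gt x 1 with hx' | hx'
  · have h := Real.abs_exp_sub_one_sub_id_le (x := x) (abs_le.2 ⟨hx.le, hx'⟩)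
    have := (abs_le.1 h).2
    linarith
  · have : Real.exp x ≤ Real.exp (x ^ 2) := Real.exp_le_exp.2 (by nlinarith)
    linarith

/-- A weak form of Hoeffding's lemma for a `[0, 1]`-valued function on a finite probability space. -/
theorem sum_mul_exp_centered_le {X : Type*} [Fintype X] (p g : X → ℝ) (hp : ∀ x, 0 ≤ p x)
    (hp1 : ∑ x, p x = 1) (hg : ∀ x, 0 ≤ g x ∧ g x ≤ 1) (c : ℝ) :
    ∑ x, p x * Real.exp (c * (g x - ∑ y, p y * g y)) ≤ Real.exp (c ^ 2) := by
  set a := ∑ y, p y * g y with ha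
  have ha0 : 0 ≤ a := Finset.sum_nonneg fun y _ => mul_nonneg (hp y) (hg y).1
  have ha1 : a ≤ 1 := by
    rw [← hp1]
    exact Finset.sum_le_sum fun y _ => mul_le_of_le_one_right (hp y) (hg y).2
  calc ∑ x, p x * Real.exp (c * (g x - a))
      ≤ ∑ x, p x * (c * (g x - a) + Real.exp (c ^ 2)) := by
        refine Finset.sum_le_sum fun x _ => mul_le_mul_of_nonneg_left ?_ (hp x)
        refine (exp_le_add_exp_sq _).trans (add_le_add le_rfl (Real.exp_le_exp.2 ?_))
        rw [mul_pow]
        have : (g x - a) ^ 2 ≤ 1 := by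
          have h1 : -1 ≤ g x - a := by linarith [(hg x).1]
          have h2 : g x - a ≤ 1 := by linarith [(hg x).2]
          nlinarith
        nlinarith [sq_nonneg c]
    _ = c * (∑ x, p x * g x - a * ∑ x, p x) + Real.exp (c ^ 2) * ∑ x, p x := by
        simp only [Finset.mul_sum, ← Finset.sum_sub_distrib, ← Finset.sum_add_distrib]
        exact Finset.sum_congr rfl fun x _ => by ring
    _ = Real.exp (c ^ 2) := by rw [hp1, ← ha]; ring

/-- The increment of `3 √k` dominates `1 / √(max k 1)`. -/
theorem inv_sqrt_max_le (k : ℕ) :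
    1 / √(max (k : ℝ) 1) ≤ 3 * (√((k : ℝ) + 1) - √(k : ℝ)) := by
  rcases Nat.eq_zero_or_pos k with rfl | hk
  · norm_num
  · have hk1 : (1 : ℝ) ≤ k := by exact_mod_cast hk
    rw [max_eq_left hk1]
    have h0 : 0 < √(k : ℝ) := Real.sqrt_pos.2 (by linarith)
    have h1 : √((k : ℝ) + 1) ≤ 2 * √(k : ℝ) := by
      rw [Real.sqrt_le_left (by positivity), mul_pow, Real.sq_sqrt (by linarith)]
      linarith
    have h2 : (√((k : ℝ) + 1) - √(k : ℝ)) * (√((k : ℝ) + 1) + √(k : ℝ)) = 1 := by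
      rw [mul_comm, ← sq_sub_sq, Real.sq_sqrt (by linarith), Real.sq_sqrt (by linarith)]; ring
    rw [div_le_iff₀ h0]
    have h3 : 0 ≤ √((k : ℝ) + 1) - √(k : ℝ) :=
      sub_nonneg.2 (Real.sqrt_le_sqrt (by linarith))
    nlinarith

/-! ### Finite product distributions -/

section Product

variable {ι : Type*} [Fintype ι] [DecidableEq ι] {S : ι → Type*}

theorem prod_update_apply (m : ∀ i, S i → ℝ) (i : ι) (a : S i → ℝ) (s : ∀ i, S i) :
    ∏ j, Function.update m i a j (s j) = a (s i) * ∏ j ∈ Finset.univ.erase i, m j (s j) := by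
  rw [← Finset.mul_prod_erase _ _ (Finset.mem_univ i)]
  congr 1
  · simp
  · refine Finset.prod_congr rfl fun j hj => ?_
    rw [Function.update_of_ne (Finset.ne_of_mem_erase hj)]

variable [∀ i, Fintype (S i)]

theorem sum_prod_eq_one (p : ∀ i, S i → ℝ) (hp : ∀ i, ∑ y, p i y = 1) :
    ∑ s : ∀ i, S i, ∏ i, p i (s i) = 1 := by
  rw [← Fintype.piFinset_univ, ← Finset.prod_univ_sum]
  simp [hp]

/-- The marginal of a product distribution. -/
theorem sum_prod_mul_coord (p : ∀ i, S i → ℝ) (hp : ∀ i, ∑ y, p i y = 1) (i : ι) (g : S i → ℝ) :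
    ∑ s : ∀ i, S i, (∏ j, p j (s j)) * g (s i) = ∑ y, p i y * g y := by
  have h : ∀ s : ∀ i, S i, (∏ j, p j (s j)) * g (s i) =
      ∏ j, Function.update p i (fun y => p i y * g y) j (s j) := by
    intro s
    rw [prod_update_apply, ← Finset.mul_prod_erase _ _ (Finset.mem_univ i)]
    ring
  simp_rw [h]
  rw [← Fintype.piFinset_univ, ← Finset.prod_univ_sum,
    ← Finset.mul_prod_erase _ _ (Finset.mem_univ i), Finset.prod_eq_one, mul_one]
  · simp
  · intro j hj
    rw [Function.update_of_ne (Finset.ne_of_mem_erase hj), hp]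

/-- Resampling one coordinate. -/
theorem sum_eq_sum_resample (i : ι) (c : S i → ℝ) (hc : ∑ y, c y = 1) (F : (∀ i, S i) → ℝ) :
    ∑ s, F s = ∑ s, c (s i) * ∑ y, F (Function.update s i y) := by
  have h : ∑ z : (∀ i, S i) × S i, c z.2 * F z.1 =
      ∑ z : (∀ i, S i) × S i, c (z.1 i) * F (Function.update z.1 i z.2) := by
    refine Finset.sum_bij' (fun z _ => (Function.update z.1 i z.2, z.1 i))
      (fun z _ => (Function.update z.1 i z.2, z.1 i)) ?_ ?_ ?_ ?_ ?_ <;> simp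
  rw [Fintype.sum_prod_type, Fintype.sum_prod_type] at h
  simp only [← Finset.mul_sum, ← Finset.sum_mul, hc, one_mul] at h
  exact h

/-- Changing one factor of a product distribution changes an expectation by at most the worst
change over the conditional expectations given the other coordinates. -/
theorem abs_sum_prod_update_sub_le (m : ∀ i, S i → ℝ) (hm : ∀ i y, 0 ≤ m i y)
    (hm1 : ∀ i, ∑ y, m i y = 1) (i : ι) (a : S i → ℝ) (h : (∀ i, S i) → ℝ) (ε : ℝ)
    (hε : ∀ s, |∑ y, (a y - m i y) * h (Function.update s i y)| ≤ ε) :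
    |∑ s, (∏ j, Function.update m i a j (s j)) * h s - ∑ s, (∏ j, m j (s j)) * h s| ≤ ε := by
  have h1 : ∑ s, (∏ j, Function.update m i a j (s j)) * h s - ∑ s, (∏ j, m j (s j)) * h s =
      ∑ s, (∏ j, m j (s j)) * ∑ y, (a y - m i y) * h (Function.update s i y) := by
    rw [← Finset.sum_sub_distrib, sum_eq_sum_resample i (m i) (hm1 i)]
    refine Finset.sum_congr rfl fun s _ => ?_
    rw [← Finset.mul_prod_erase _ _ (Finset.mem_univ i), mul_assoc]
    congr 1
    rw [Finset.mul_sum]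
    refine Finset.sum_congr rfl fun y _ => ?_
    rw [prod_update_apply, ← Finset.mul_prod_erase _ _ (Finset.mem_univ i)]
    have : ∏ j ∈ Finset.univ.erase i, m j (Function.update s i y j) =
        ∏ j ∈ Finset.univ.erase i, m j (s j) :=
      Finset.prod_congr rfl fun j hj => by
        rw [Function.update_of_ne (Finset.ne_of_mem_erase hj)]
    rw [this, Function.update_self]
    ring
  rw [h1]
  refine (Finset.abs_sum_le_sum_abs _ _).trans ?_
  calc _ ≤ ∑ s : ∀ i, S i, (∏ j, m j (s j)) * ε := by
        refine Finset.sum_le_sum fun s _ => ?_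
        have h0 : 0 ≤ ∏ j, m j (s j) := Finset.prod_nonneg fun j _ => hm j _
        rw [abs_mul, abs_of_nonneg h0]
        exact mul_le_mul_of_nonneg_left (hε s) h0
    _ = ε := by rw [← Finset.sum_mul, sum_prod_eq_one m hm1, one_mul]

/-- Hybrid argument: the factors of a product distribution are exchanged one after the other. -/
theorem abs_sum_prod_sub_le (p q : ∀ i, S i → ℝ) (hp : ∀ i y, 0 ≤ p i y)
    (hp1 : ∀ i, ∑ y, p i y = 1) (hq : ∀ i y, 0 ≤ q i y) (hq1 : ∀ i, ∑ y, q i y = 1)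
    (h : (∀ i, S i) → ℝ) (ε : ι → ℝ)
    (hε : ∀ i s, |∑ y, (p i y - q i y) * h (Function.update s i y)| ≤ ε i) :
    |∑ s, (∏ j, p j (s j)) * h s - ∑ s, (∏ j, q j (s j)) * h s| ≤ ∑ i, ε i := by
  let mix : Finset ι → ∀ i, S i → ℝ := fun F i => if i ∈ F then p i else q i
  have key : ∀ F : Finset ι,
      |∑ s, (∏ j, mix F j (s j)) * h s - ∑ s, (∏ j, q j (s j)) * h s| ≤ ∑ i ∈ F, ε i := by
    intro F
    induction F using Finset.induction_on with
    | empty => simp [mix]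
    | insert i F hi ih =>
      have h1 : mix (insert i F) = Function.update (mix F) i (p i) := by
        funext j
        by_cases hj : j = i
        · subst hj; simp [mix]
        · simp [mix, hj]
      have h2 := abs_sum_prod_update_sub_le (mix F)
        (fun j y => by by_cases hj : j ∈ F <;> simp [mix, hj, hp, hq])
        (fun j => by by_cases hj : j ∈ F <;> simp [mix, hj, hp1, hq1]) i (p i) h (ε i)
        (fun s => by simpa [mix, hi] using hε i s)
      rw [Finset.sum_insert hi, h1]
      refine (abs_sub_le _ (∑ s, (∏ j, mix F j (s j)) * h s) _).trans ?_
      exact add_le_add h2 ih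
  simpa [mix] using key Finset.univ

end Product

/-! ### Lipschitz test functions on a finite metric space -/

/-- A discrete form of `W₁(p, q) = ∫ |F_p - F_q|`: if a finite metric space has at most `M` points or
embeds into the line, then finitely many `[0, 1]`-valued test functions `u l` with weights `w l` of
total mass at most `max M 1` times the diameter control the integrals of all Lipschitz functions
against signed measures `d` of mass zero. On the line, `u l` are the indicators of initial segments
and `w l` the gaps between consecutive points, so that the total weight is free of the number of
points. -/
theorem exists_testFunctions {X : Type*} [Fintype X] [Nonempty X] [MetricSpace X] (M : ℕ)
    (hX : Fintype.card X ≤ M ∨ ∃ e : X → ℝ, Isometry e) :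
    ∃ (N : ℕ) (u : ℕ → X → ℝ) (w : ℕ → ℝ), (∀ l x, 0 ≤ u l x ∧ u l x ≤ 1) ∧ (∀ l, 0 ≤ w l) ∧
      ∑ l ∈ Finset.range N, w l ≤ ((M : ℝ) + 1) * Metric.diam (Set.univ : Set X) ∧
      ∀ (g : X → ℝ) (L : ℝ), 0 ≤ L → (∀ x y, |g x - g y| ≤ L * dist x y) →
        ∀ d : X → ℝ, ∑ x, d x = 0 →
          |∑ x, d x * g x| ≤ L * ∑ l ∈ Finset.range N, w l * |∑ x, d x * u l x| := by
  classical
  have hdist : ∀ x y : X, dist x y ≤ Metric.diam (Set.univ : Set X) := fun x y =>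
    Metric.dist_le_diam_of_mem (Set.toFinite _).isBounded (Set.mem_univ _) (Set.mem_univ _)
  rcases hX with hX | ⟨e, he⟩
  · let φ := Fintype.equivFin X
    let D := Metric.diam (Set.univ : Set X)
    have hD : 0 ≤ D := Metric.diam_nonneg
    refine ⟨Fintype.card X, fun l x => if (φ x : ℕ) = l then 1 else 0, fun _ => D, ?_, ?_, ?_, ?_⟩
    · intro l x; dsimp only; split_ifs <;> norm_num
    · intro _; exact hD
    · simp only [Finset.sum_const, Finset.card_range, nsmul_eq_mul]
      refine mul_le_mul_of_nonneg_right ?_ hD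
      have : (Fintype.card X : ℝ) ≤ M := by exact_mod_cast hX
      linarith
    · intro g L hL hg d hd
      obtain ⟨x₀⟩ := ‹Nonempty X›
      have h1 : ∑ x, d x * g x = ∑ x, d x * (g x - g x₀) := by
        simp only [mul_sub, Finset.sum_sub_distrib, ← Finset.sum_mul, hd]; ring
      have h2 : ∑ l ∈ Finset.range (Fintype.card X),
          D * |∑ x, d x * (if (φ x : ℕ) = l then (1 : ℝ) else 0)| = ∑ x, D * |d x| := by
        rw [Finset.sum_range, ← φ.sum_comp]
        refine Finset.sum_congr rfl fun x _ => ?_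
        congr 2
        rw [Finset.sum_eq_single x]
        · simp
        · intro y _ hy
          rw [if_neg, mul_zero]
          intro h
          exact hy (φ.injective (Fin.ext h))
        · simp
      rw [h1, h2, Finset.mul_sum]
      refine (Finset.abs_sum_le_sum_abs _ _).trans (Finset.sum_le_sum fun x _ => ?_)
      rw [abs_mul]
      calc |d x| * |g x - g x₀| ≤ |d x| * (L * D) := by
            gcongr
            exact (hg x x₀).trans (mul_le_mul_of_nonneg_left (hdist x x₀) hL)
        _ = L * (D * |d x|) := by ring
  · let _ : LinearOrder X := LinearOrder.lift' e he.injective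
    let φ : Fin (Fintype.card X) ≃o X := Fintype.orderIsoFinOfCardEq X rfl
    have hc : 0 < Fintype.card X := Fintype.card_pos
    -- The points in increasing order; beyond the last one the sequence is constant.
    let y : ℕ → X := fun j => φ ⟨min j (Fintype.card X - 1), by omega⟩
    have hy : Monotone y := fun a b hab => φ.monotone (by
      rw [Fin.mk_le_mk]; exact min_le_min_right _ hab)
    have hey : ∀ j, e (y j) ≤ e (y (j + 1)) := fun j => hy (Nat.le_succ j)
    have hyφ : ∀ j (hj : j < Fintype.card X), y j = φ ⟨j, hj⟩ := fun j hj => by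
      simp only [y]; congr 2; omega
    have hsum : ∀ (N : ℕ) (_ : N ≤ Fintype.card X) (F : X → ℝ), ∑ j ∈ Finset.range N, F (y j) =
        ∑ x, F x * (if (φ.symm x : ℕ) < N then 1 else 0) := by
      intro N hN F
      have h1 : ∑ j ∈ Finset.range N, F (y j) =
          ∑ j ∈ Finset.range (Fintype.card X), if j < N then F (y j) else 0 := by
        rw [← Finset.sum_filter]
        refine Finset.sum_congr ?_ fun _ _ => rfl
        ext j; simp only [Finset.mem_range, Finset.mem_filter]; omega
      rw [h1, Finset.sum_range, ← φ.toEquiv.sum_comp]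
      simp only [RelIso.coe_fn_toEquiv, OrderIso.symm_apply_apply, mul_ite, mul_one, mul_zero]
      refine Finset.sum_congr rfl fun j _ => ?_
      rw [hyφ j j.2]
    refine ⟨Fintype.card X - 1, fun l x => if (φ.symm x : ℕ) < l + 1 then 1 else 0,
      fun l => e (y (l + 1)) - e (y l), ?_, ?_, ?_, ?_⟩
    · intro l x; dsimp only; split_ifs <;> norm_num
    · intro l; exact sub_nonneg.2 (hey l)
    · rw [Finset.sum_range_sub (fun l => e (y l))]
      have h1 : e (y (Fintype.card X - 1)) - e (y 0) ≤ Metric.diam (Set.univ : Set X) :=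
        (le_abs_self _).trans ((Real.dist_eq _ _).symm.le.trans
          ((he.dist_eq _ _).le.trans (hdist _ _)))
      have h2 : (0 : ℝ) ≤ M := Nat.cast_nonneg M
      have h3 : 0 ≤ Metric.diam (Set.univ : Set X) := Metric.diam_nonneg
      nlinarith
    · intro g L hL hg d hd
      have h1 : ∑ x, d x * g x = ∑ j ∈ Finset.range (Fintype.card X), g (y j) * d (y j) := by
        rw [hsum _ le_rfl fun x => g x * d x]
        refine Finset.sum_congr rfl fun x _ => ?_
        rw [if_pos (φ.symm x).2]; ring
      have h2 : ∑ j ∈ Finset.range (Fintype.card X), d (y j) = 0 := by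
        rw [hsum _ le_rfl d, ← hd]
        refine Finset.sum_congr rfl fun x _ => ?_
        rw [if_pos (φ.symm x).2, mul_one]
      have h3 := Finset.sum_range_by_parts (fun j => g (y j)) (fun j => d (y j)) (Fintype.card X)
      simp only [smul_eq_mul, h2, mul_zero, zero_sub] at h3
      rw [h1, h3, abs_neg, Finset.mul_sum]
      refine (Finset.abs_sum_le_sum_abs _ _).trans (Finset.sum_le_sum fun l hl => ?_)
      have hl' : l + 1 ≤ Fintype.card X := by
        have := Finset.mem_range.1 hl; omega
      rw [abs_mul, hsum (l + 1) hl' d, ← mul_assoc]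
      refine mul_le_mul_of_nonneg_right ?_ (abs_nonneg _)
      refine (hg _ _).trans (le_of_eq ?_)
      rw [← he.dist_eq, Real.dist_eq, abs_of_nonneg (sub_nonneg.2 (hey l))]

/-! ### Contraction by the ergodicity coefficient -/

section Ergodicity

variable {X : Type*} [Fintype X] {Q : X → X → ℝ}

theorem one_sub_ergodicityCoeff_le (Q : X → X → ℝ) (x x' : X) :
    1 - ergodicityCoeff Q ≤ ∑ z, min (Q x z) (Q x' z) := by
  have h1 : (⨅ x : X, ⨅ x' : X, ∑ z, min (Q x z) (Q x' z)) ≤ ⨅ x' : X, ∑ z, min (Q x z) (Q x' z) :=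
    ciInf_le (Set.finite_range _).bddBelow x
  have h2 : (⨅ x' : X, ∑ z, min (Q x z) (Q x' z)) ≤ ∑ z, min (Q x z) (Q x' z) :=
    ciInf_le (Set.finite_range _).bddBelow x'
  unfold ergodicityCoeff
  linarith

theorem ergodicityCoeff_nonneg [Nonempty X] (hQ1 : ∀ x, ∑ y, Q x y = 1) :
    0 ≤ ergodicityCoeff Q := by
  obtain ⟨x⟩ := ‹Nonempty X›
  have := one_sub_ergodicityCoeff_le Q x x
  simp only [min_self, hQ1] at this
  linarith

/-- The transition matrix shrinks the oscillation of a function by its ergodicity coefficient. -/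
theorem expectNext_sub_le (hQ1 : ∀ x, ∑ y, Q x y = 1) {lam : ℝ}
    (hlam : ergodicityCoeff Q ≤ lam) (f : X → ℝ) {D : ℝ} (hD : ∀ x x', f x - f x' ≤ D) (x x' : X) :
    expectNext Q f x - expectNext Q f x' ≤ lam * D := by
  set c := ∑ z, min (Q x z) (Q x' z) with hc
  have hclam : 1 - lam ≤ c := by linarith [one_sub_ergodicityCoeff_le Q x x']
  obtain ⟨y, -, hy⟩ := Finset.exists_min_image Finset.univ f ⟨x, Finset.mem_univ x⟩
  have hy' : ∀ z, f y ≤ f z := fun z => hy z (Finset.mem_univ z)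
  have h0D : 0 ≤ D := by simpa using hD x x
  have h1 : expectNext Q f x - expectNext Q f x' =
      ∑ z, (Q x z - min (Q x z) (Q x' z)) * (f z - f y)
        - ∑ z, (Q x' z - min (Q x z) (Q x' z)) * (f z - f y) := by
    have e1 : ∑ z, Q x z * f y = f y := by rw [← Finset.sum_mul, hQ1, one_mul]
    have e2 : ∑ z, Q x' z * f y = f y := by rw [← Finset.sum_mul, hQ1, one_mul]
    simp only [sub_mul, mul_sub, Finset.sum_sub_distrib, e1, e2, expectNext]
    ring
  have h2 : 0 ≤ ∑ z, (Q x' z - min (Q x z) (Q x' z)) * (f z - f y) :=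
    Finset.sum_nonneg fun z _ => mul_nonneg (sub_nonneg.2 (min_le_right _ _)) (sub_nonneg.2 (hy' z))
  have h3 : ∑ z, (Q x z - min (Q x z) (Q x' z)) * (f z - f y) ≤
      ∑ z, (Q x z - min (Q x z) (Q x' z)) * D :=
    Finset.sum_le_sum fun z _ => mul_le_mul_of_nonneg_left (hD z y) (sub_nonneg.2 (min_le_left _ _))
  rw [← Finset.sum_mul, Finset.sum_sub_distrib, hQ1, ← hc] at h3
  nlinarith

/-- A solution of the Bellman equation oscillates by at most the oscillation of the reward divided
by one minus the ergodicity coefficient. -/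
theorem bellman_sub_le (hQ1 : ∀ x, ∑ y, Q x y = 1) {lam : ℝ}
    (hlam : ergodicityCoeff Q ≤ lam) (hlam1 : lam < 1) {V ρ : X → ℝ} {J R : ℝ}
    (hR : ∀ x x', ρ x - ρ x' ≤ R) (hV : ∀ x, J + V x = ρ x + expectNext Q V x) (x x' : X) :
    V x - V x' ≤ R / (1 - lam) := by
  have hne : (Finset.univ : Finset X).Nonempty := ⟨x, Finset.mem_univ x⟩
  obtain ⟨a, -, ha⟩ := Finset.exists_max_image Finset.univ V hne
  obtain ⟨b, -, hb⟩ := Finset.exists_min_image Finset.univ V hne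
  have hab : ∀ y y', V y - V y' ≤ V a - V b := fun y y' =>
    sub_le_sub (ha y (Finset.mem_univ y)) (hb y' (Finset.mem_univ y'))
  have h1 := expectNext_sub_le hQ1 hlam V hab a b
  have h2 := hR a b
  have h3 : V a - V b ≤ R / (1 - lam) := by
    rw [le_div_iff₀ (by linarith)]
    nlinarith [hV a, hV b]
  exact (hab x x').trans h3

/-- The differences of a solution of the Bellman equation are limits of differences of expected
total rewards. In particular they are determined by the transition matrix and the reward. -/
theorem tendsto_bellman_sub [Nonempty X] (hQ1 : ∀ x, ∑ y, Q x y = 1)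
    (hlam : ergodicityCoeff Q < 1) {V ρ : X → ℝ} {J : ℝ}
    (hV : ∀ x, J + V x = ρ x + expectNext Q V x) (x x' : X) :
    Tendsto (fun T : ℕ => ∑ t ∈ Finset.range T,
      ((expectNext Q)^[t] ρ x - (expectNext Q)^[t] ρ x')) atTop (nhds (V x - V x')) := by
  set lam := ergodicityCoeff Q
  have hlam0 : 0 ≤ lam := ergodicityCoeff_nonneg hQ1
  obtain ⟨D, hD⟩ : ∃ D, ∀ x x', V x - V x' ≤ D := by
    obtain ⟨D, hD⟩ := (Set.finite_range fun z : X × X => V z.1 - V z.2).bddAbove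
    exact ⟨D, fun x x' => hD ⟨(x, x'), rfl⟩⟩
  have hit : ∀ t : ℕ, ∀ x x', (expectNext Q)^[t] V x - (expectNext Q)^[t] V x' ≤ lam ^ t * D := by
    intro t
    induction t with
    | zero => simpa using hD
    | succ t ih =>
      intro x x'
      rw [Function.iterate_succ_apply', pow_succ', mul_assoc]
      exact expectNext_sub_le hQ1 le_rfl _ ih x x'
  have hstep : ∀ t : ℕ, ∀ x, (expectNext Q)^[t] V x + J =
      (expectNext Q)^[t] ρ x + (expectNext Q)^[t + 1] V x := by
    intro t
    induction t with
    | zero => intro x; simpa [add_comm] using hV x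
    | succ t ih =>
      intro x
      have h1 := congrArg (fun f => expectNext Q f x) (funext ih)
      simp only [expectNext, mul_add, Finset.sum_add_distrib, ← Finset.sum_mul, hQ1, one_mul] at h1
      rw [Function.iterate_succ_apply', Function.iterate_succ_apply',
        Function.iterate_succ_apply' _ (t + 1)]
      exact h1
  have hsum : ∀ T : ℕ, ∑ t ∈ Finset.range T,
      ((expectNext Q)^[t] ρ x - (expectNext Q)^[t] ρ x') =
        V x - V x' - ((expectNext Q)^[T] V x - (expectNext Q)^[T] V x') := by
    intro T
    induction T with
    | zero => simp
    | succ T ih =>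
      rw [Finset.sum_range_succ, ih]
      linarith [hstep T x, hstep T x']
  have hlim : Tendsto (fun T : ℕ => (expectNext Q)^[T] V x - (expectNext Q)^[T] V x')
      atTop (nhds 0) := by
    have h0 : Tendsto (fun t : ℕ => lam ^ t * D) atTop (nhds 0) := by
      simpa using (tendsto_pow_atTop_nhds_zero_of_lt_one hlam0 hlam).mul_const D
    refine tendsto_of_tendsto_of_tendsto_of_le_of_le (by simpa using h0.neg) h0 ?_
      fun t => hit t x x'
    intro t
    have := hit t x' x
    dsimp only
    linarith
  simp_rw [hsum]
  simpa using tendsto_const_nhds.sub hlim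

end Ergodicity

/-! ### Visits and episodes along a history -/

section Episodes

variable {n : ℕ} {S : Fin n → Type u}

@[simp]
theorem visits_nil (i : Fin n) (x : S i) (b : Bool) :
    visits ([] : List ((∀ i, S i) × (Fin n → Bool))) i x b = 0 := rfl

open Classical in
theorem visits_cons (z : (∀ i, S i) × (Fin n → Bool)) (l : List ((∀ i, S i) × (Fin n → Bool)))
    (i : Fin n) (x : S i) (b : Bool) :
    visits (z :: l) i x b = visits l i x b + if z.1 i = x ∧ z.2 i = b then 1 else 0 := by
  unfold visits
  rw [List.countP_cons]
  simp

theorem visits_le_cons (z : (∀ i, S i) × (Fin n → Bool)) (l : List ((∀ i, S i) × (Fin n → Bool)))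
    (i : Fin n) (x : S i) (b : Bool) : visits l i x b ≤ visits (z :: l) i x b := by
  rw [visits_cons]; exact Nat.le_add_right _ _

theorem visits_le_length (l : List ((∀ i, S i) × (Fin n → Bool))) (i : Fin n) (x : S i)
    (b : Bool) : visits l i x b ≤ l.length :=
  List.countP_le_length

theorem sum_visits [∀ i, Fintype (S i)] (l : List ((∀ i, S i) × (Fin n → Bool))) (i : Fin n) :
    ∑ z : S i × Bool, visits l i z.1 z.2 = l.length := by
  classical
  induction l with
  | nil => simp
  | cons z l ih =>
    simp only [visits_cons, Finset.sum_add_distrib, ih, List.length_cons]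
    congr 1
    rw [Finset.sum_eq_single (z.1 i, z.2 i)]
    · simp
    · rintro ⟨x, b⟩ - h
      rw [if_neg]
      rintro ⟨rfl, rfl⟩
      exact h rfl
    · simp

theorem sum_sqrt_visits_le [∀ i, Fintype (S i)] (l : List ((∀ i, S i) × (Fin n → Bool)))
    (i : Fin n) :
    ∑ z : S i × Bool, √(visits l i z.1 z.2 : ℝ) ≤ √(2 * Fintype.card (S i) * l.length) := by
  refine Real.le_sqrt_of_sq_le ((sq_sum_le_card_mul_sum_sq).trans (le_of_eq ?_))
  simp only [Real.sq_sqrt (Nat.cast_nonneg _)]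
  rw [← Nat.cast_sum, sum_visits]
  rw [Finset.card_univ, Fintype.card_prod, Fintype.card_bool]
  push_cast
  ring

/-- A new episode starts at the time that follows the past `l`. -/
def StartsAt (l : List ((∀ i, S i) × (Fin n → Bool))) : Prop :=
  (episodeAt l).start = l.length + 1

/-- The second criterion of the stopping rule: some visit count has more than doubled. -/
def Episode.Doubles (e : Episode S) (l : List ((∀ i, S i) × (Fin n → Bool))) : Prop :=
  ∃ (i : Fin n) (x : S i) (b : Bool), 2 * visits e.past i x b < visits l i x b

theorem episodeAt_cons_of_stops {z : (∀ i, S i) × (Fin n → Bool)}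
    {l : List ((∀ i, S i) × (Fin n → Bool))} (h : (episodeAt l).Stops (z :: l)) :
    episodeAt (z :: l) =
      ⟨(z :: l).length + 1, (z :: l).length + 1 - (episodeAt l).start, z :: l⟩ := by
  rw [episodeAt, if_pos h]

theorem episodeAt_cons_of_not_stops {z : (∀ i, S i) × (Fin n → Bool)}
    {l : List ((∀ i, S i) × (Fin n → Bool))} (h : ¬ (episodeAt l).Stops (z :: l)) :
    episodeAt (z :: l) = episodeAt l := by
  rw [episodeAt, if_neg h]

theorem one_le_episodeAt_start (l : List ((∀ i, S i) × (Fin n → Bool))) :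
    1 ≤ (episodeAt l).start := by
  induction l with
  | nil => rfl
  | cons z l ih =>
    by_cases h : (episodeAt l).Stops (z :: l)
    · rw [episodeAt_cons_of_stops h]; simp
    · rwa [episodeAt_cons_of_not_stops h]

theorem episodeAt_start_le (l : List ((∀ i, S i) × (Fin n → Bool))) :
    (episodeAt l).start ≤ l.length + 1 := by
  induction l with
  | nil => rfl
  | cons z l ih =>
    by_cases h : (episodeAt l).Stops (z :: l)
    · rw [episodeAt_cons_of_stops h]
    · rw [episodeAt_cons_of_not_stops h, List.length_cons]; omega

theorem startsAt_nil : StartsAt ([] : List ((∀ i, S i) × (Fin n → Bool))) := rfl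

theorem startsAt_cons_iff (z : (∀ i, S i) × (Fin n → Bool))
    (l : List ((∀ i, S i) × (Fin n → Bool))) :
    StartsAt (z :: l) ↔ (episodeAt l).Stops (z :: l) := by
  constructor
  · intro h
    by_contra h'
    have := episodeAt_start_le l
    rw [StartsAt, episodeAt_cons_of_not_stops h', List.length_cons] at h
    omega
  · intro h
    rw [StartsAt, episodeAt_cons_of_stops h]

theorem length_lt_start_add_prevLen (l : List ((∀ i, S i) × (Fin n → Bool))) :
    l.length + 1 ≤ (episodeAt l).start + (episodeAt l).prevLen := by
  cases l with
  | nil => simp [episodeAt]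
  | cons z l =>
    by_cases h : (episodeAt l).Stops (z :: l)
    · rw [episodeAt_cons_of_stops h]; simp
    · rw [episodeAt_cons_of_not_stops h]
      by_contra h'
      exact h (Or.inl (by omega))

/-- During an episode no visit count is more than twice its value at the start of the episode. -/
theorem visits_le_two_mul (l : List ((∀ i, S i) × (Fin n → Bool))) (i : Fin n) (x : S i)
    (b : Bool) : visits l i x b ≤ 2 * visits (episodeAt l).past i x b := by
  cases l with
  | nil => simp
  | cons z l =>
    by_cases h : (episodeAt l).Stops (z :: l)
    · rw [episodeAt_cons_of_stops h]; dsimp only; omega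
    · rw [episodeAt_cons_of_not_stops h]
      by_contra h'
      exact h (Or.inr ⟨i, x, b, by omega⟩)

theorem visits_episodeAt_past_le (l : List ((∀ i, S i) × (Fin n → Bool))) (i : Fin n) (x : S i)
    (b : Bool) : visits (episodeAt l).past i x b ≤ visits l i x b := by
  induction l with
  | nil => rfl
  | cons z l ih =>
    by_cases h : (episodeAt l).Stops (z :: l)
    · rw [episodeAt_cons_of_stops h]
    · rw [episodeAt_cons_of_not_stops h]
      exact ih.trans (visits_le_cons z l i x b)

open Classical in
/-- The number of episodes, after the first one, that start at or before the time after `l`. -/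
noncomputable def numStarts : List ((∀ i, S i) × (Fin n → Bool)) → ℕ
  | [] => 0
  | z :: l => numStarts l + if StartsAt (z :: l) then 1 else 0

open Classical in
/-- The number of episodes that end because a visit count has doubled. -/
noncomputable def numDoublings : List ((∀ i, S i) × (Fin n → Bool)) → ℕ
  | [] => 0
  | z :: l => numDoublings l + if (episodeAt l).Doubles (z :: l) then 1 else 0

theorem numStarts_le_length (l : List ((∀ i, S i) × (Fin n → Bool))) :
    numStarts l ≤ l.length := by
  induction l with
  | nil => rfl
  | cons z l ih =>
    rw [numStarts, List.length_cons]
    split_ifs <;> omega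

/-- An episode that ends without a doubling is longer than the one before. Between doublings at
most `k` episodes are therefore shorter than `k`, and every other episode takes `k` time units. -/
theorem mul_numStarts_le (k : ℕ) (l : List ((∀ i, S i) × (Fin n → Bool))) :
    k * numStarts l + 1 ≤ (episodeAt l).start + k * k * numDoublings l +
      k * min (episodeAt l).prevLen k := by
  induction l with
  | nil => simp [numStarts, episodeAt]
  | cons z l ih =>
    have hs := episodeAt_start_le l
    have h1 := one_le_episodeAt_start l
    by_cases h : (episodeAt l).Stops (z :: l)
    · have hst : StartsAt (z :: l) := (startsAt_cons_iff z l).2 h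
      rw [numStarts, if_pos hst, numDoublings, episodeAt_cons_of_stops h]
      dsimp only
      simp only [List.length_cons]
      set s := (episodeAt l).start
      set p := (episodeAt l).prevLen
      obtain ⟨q, hq⟩ : ∃ q, l.length + 1 + 1 = s + q := ⟨_, (Nat.add_sub_of_le (by omega)).symm⟩
      rw [hq, Nat.add_sub_cancel_left]
      have hq1 : 1 ≤ q := by omega
      by_cases hd : (episodeAt l).Doubles (z :: l)
      · rw [if_pos hd]
        have h2 : k * min p k ≤ k * k := Nat.mul_le_mul_left k (min_le_right _ _)
        have h3 : k ≤ q + k * min q k := by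
          rcases Nat.eq_zero_or_pos k with rfl | hk
          · omega
          · have : k * 1 ≤ k * min q k := Nat.mul_le_mul_left k (le_min hq1 hk)
            omega
        have h4 : k * (numStarts l + 1) = k * numStarts l + k := by ring
        have h5 : k * k * (numDoublings l + 1) = k * k * numDoublings l + k * k := by ring
        omega
      · rw [if_neg hd]
        have hp : p + 1 ≤ q := by
          rcases h with h | h
          · rw [List.length_cons] at h; omega
          · exact absurd h hd
        have h3 : k + k * min p k ≤ q + k * min q k := by
          rcases le_or_gt k p with hk | hk
          · rw [min_eq_right hk, min_eq_right (by omega)]; omega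
          · have h6 : min p k + 1 ≤ min q k := by omega
            have h7 := Nat.mul_le_mul_left k h6
            have h8 : k * (min p k + 1) = k * min p k + k := by ring
            omega
        have h4 : k * (numStarts l + 1) = k * numStarts l + k := by ring
        rw [add_zero]
        omega
    · have hst : ¬ StartsAt (z :: l) := fun h' => h ((startsAt_cons_iff z l).1 h')
      have : k * k * numDoublings l ≤ k * k * numDoublings (z :: l) :=
        Nat.mul_le_mul_left _ (by rw [numDoublings]; exact Nat.le_add_right _ _)
      rw [numStarts, if_neg hst, episodeAt_cons_of_not_stops h, add_zero]
      omega

theorem size_add_one_le_size {a b : ℕ} (h : 2 * a < b) : a.size + 1 ≤ b.size := by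
  by_contra h'
  have h1 : b.size ≤ a.size := by omega
  rcases Nat.eq_zero_or_pos a with rfl | ha
  · have : 0 < b.size := Nat.size_pos.2 (by omega)
    simp at h1; omega
  · have hpos : 0 < a.size := Nat.size_pos.2 ha
    have h2 : 2 ^ (a.size - 1) ≤ a := Nat.lt_size.1 (by omega)
    have h3 : b < 2 ^ a.size := Nat.size_le.1 h1
    have h4 : 2 ^ a.size = 2 * 2 ^ (a.size - 1) := by
      rw [← pow_succ']; congr 1; omega
    omega

/-- Each doubling adds a binary digit to some visit count. -/
theorem numDoublings_le_sum_size [∀ i, Fintype (S i)] (l : List ((∀ i, S i) × (Fin n → Bool))) :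
    numDoublings l ≤ ∑ i, ∑ z : S i × Bool, (visits (episodeAt l).past i z.1 z.2).size := by
  induction l with
  | nil => simp [numDoublings]
  | cons z l ih =>
    have hmono : ∀ (i : Fin n) (w : S i × Bool), (visits (episodeAt l).past i w.1 w.2).size ≤
        (visits (z :: l) i w.1 w.2).size := fun i w =>
      Nat.size_le_size ((visits_episodeAt_past_le l i _ _).trans (visits_le_cons z l i _ _))
    by_cases hd : (episodeAt l).Doubles (z :: l)
    · have h : (episodeAt l).Stops (z :: l) := Or.inr hd
      rw [numDoublings, if_pos hd, episodeAt_cons_of_stops h]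
      obtain ⟨i, x, b, hxb⟩ := hd
      refine (Nat.succ_le_succ ih).trans ?_
      refine Nat.succ_le_of_lt (Finset.sum_lt_sum
        (fun j _ => Finset.sum_le_sum fun w _ => hmono j w) ⟨i, Finset.mem_univ i, ?_⟩)
      exact Finset.sum_lt_sum (fun w _ => hmono i w)
        ⟨(x, b), Finset.mem_univ _, size_add_one_le_size hxb⟩
    · rw [numDoublings, if_neg hd, add_zero]
      by_cases h : (episodeAt l).Stops (z :: l)
      · rw [episodeAt_cons_of_stops h]
        exact ih.trans (Finset.sum_le_sum fun j _ => Finset.sum_le_sum fun w _ => hmono j w)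
      · rwa [episodeAt_cons_of_not_stops h]

theorem size_le_two_mul_log {T : ℕ} (hT : 0 < T) : (T.size : ℝ) ≤ 2 * Real.log (3 * T) := by
  have hpos : 0 < T.size := Nat.size_pos.2 hT
  have h1 : 2 ^ (T.size - 1) ≤ T := Nat.lt_size.1 (by omega)
  have h2 : ((T.size - 1 : ℕ) : ℝ) * Real.log 2 ≤ Real.log T := by
    rw [← Real.log_pow]
    exact Real.log_le_log (by positivity) (by exact_mod_cast h1)
  have h3 : ((T.size - 1 : ℕ) : ℝ) = (T.size : ℝ) - 1 := by
    rw [Nat.cast_sub hpos, Nat.cast_one]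
  have hT' : (0 : ℝ) < T := by exact_mod_cast hT
  rw [Real.log_mul (by norm_num) hT'.ne']
  have h4 := Real.log_two_gt_d9
  have h5 : Real.log 2 ≤ Real.log 3 := Real.log_le_log (by norm_num) (by norm_num)
  have h6 : 0 ≤ Real.log T := Real.log_nonneg (by exact_mod_cast hT)
  rw [h3] at h2
  nlinarith

theorem one_le_log_three_mul {T : ℕ} (hT : 0 < T) : 1 ≤ Real.log (3 * T) := by
  have hT' : (1 : ℝ) ≤ T := by exact_mod_cast hT
  rw [Real.le_log_iff_exp_le (by positivity)]
  have := Real.exp_one_lt_d9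
  linarith

/-- The number of episodes up to time `T` is of order `√(S̄ T log T)`. -/
theorem numStarts_le_sqrt [∀ i, Fintype (S i)] (l : List ((∀ i, S i) × (Fin n → Bool))) {T : ℕ}
    (hT : 0 < T) (hl : l.length ≤ T) (hS : (1 : ℝ) ≤ ∑ i, (Fintype.card (S i) : ℝ)) :
    (numStarts l : ℝ) ≤
      3 * √(5 * (∑ i, (Fintype.card (S i) : ℝ)) * T * Real.log (3 * T)) := by
  set Sb := ∑ i, (Fintype.card (S i) : ℝ)
  set Lg := Real.log (3 * T)
  have hLg : 1 ≤ Lg := one_le_log_three_mul hT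
  have hT' : (1 : ℝ) ≤ T := by exact_mod_cast hT
  have hSL : 1 ≤ Sb * Lg := one_le_mul_of_one_le_of_one_le hS hLg
  set A := 5 * (Sb * Lg) with hA
  have hA0 : 0 < A := by linarith
  have hAT : 5 * Sb * T * Lg = A * T := by rw [hA]; ring
  rw [hAT]
  have hD : (numDoublings l : ℝ) + 1 ≤ A := by
    have h1 : (numDoublings l : ℝ) ≤ ∑ i, ∑ _z : S i × Bool, 2 * Lg := by
      refine (Nat.cast_le.2 (numDoublings_le_sum_size l)).trans ?_
      push_cast
      refine Finset.sum_le_sum fun i _ => Finset.sum_le_sum fun z _ => ?_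
      refine le_trans ?_ (size_le_two_mul_log hT)
      exact_mod_cast Nat.size_le_size
        ((visits_episodeAt_past_le l i _ _).trans ((visits_le_length l i _ _).trans hl))
    have h2 : ∑ i, ∑ _z : S i × Bool, 2 * Lg = 4 * (Sb * Lg) := by
      simp only [Finset.sum_const, Finset.card_univ, Fintype.card_prod, Fintype.card_bool,
        nsmul_eq_mul, Sb, Finset.sum_mul, Finset.mul_sum]
      refine Finset.sum_congr rfl fun i _ => ?_
      push_cast; ring
    linarith
  rcases le_or_gt (T : ℝ) A with hTA | hTA
  · have h1 : (numStarts l : ℝ) ≤ T := by exact_mod_cast (numStarts_le_length l).trans hl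
    have h2 : (T : ℝ) ≤ √(A * T) := Real.le_sqrt_of_sq_le (by nlinarith)
    have h3 := Real.sqrt_nonneg (A * T)
    linarith
  · -- the cut-off length that balances the two terms
    set y := √(T / A) with hy
    have hy1 : 1 ≤ y := Real.one_le_sqrt.2 ((one_le_div hA0).2 hTA.le)
    have hyk : y ≤ ⌈y⌉₊ := Nat.le_ceil y
    have hky : (⌈y⌉₊ : ℝ) ≤ 2 * y := by
      have := Nat.ceil_lt_add_one (show 0 ≤ y by linarith)
      linarith
    set k := ⌈y⌉₊
    have hk0 : (0 : ℝ) < k := by linarith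
    have h1 := mul_numStarts_le k l
    have h2 := episodeAt_start_le l
    have h3 : k * min (episodeAt l).prevLen k ≤ k * k := Nat.mul_le_mul_left k (min_le_right _ _)
    have h4 : k * numStarts l ≤ T + k * k * (numDoublings l + 1) := by
      rw [mul_add, mul_one]; omega
    have h5 : (k : ℝ) * numStarts l ≤ T + k * k * A := by
      have : (k : ℝ) * numStarts l ≤ T + k * k * (numDoublings l + 1) := by exact_mod_cast h4
      refine this.trans ?_
      gcongr
    have hyy : y * y = T / A := Real.mul_self_sqrt (by positivity)
    have hs : √(A * T) = A * y := by
      rw [hy, Real.sqrt_eq_iff_mul_self_eq (by positivity) (by positivity)]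
      have : A * √(T / A) * (A * √(T / A)) = A * A * (y * y) := by rw [hy]; ring
      rw [this, hyy]; field_simp
    have hTy : (T : ℝ) = A * y * y := by rw [mul_assoc, hyy]; field_simp
    rw [hs]
    have h6 : (k : ℝ) * numStarts l ≤ k * (3 * (A * y)) := by
      have e1 : A * y * y ≤ A * y * k := mul_le_mul_of_nonneg_left hyk (by positivity)
      have e2 : (k : ℝ) * k * A ≤ k * (2 * y) * A := by gcongr
      nlinarith
    exact le_of_mul_le_mul_left h6 hk0

/-- The history at the start of the episode in force. -/
noncomputable def episodeHistory : List ((∀ i, S i) × (Fin n → Bool)) → (∀ i, S i) → History S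
  | [], s => ⟨[], s⟩
  | z :: l, s =>
    open Classical in
    if StartsAt (z :: l) then ⟨z :: l, s⟩ else episodeHistory l z.1

theorem episodeHistory_past (l : List ((∀ i, S i) × (Fin n → Bool))) (s : ∀ i, S i) :
    (episodeHistory l s).past = (episodeAt l).past := by
  induction l generalizing s with
  | nil => rfl
  | cons z l ih =>
    by_cases h : StartsAt (z :: l)
    · rw [episodeHistory, if_pos h, episodeAt_cons_of_stops ((startsAt_cons_iff z l).1 h)]
    · rw [episodeHistory, if_neg h, ih,
        episodeAt_cons_of_not_stops (fun h' => h ((startsAt_cons_iff z l).2 h'))]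

theorem episodeHistory_of_startsAt {l : List ((∀ i, S i) × (Fin n → Bool))} (s : ∀ i, S i)
    (h : StartsAt l) : episodeHistory l s = ⟨l, s⟩ := by
  cases l with
  | nil => rfl
  | cons z l => rw [episodeHistory, if_pos h]

end Episodes

open scoped ENNReal

/-! ### The state of the algorithm -/

section AlgState

variable {n : ℕ} {S : Fin n → Type u} [∀ i, Fintype (S i)]

instance : DiscreteMeasurableSpace (History S) := ⟨fun _ => trivial⟩

instance : Countable (History S) := by
  have h : Function.Injective fun h : History S => (h.past, h.cur) := by
    rintro ⟨l, s⟩ ⟨l', s'⟩ h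
    simpa using h
  exact h.countable

/-- The history after one more action and one more state. -/
def History.next (h : History S) (a : Fin n → Bool) (s' : ∀ i, S i) : History S :=
  ⟨(h.cur, a) :: h.past, s'⟩

variable {Θ : Fin n → Type v} [∀ i, MeasurableSpace (Θ i)]

/-- Since histories are countable, measurability of a function of the true parameter, the history
and the parameter in force can be checked for each history separately. -/
theorem measurable_of_forall_history {γ : Type*} [MeasurableSpace γ]
    {f : (∀ i, Θ i) × History S × (∀ i, Θ i) → γ}
    (hf : ∀ h, Measurable fun q : (∀ i, Θ i) × (∀ i, Θ i) => f (q.1, h, q.2)) : Measurable f := by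
  let F : History S × ((∀ i, Θ i) × (∀ i, Θ i)) → γ := fun z => f (z.2.1, z.1, z.2.2)
  have hF : Measurable F := measurable_from_prod_countable_right hf
  exact hF.fun_comp (by fun_prop : Measurable fun x : (∀ i, Θ i) × History S × (∀ i, Θ i) =>
    (x.2.1, (x.1, x.2.2)))

end AlgState

namespace RestlessBandit

variable {n : ℕ} {S : Fin n → Type u} [∀ i, Fintype (S i)]
  {Θ : Fin n → Type v} [∀ i, MeasurableSpace (Θ i)] (B : RestlessBandit S Θ)

theorem jointP_nonneg (θ : ∀ i, Θ i) (s : ∀ i, S i) (a : Fin n → Bool) (s' : ∀ i, S i) :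
    0 ≤ B.jointP θ s a s' := Finset.prod_nonneg fun i _ => B.P_nonneg i _ _ _ _

theorem sum_jointP (θ : ∀ i, Θ i) (s : ∀ i, S i) (a : Fin n → Bool) :
    ∑ s', B.jointP θ s a s' = 1 :=
  sum_prod_eq_one (fun i => B.P i (θ i) (s i) (a i)) fun i => B.P_sum i _ _ _

theorem measurable_jointP (s : ∀ i, S i) (a : Fin n → Bool) (s' : ∀ i, S i) :
    Measurable fun θ => B.jointP θ s a s' :=
  Finset.measurable_fun_prod _ fun i _ =>
    (B.P_measurable i (s i) (a i) (s' i)).fun_comp (measurable_pi_apply i)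

theorem sum_jointInit : ∑ s, B.jointInit s = 1 := sum_prod_eq_one B.init B.init_sum

theorem jointInit_nonneg (s : ∀ i, S i) : 0 ≤ B.jointInit s :=
  Finset.prod_nonneg fun i _ => B.init_nonneg i _

/-! ### Likelihoods and posteriors -/

instance (i : Fin n) : IsProbabilityMeasure (B.prior i) := B.prior_prob i

/-- The likelihood of the transitions of arm `i` along a history. -/
noncomputable def armLikelihood (i : Fin n) :
    List ((∀ i, S i) × (Fin n → Bool)) → (∀ i, S i) → Θ i → ℝ≥0∞
  | [], _ => fun _ => 1
  | (s, a) :: l, s' => fun θ =>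
      armLikelihood i l s θ * ENNReal.ofReal (B.P i θ (s i) (a i) (s' i))

/-- The unnormalized posterior of arm `i`. -/
noncomputable def armWeight (i : Fin n) (l : List ((∀ i, S i) × (Fin n → Bool))) (s : ∀ i, S i) :
    Measure (Θ i) :=
  (B.prior i).withDensity (B.armLikelihood i l s)

/-- The unnormalized posterior of the joint parameter. -/
noncomputable def jointWeight (l : List ((∀ i, S i) × (Fin n → Bool))) (s : ∀ i, S i) :
    Measure (∀ i, Θ i) :=
  (Measure.pi B.prior).withDensity fun θ => ∏ i, B.armLikelihood i l s (θ i)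

theorem P_le_one (i : Fin n) (θ : Θ i) (s : S i) (b : Bool) (s' : S i) : B.P i θ s b s' ≤ 1 := by
  rw [← B.P_sum i θ s b]
  exact Finset.single_le_sum (fun y _ => B.P_nonneg i θ s b y) (Finset.mem_univ s')

theorem measurable_armLikelihood (i : Fin n) (l : List ((∀ i, S i) × (Fin n → Bool)))
    (s : ∀ i, S i) : Measurable (B.armLikelihood i l s) := by
  induction l generalizing s with
  | nil => exact measurable_const
  | cons z l ih => exact (ih z.1).mul (B.P_measurable i _ _ _).ennreal_ofReal

theorem armLikelihood_le_one (i : Fin n) (l : List ((∀ i, S i) × (Fin n → Bool)))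
    (s : ∀ i, S i) (θ : Θ i) : B.armLikelihood i l s θ ≤ 1 := by
  induction l generalizing s with
  | nil => exact le_rfl
  | cons z l ih =>
    refine mul_le_one' (ih z.1) ?_
    rw [← ENNReal.ofReal_one]
    exact ENNReal.ofReal_le_ofReal (B.P_le_one i _ _ _ _)

theorem armWeight_univ_le_one (i : Fin n) (l : List ((∀ i, S i) × (Fin n → Bool)))
    (s : ∀ i, S i) : B.armWeight i l s Set.univ ≤ 1 := by
  rw [armWeight, withDensity_apply _ MeasurableSet.univ, Measure.restrict_univ]
  calc _ ≤ ∫⁻ _, 1 ∂(B.prior i) := lintegral_mono fun θ => B.armLikelihood_le_one i l s θ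
    _ = 1 := by simp

instance (i : Fin n) (l : List ((∀ i, S i) × (Fin n → Bool))) (s : ∀ i, S i) :
    IsFiniteMeasure (B.armWeight i l s) :=
  ⟨(B.armWeight_univ_le_one i l s).trans_lt ENNReal.one_lt_top⟩

theorem armWeight_cons (i : Fin n) (s : ∀ i, S i) (a : Fin n → Bool)
    (l : List ((∀ i, S i) × (Fin n → Bool))) (s' : ∀ i, S i) :
    B.armWeight i ((s, a) :: l) s' =
      (B.armWeight i l s).withDensity fun θ => ENNReal.ofReal (B.P i θ (s i) (a i) (s' i)) :=
  withDensity_mul _ (B.measurable_armLikelihood i l s) (B.P_measurable i _ _ _).ennreal_ofReal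

theorem jointWeight_cons (s : ∀ i, S i) (a : Fin n → Bool)
    (l : List ((∀ i, S i) × (Fin n → Bool))) (s' : ∀ i, S i) :
    B.jointWeight ((s, a) :: l) s' =
      (B.jointWeight l s).withDensity fun θ => ENNReal.ofReal (B.jointP θ s a s') := by
  unfold jointWeight
  rw [← withDensity_mul _ (Finset.measurable_fun_prod _ fun i _ =>
    (B.measurable_armLikelihood i l s).fun_comp (measurable_pi_apply i))
    (B.measurable_jointP s a s').ennreal_ofReal]
  congr 1
  funext θ
  rw [Pi.mul_apply, jointP, ENNReal.ofReal_prod_of_nonneg fun i _ => B.P_nonneg i _ _ _ _,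
    ← Finset.prod_mul_distrib]
  rfl

/-- The recursive posterior is the normalized likelihood-weighted prior. -/
theorem posterior_eq (i : Fin n) (l : List ((∀ i, S i) × (Fin n → Bool))) (s : ∀ i, S i) :
    B.posterior i l s = (B.armWeight i l s Set.univ)⁻¹ • B.armWeight i l s := by
  induction l generalizing s with
  | nil =>
    have : B.armWeight i [] s = B.prior i := by
      simp only [armWeight, armLikelihood]
      exact withDensity_one
    rw [this]; simp [posterior]
  | cons z l ih =>
    obtain ⟨s₀, a⟩ := z
    set W := B.armWeight i l s₀
    have hP : Measurable fun θ => ENNReal.ofReal (B.P i θ (s₀ i) (a i) (s i)) :=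
      (B.P_measurable i _ _ _).ennreal_ofReal
    have hW : W.withDensity (fun θ => ENNReal.ofReal (B.P i θ (s₀ i) (a i) (s i))) Set.univ =
        ∫⁻ θ, ENNReal.ofReal (B.P i θ (s₀ i) (a i) (s i)) ∂W := by
      rw [withDensity_apply _ MeasurableSet.univ, Measure.restrict_univ]
    rw [armWeight_cons, posterior, ih, bayesUpdate, withDensity_smul_measure,
      lintegral_smul_measure, hW, smul_smul, smul_eq_mul]
    rcases eq_or_ne (W Set.univ) 0 with h0 | h0
    · have : W = 0 := Measure.measure_univ_eq_zero.1 h0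
      simp [W, this]
    · congr 1
      have h1 : W Set.univ ≠ ∞ := measure_ne_top _ _
      rw [ENNReal.mul_inv (Or.inl (ENNReal.inv_ne_zero.2 h1)) (Or.inl (ENNReal.inv_ne_top.2 h0)),
        inv_inv, mul_comm, ← mul_assoc, ENNReal.inv_mul_cancel h0 h1, one_mul]

theorem posterior_univ_le_one (i : Fin n) (l : List ((∀ i, S i) × (Fin n → Bool)))
    (s : ∀ i, S i) : B.posterior i l s Set.univ ≤ 1 := by
  rw [posterior_eq, Measure.smul_apply, smul_eq_mul]
  exact ENNReal.inv_mul_le_one _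

instance (i : Fin n) (l : List ((∀ i, S i) × (Fin n → Bool))) (s : ∀ i, S i) :
    IsFiniteMeasure (B.posterior i l s) :=
  ⟨(B.posterior_univ_le_one i l s).trans_lt ENNReal.one_lt_top⟩

theorem armWeight_eq_smul_posterior (i : Fin n) (l : List ((∀ i, S i) × (Fin n → Bool)))
    (s : ∀ i, S i) : B.armWeight i l s = B.armWeight i l s Set.univ • B.posterior i l s := by
  rw [posterior_eq, smul_smul]
  rcases eq_or_ne (B.armWeight i l s Set.univ) 0 with h0 | h0
  · rw [Measure.measure_univ_eq_zero.1 h0, smul_zero]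
  · rw [ENNReal.mul_inv_cancel h0 (measure_ne_top _ _), one_smul]

/-- The arms are independent under the joint posterior. -/
theorem jointWeight_eq_smul_pi (l : List ((∀ i, S i) × (Fin n → Bool))) (s : ∀ i, S i) :
    B.jointWeight l s = (∏ i, B.armWeight i l s Set.univ) •
      Measure.pi fun i => B.posterior i l s := by
  have h1 : Measure.pi (fun i => B.armWeight i l s) = B.jointWeight l s := by
    refine Measure.pi_eq fun A hA => ?_
    rw [jointWeight, withDensity_apply _ (MeasurableSet.univ_pi hA),
      ← lintegral_indicator (MeasurableSet.univ_pi hA)]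
    have h2 : ∀ θ : ∀ i, Θ i, (Set.univ.pi A).indicator
        (fun θ => ∏ i, B.armLikelihood i l s (θ i)) θ =
          ∏ i, (A i).indicator (B.armLikelihood i l s) (θ i) := by
      intro θ
      by_cases hθ : θ ∈ Set.univ.pi A
      · rw [Set.indicator_of_mem hθ]
        exact Finset.prod_congr rfl fun i _ => (Set.indicator_of_mem (hθ i trivial) _).symm
      · rw [Set.indicator_of_notMem hθ]
        simp only [Set.mem_univ_pi, not_forall] at hθ
        obtain ⟨i, hi⟩ := hθ
        exact (Finset.prod_eq_zero (Finset.mem_univ i) (Set.indicator_of_notMem hi _)).symm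
    simp_rw [h2]
    have hm : ∀ i, Measurable ((A i).indicator (B.armLikelihood i l s)) := fun i =>
      (B.measurable_armLikelihood i l s).indicator (hA i)
    have hind : ProbabilityTheory.iIndepFun
        (fun i (θ : ∀ i, Θ i) => (A i).indicator (B.armLikelihood i l s) (θ i))
        (Measure.pi B.prior) :=
      ProbabilityTheory.iIndepFun_pi (X := fun i => (A i).indicator (B.armLikelihood i l s))
        fun i => (hm i).aemeasurable
    rw [ProbabilityTheory.lintegral_prod_eq_prod_lintegral_of_indepFun _ _ hind
      fun i => (hm i).fun_comp (measurable_pi_apply i)]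
    refine Finset.prod_congr rfl fun i _ => ?_
    rw [armWeight, withDensity_apply _ (hA i), ← lintegral_indicator (hA i)]
    exact (measurePreserving_eval B.prior i).lintegral_comp (hm i)
  rw [← h1]
  refine Measure.pi_eq fun A _ => ?_
  rw [Measure.smul_apply, Measure.pi_pi, smul_eq_mul, ← Finset.prod_mul_distrib]
  refine Finset.prod_congr rfl fun i _ => ?_
  conv_rhs => rw [armWeight_eq_smul_posterior]
  rw [Measure.smul_apply, smul_eq_mul]

instance (l : List ((∀ i, S i) × (Fin n → Bool))) (s : ∀ i, S i) :
    IsFiniteMeasure (B.jointWeight l s) := by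
  rw [jointWeight_eq_smul_pi]
  refine ⟨?_⟩
  rw [Measure.smul_apply, smul_eq_mul]
  exact ENNReal.mul_lt_top (ENNReal.prod_lt_top fun i _ => measure_lt_top _ _)
    (measure_lt_top _ _)

/-! ### One step of the algorithm -/

variable {B}

theorem lintegral_nextParam_of_startsAt {h : History S} (hh : StartsAt h.past) (ϑ : ∀ i, Θ i)
    (f : (∀ i, Θ i) → ℝ≥0∞) :
    ∫⁻ ϑ', f ϑ' ∂(B.nextParam h ϑ) =
      ∫⁻ ϑ', f ϑ' ∂(Measure.pi fun i => B.posterior i h.past h.cur) := by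
  unfold StartsAt at hh
  rw [nextParam, if_pos hh]

theorem lintegral_nextParam_of_not_startsAt {h : History S} (hh : ¬ StartsAt h.past)
    (ϑ : ∀ i, Θ i) {f : (∀ i, Θ i) → ℝ≥0∞} (hf : Measurable f) :
    ∫⁻ ϑ', f ϑ' ∂(B.nextParam h ϑ) = f ϑ := by
  unfold StartsAt at hh
  rw [nextParam, if_neg hh, lintegral_dirac' _ hf]

theorem measurable_lintegral_nextParam (h : History S)
    {f : (∀ i, Θ i) × (∀ i, Θ i) → ℝ≥0∞} (hf : Measurable f) :
    Measurable fun q : (∀ i, Θ i) × (∀ i, Θ i) => ∫⁻ ϑ', f (q.1, ϑ') ∂(B.nextParam h q.2) := by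
  by_cases hh : StartsAt h.past
  · simp_rw [lintegral_nextParam_of_startsAt hh]
    exact hf.lintegral_prod_right'.fun_comp measurable_fst
  · simp_rw [lintegral_nextParam_of_not_startsAt hh _ (hf.fun_comp measurable_prodMk_left)]
    exact hf

variable {μ : (∀ i, Θ i) → (∀ i, S i) → (Fin n → Bool)}

theorem lintegral_step (x : (∀ i, Θ i) × History S × (∀ i, Θ i))
    {F : (∀ i, Θ i) × History S × (∀ i, Θ i) → ℝ≥0∞} (hF : Measurable F) :
    ∫⁻ y, F y ∂(B.step μ x) = ∑ s', ENNReal.ofReal (B.jointP x.1 x.2.1.cur (μ x.2.2 x.2.1.cur) s') *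
      ∫⁻ ϑ', F (x.1, x.2.1.next (μ x.2.2 x.2.1.cur) s', ϑ')
        ∂(B.nextParam (x.2.1.next (μ x.2.2 x.2.1.cur) s') x.2.2) := by
  rw [step, lintegral_finsetSum_measure]
  refine Finset.sum_congr rfl fun s' _ => ?_
  rw [lintegral_smul_measure, lintegral_map hF (by fun_prop), smul_eq_mul]
  rfl

theorem measurable_action (hμ : ∀ s, Measurable fun θ => μ θ s) :
    Measurable fun x : (∀ i, Θ i) × History S × (∀ i, Θ i) => μ x.2.2 x.2.1.cur :=
  measurable_of_forall_history fun h => (hμ h.cur).fun_comp measurable_snd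

theorem measurable_action_history {γ : Type*} [MeasurableSpace γ]
    (hμ : ∀ s, Measurable fun θ => μ θ s)
    {f : (Fin n → Bool) → (∀ i, Θ i) × History S × (∀ i, Θ i) → γ} (hf : ∀ a, Measurable (f a)) :
    Measurable fun x => f (μ x.2.2 x.2.1.cur) x := by
  have h : Measurable fun z : (Fin n → Bool) × ((∀ i, Θ i) × History S × (∀ i, Θ i)) =>
    f z.1 z.2 := measurable_from_prod_countable_right hf
  exact h.fun_comp ((measurable_action hμ).prodMk measurable_id)

theorem measurable_step (hμ : ∀ s, Measurable fun θ => μ θ s) : Measurable (B.step μ) := by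
  refine Measure.measurable_of_measurable_coe _ fun E hE => ?_
  have h1 : ∀ x, B.step μ x E = ∑ s',
      ENNReal.ofReal (B.jointP x.1 x.2.1.cur (μ x.2.2 x.2.1.cur) s') *
      ∫⁻ ϑ', E.indicator 1 (x.1, x.2.1.next (μ x.2.2 x.2.1.cur) s', ϑ')
        ∂(B.nextParam (x.2.1.next (μ x.2.2 x.2.1.cur) s') x.2.2) := fun x => by
    rw [← lintegral_step x (measurable_one.indicator hE), lintegral_indicator_one hE]
  simp_rw [h1]
  refine Finset.measurable_sum _ fun s' _ => measurable_action_history hμ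
    (f := fun a x => ENNReal.ofReal (B.jointP x.1 x.2.1.cur a s') *
      ∫⁻ ϑ', E.indicator 1 (x.1, x.2.1.next a s', ϑ') ∂(B.nextParam (x.2.1.next a s') x.2.2))
    fun a => measurable_of_forall_history fun h => ?_
  refine ((B.measurable_jointP h.cur a s').ennreal_ofReal.fun_comp measurable_fst).mul ?_
  exact measurable_lintegral_nextParam (h.next a s')
    (f := fun q => E.indicator 1 (q.1, h.next a s', q.2))
    ((measurable_one.indicator hE).fun_comp (by fun_prop))

theorem lintegral_law_zero {F : (∀ i, Θ i) × History S × (∀ i, Θ i) → ℝ≥0∞} (hF : Measurable F) :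
    ∫⁻ x, F x ∂(B.law μ 0) = ∑ s, ENNReal.ofReal (B.jointInit s) *
      ∫⁻ θ, ∫⁻ ϑ, F (θ, ⟨[], s⟩, ϑ) ∂(Measure.pi B.prior) ∂(Measure.pi B.prior) := by
  rw [law, lintegral_finsetSum_measure]
  refine Finset.sum_congr rfl fun s _ => ?_
  have hm : Measurable fun q : (∀ i, Θ i) × (∀ i, Θ i) =>
      ((q.1, ⟨[], s⟩, q.2) : (∀ i, Θ i) × History S × (∀ i, Θ i)) := by fun_prop
  have hFm : Measurable fun q : (∀ i, Θ i) × (∀ i, Θ i) => F (q.1, ⟨[], s⟩, q.2) := hF.comp hm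
  rw [lintegral_smul_measure, lintegral_map hF hm, smul_eq_mul,
    lintegral_prod _ hFm.aemeasurable]

theorem lintegral_law_succ (hμ : ∀ s, Measurable fun θ => μ θ s) (t : ℕ)
    {F : (∀ i, Θ i) × History S × (∀ i, Θ i) → ℝ≥0∞} (hF : Measurable F) :
    ∫⁻ x, F x ∂(B.law μ (t + 1)) = ∫⁻ x, ∫⁻ y, F y ∂(B.step μ x) ∂(B.law μ t) :=
  Measure.lintegral_bind (measurable_step hμ).aemeasurable hF.aemeasurable

/-! ### Posterior sampling -/

open Classical in
/-- Given the history, the true parameter and the parameter in force are independent, the former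
is distributed as its posterior, and at the start of an episode so is the latter. -/
theorem exists_lintegral_law_history (hμ : ∀ s, Measurable fun θ => μ θ s) (t : ℕ)
    (h : History S) :
    ∃ ν : Measure (∀ i, Θ i), IsFiniteMeasure ν ∧
      (StartsAt h.past → ∃ c : ℝ≥0∞, ν = c • Measure.pi fun i => B.posterior i h.past h.cur) ∧
      ∀ f : (∀ i, Θ i) × (∀ i, Θ i) → ℝ≥0∞, Measurable f →
        ∫⁻ x, (if x.2.1 = h then f (x.1, x.2.2) else 0) ∂(B.law μ t) =
          ∫⁻ θ, ∫⁻ ϑ, f (θ, ϑ) ∂ν ∂(B.jointWeight h.past h.cur) := by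
  have hmeas : ∀ (h : History S) (f : (∀ i, Θ i) × (∀ i, Θ i) → ℝ≥0∞), Measurable f →
      Measurable fun x : (∀ i, Θ i) × History S × (∀ i, Θ i) =>
        if x.2.1 = h then f (x.1, x.2.2) else 0 := fun h f hf =>
    measurable_of_forall_history fun h' => by
      by_cases hh : h' = h
      · simpa [hh] using hf
      · simp [hh]
  induction t generalizing h with
  | zero =>
    obtain ⟨l, s⟩ := h
    cases l with
    | nil =>
      refine ⟨ENNReal.ofReal (B.jointInit s) • Measure.pi B.prior, ?_, ?_, ?_⟩
      · exact ⟨by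
          rw [Measure.smul_apply, smul_eq_mul]
          exact ENNReal.mul_lt_top ENNReal.ofReal_lt_top (measure_lt_top _ _)⟩
      · exact fun _ => ⟨_, rfl⟩
      · intro f hf
        have hW : B.jointWeight [] s = Measure.pi B.prior := by
          simp only [jointWeight, armLikelihood, Finset.prod_const_one]
          exact withDensity_one
        rw [lintegral_law_zero (hmeas _ f hf), Finset.sum_eq_single s]
        · simp only [if_true, hW, lintegral_smul_measure, smul_eq_mul]
          rw [lintegral_const_mul _ hf.lintegral_prod_right']
        · intro s₁ _ hs₁
          have : (⟨[], s₁⟩ : History S) ≠ ⟨[], s⟩ := fun h => hs₁ (History.mk.inj h).2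
          simp [this]
        · simp
    | cons z l =>
      refine ⟨0, inferInstance, fun _ => ⟨0, by simp⟩, fun f hf => ?_⟩
      rw [lintegral_law_zero (hmeas _ f hf)]
      simp
  | succ t ih =>
    obtain ⟨l, s'⟩ := h
    cases l with
    | nil =>
      refine ⟨0, inferInstance, fun _ => ⟨0, by simp⟩, fun f hf => ?_⟩
      rw [lintegral_law_succ hμ t (hmeas _ f hf)]
      simp_rw [lintegral_step _ (hmeas _ f hf)]
      simp [History.next]
    | cons z l =>
      obtain ⟨s, a⟩ := z
      obtain ⟨ν₀, hν₀, -, hν⟩ := ih ⟨l, s⟩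
      have hE : MeasurableSet {ϑ : ∀ i, Θ i | μ ϑ s = a} := hμ s (measurableSet_singleton a)
      let h : History S := ⟨(s, a) :: l, s'⟩
      -- The part of the law before the step that leads to the history `h`.
      let g : (∀ i, Θ i) → (∀ i, Θ i) → ((∀ i, Θ i) × (∀ i, Θ i) → ℝ≥0∞) → ℝ≥0∞ := fun θ ϑ f =>
        if μ ϑ s = a then
          ENNReal.ofReal (B.jointP θ s a s') * ∫⁻ ϑ', f (θ, ϑ') ∂(B.nextParam h ϑ) else 0
      have hstep : ∀ f : (∀ i, Θ i) × (∀ i, Θ i) → ℝ≥0∞, Measurable f →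
          ∫⁻ x, (if x.2.1 = h then f (x.1, x.2.2) else 0) ∂(B.law μ (t + 1)) =
            ∫⁻ θ, ∫⁻ ϑ, g θ ϑ f ∂ν₀ ∂(B.jointWeight l s) := by
        intro f hf
        have hg : Measurable fun q : (∀ i, Θ i) × (∀ i, Θ i) => g q.1 q.2 f :=
          Measurable.ite (measurable_snd hE)
            (((B.measurable_jointP s a s').ennreal_ofReal.fun_comp measurable_fst).mul
              (measurable_lintegral_nextParam h hf)) measurable_const
        rw [lintegral_law_succ hμ t (hmeas _ f hf), ← hν _ hg]
        refine lintegral_congr fun x => ?_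
        rw [lintegral_step _ (hmeas _ f hf)]
        dsimp only
        obtain ⟨θ, ⟨l₀, s₀⟩, ϑ⟩ := x
        dsimp only [History.next, h, g]
        by_cases h0 : l₀ = l ∧ s₀ = s
        · obtain ⟨rfl, rfl⟩ := h0
          rw [if_pos rfl]
          by_cases ha : μ ϑ s₀ = a
          · rw [if_pos ha, Finset.sum_eq_single s']
            · simp [ha]
            · intro s₁ _ hs₁
              simp [hs₁]
            · simp
          · simp [ha]
        · have h0' : (⟨l₀, s₀⟩ : History S) ≠ ⟨l, s⟩ := fun h =>
            h0 ⟨(History.mk.inj h).1, (History.mk.inj h).2⟩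
          rw [if_neg h0']
          refine Finset.sum_eq_zero fun s₁ _ => ?_
          have : (⟨(s₀, μ ϑ s₀) :: l₀, s₁⟩ : History S) ≠ ⟨(s, a) :: l, s'⟩ := by
            intro h
            simp only [History.mk.injEq, List.cons.injEq, Prod.mk.injEq] at h
            exact h0 ⟨h.1.2, h.1.1.1⟩
          simp [this]
      refine ⟨if StartsAt ((s, a) :: l) then
          ν₀ {ϑ | μ ϑ s = a} • Measure.pi fun i => B.posterior i ((s, a) :: l) s'
        else ν₀.restrict {ϑ | μ ϑ s = a}, ?_, fun hst => ⟨_, if_pos hst⟩, fun f hf => ?_⟩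
      · split_ifs
        · exact ⟨by
            rw [Measure.smul_apply, smul_eq_mul]
            exact ENNReal.mul_lt_top (measure_lt_top _ _) (measure_lt_top _ _)⟩
        · infer_instance
      · rw [hstep f hf]
        dsimp only
        rw [jointWeight_cons]
        by_cases hst : StartsAt ((s, a) :: l)
        · simp only [if_pos hst, lintegral_smul_measure, smul_eq_mul]
          rw [lintegral_withDensity_eq_lintegral_mul _ (B.measurable_jointP s a s').ennreal_ofReal
            (hf.lintegral_prod_right'.const_mul _)]
          refine lintegral_congr fun θ => ?_
          have : ∀ ϑ, g θ ϑ f = {ϑ | μ ϑ s = a}.indicator (fun _ =>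
              ENNReal.ofReal (B.jointP θ s a s') *
                ∫⁻ ϑ', f (θ, ϑ') ∂(Measure.pi fun i => B.posterior i ((s, a) :: l) s')) ϑ := by
            intro ϑ
            dsimp only [g]
            rw [lintegral_nextParam_of_startsAt (h := h) hst, Set.indicator_apply]
            exact if_congr Iff.rfl rfl rfl
          simp_rw [this]
          rw [lintegral_indicator_const hE, Pi.mul_apply]
          ring
        · simp only [if_neg hst]
          rw [lintegral_withDensity_eq_lintegral_mul _ (B.measurable_jointP s a s').ennreal_ofReal
            hf.lintegral_prod_right']
          refine lintegral_congr fun θ => ?_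
          have : ∀ ϑ, g θ ϑ f = {ϑ | μ ϑ s = a}.indicator (fun ϑ =>
              ENNReal.ofReal (B.jointP θ s a s') * f (θ, ϑ)) ϑ := by
            intro ϑ
            dsimp only [g]
            rw [lintegral_nextParam_of_not_startsAt (h := h) hst _
              (hf.fun_comp measurable_prodMk_left), Set.indicator_apply]
            exact if_congr Iff.rfl rfl rfl
          simp_rw [this]
          rw [lintegral_indicator hE, Pi.mul_apply,
            lintegral_const_mul _ (hf.fun_comp measurable_prodMk_left)]

open Classical in
theorem lintegral_law_eq_tsum (t : ℕ) {F : (∀ i, Θ i) × History S × (∀ i, Θ i) → ℝ≥0∞}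
    (hF : Measurable F) :
    ∫⁻ x, F x ∂(B.law μ t) =
      ∑' h, ∫⁻ x, (if x.2.1 = h then F (x.1, h, x.2.2) else 0) ∂(B.law μ t) := by
  rw [← lintegral_tsum]
  · refine lintegral_congr fun x => ?_
    rw [tsum_eq_single x.2.1 fun h hh => if_neg (Ne.symm hh), if_pos rfl]
  · intro h
    refine (measurable_of_forall_history fun h' => ?_).aemeasurable
    by_cases hh : h' = h
    · simpa [hh] using hF.fun_comp (by fun_prop : Measurable fun q : (∀ i, Θ i) × (∀ i, Θ i) =>
        ((q.1, h, q.2) : (∀ i, Θ i) × History S × (∀ i, Θ i)))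
    · simp [hh]

open Classical in
/-- At the start of an episode the sampled parameter can be exchanged for the true one in
expectations of functions of the history and the parameter. -/
theorem lintegral_sample_eq (hμ : ∀ s, Measurable fun θ => μ θ s) (t : ℕ)
    {F : History S → (∀ i, Θ i) → ℝ≥0∞} (hF : ∀ h, Measurable (F h)) :
    ∫⁻ x, (if StartsAt x.2.1.past then F x.2.1 x.2.2 else 0) ∂(B.law μ t) =
      ∫⁻ x, (if StartsAt x.2.1.past then F x.2.1 x.1 else 0) ∂(B.law μ t) := by
  rw [lintegral_law_eq_tsum t, lintegral_law_eq_tsum t]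
  · refine tsum_congr fun h => ?_
    dsimp only
    by_cases hst : StartsAt h.past
    · simp only [if_pos hst]
      obtain ⟨ν, -, hν, hf⟩ := exists_lintegral_law_history (B := B) hμ t h
      obtain ⟨c, hc⟩ := hν hst
      rw [hf (fun q => F h q.2) ((hF h).fun_comp measurable_snd),
        hf (fun q => F h q.1) ((hF h).fun_comp measurable_fst), hc, jointWeight_eq_smul_pi]
      simp only [lintegral_smul_measure, lintegral_const, smul_eq_mul, Measure.smul_apply]
      rw [lintegral_mul_const _ (hF h)]
      ring
    · simp [hst]
  all_goals
    refine measurable_of_forall_history fun h => ?_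
    by_cases hst : StartsAt h.past
    · simp only [if_pos hst]
      first
        | exact (hF h).fun_comp measurable_fst
        | exact (hF h).fun_comp measurable_snd
    · simp [hst]

theorem ae_length (hμ : ∀ s, Measurable fun θ => μ θ s) (t : ℕ) :
    ∀ᵐ x ∂(B.law μ t), x.2.1.past.length = t := by
  have hm : ∀ t : ℕ, MeasurableSet {x : (∀ i, Θ i) × History S × (∀ i, Θ i) |
      ¬ x.2.1.past.length = t} := fun t =>
    (measurable_fst.fun_comp measurable_snd)
      (MeasurableSet.of_discrete (s := {h : History S | ¬ h.past.length = t}))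
  induction t with
  | zero =>
    rw [ae_iff, ← lintegral_indicator_one (hm 0),
      lintegral_law_zero (measurable_one.indicator (hm 0))]
    simp
  | succ t ih =>
    rw [ae_iff, ← lintegral_indicator_one (hm (t + 1)),
      lintegral_law_succ hμ t (measurable_one.indicator (hm (t + 1))),
      lintegral_eq_zero_iff' ((Measure.measurable_lintegral
        (measurable_one.indicator (hm (t + 1)))).fun_comp (measurable_step hμ)).aemeasurable]
    filter_upwards [ih] with x hx
    rw [lintegral_step _ (measurable_one.indicator (hm (t + 1)))]
    simp [History.next, hx]

/-- Almost surely the posterior after a possible next transition is a probability measure. -/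
theorem ae_posterior (hμ : ∀ s, Measurable fun θ => μ θ s) (t : ℕ) :
    ∀ᵐ x ∂(B.law μ t), ∀ (a : Fin n → Bool) (s' : ∀ i, S i),
      B.jointP x.1 x.2.1.cur a s' = 0 ∨
        ∀ i, IsProbabilityMeasure (B.posterior i (x.2.1.next a s').past s') := by
  classical
  rw [ae_all_iff]; intro a
  rw [ae_all_iff]; intro s'
  have key : ∀ h : History S, ∀ᵐ x ∂(B.law μ t), x.2.1 = h →
      (B.jointP x.1 h.cur a s' = 0 ∨
        ∀ i, IsProbabilityMeasure (B.posterior i (h.next a s').past s')) := by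
    intro h
    by_cases hW : ∀ i, B.armWeight i (h.next a s').past s' Set.univ ≠ 0
    · refine Eventually.of_forall fun x _ => Or.inr fun i => ⟨?_⟩
      rw [posterior_eq, Measure.smul_apply, smul_eq_mul]
      exact ENNReal.inv_mul_cancel (hW i) (measure_ne_top _ _)
    · push Not at hW
      obtain ⟨i, hi⟩ := hW
      have hz : B.jointWeight (h.next a s').past s' = 0 := by
        rw [jointWeight_eq_smul_pi, Finset.prod_eq_zero (Finset.mem_univ i) hi, zero_smul]
      obtain ⟨ν, hνf, -, hf⟩ := exists_lintegral_law_history (B := B) hμ t h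
      have hJ := (B.measurable_jointP h.cur a s').ennreal_ofReal
      have h1 := hf (fun q => ENNReal.ofReal (B.jointP q.1 h.cur a s')) (hJ.fun_comp measurable_fst)
      have h2 : ∫⁻ θ, ENNReal.ofReal (B.jointP θ h.cur a s') ∂(B.jointWeight h.past h.cur) = 0 := by
        have : B.jointWeight (h.next a s').past s' Set.univ = 0 := by rw [hz]; rfl
        rw [History.next, jointWeight_cons, withDensity_apply _ MeasurableSet.univ,
          Measure.restrict_univ] at this
        exact this
      simp only [lintegral_const] at h1
      rw [lintegral_mul_const _ hJ, h2, zero_mul, lintegral_eq_zero_iff'] at h1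
      · filter_upwards [h1] with x hx hxh
        left
        rw [if_pos hxh] at hx
        exact le_antisymm (ENNReal.ofReal_eq_zero.1 hx) (B.jointP_nonneg _ _ _ _)
      · refine (measurable_of_forall_history fun h' => ?_).aemeasurable
        by_cases hh : h' = h
        · simpa [hh] using hJ.fun_comp measurable_fst
        · simp [hh]
  filter_upwards [ae_all_iff.2 key] with x hx
  exact hx x.2.1 rfl

theorem isProbabilityMeasure_nextParam {h : History S}
    (hh : ∀ i, IsProbabilityMeasure (B.posterior i h.past h.cur)) (ϑ : ∀ i, Θ i) :
    IsProbabilityMeasure (B.nextParam h ϑ) := by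
  rw [nextParam]
  split_ifs <;> infer_instance

theorem isProbabilityMeasure_law (hμ : ∀ s, Measurable fun θ => μ θ s) (t : ℕ) :
    IsProbabilityMeasure (B.law μ t) := by
  induction t with
  | zero =>
    refine ⟨?_⟩
    rw [← lintegral_one, lintegral_law_zero measurable_const]
    simp only [lintegral_const, measure_univ, mul_one]
    rw [← ENNReal.ofReal_sum_of_nonneg fun s _ => B.jointInit_nonneg s, sum_jointInit,
      ENNReal.ofReal_one]
  | succ t ih =>
    refine ⟨?_⟩
    rw [← lintegral_one, lintegral_law_succ hμ t measurable_const]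
    have : ∀ᵐ x ∂(B.law μ t), ∫⁻ _y, 1 ∂(B.step μ x) = 1 := by
      filter_upwards [ae_posterior hμ t] with x hx
      rw [lintegral_step _ measurable_const]
      refine Eq.trans (b := ∑ s', ENNReal.ofReal
        (B.jointP x.1 x.2.1.cur (μ x.2.2 x.2.1.cur) s')) ?_ ?_
      · refine Finset.sum_congr rfl fun s' _ => ?_
        rcases hx (μ x.2.2 x.2.1.cur) s' with h0 | h0
        · simp [h0]
        · have := isProbabilityMeasure_nextParam (h := x.2.1.next (μ x.2.2 x.2.1.cur) s') h0 x.2.2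
          simp
      · rw [← ENNReal.ofReal_sum_of_nonneg fun s _ => B.jointP_nonneg _ _ _ _, sum_jointP,
          ENNReal.ofReal_one]
    rw [lintegral_congr_ae this]
    simp

theorem lintegral_step_le (hμ : ∀ s, Measurable fun θ => μ θ s) (t : ℕ)
    {φ : (∀ i, Θ i) × History S × (∀ i, Θ i) → (∀ i, S i) → ℝ≥0∞}
    {F : (∀ i, Θ i) × History S × (∀ i, Θ i) → ℝ≥0∞} (hF : Measurable F)
    (h : ∀ x s' ϑ', x.2.1.past.length = t →
      StartsAt (x.2.1.next (μ x.2.2 x.2.1.cur) s').past ∨ ϑ' = x.2.2 →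
      φ x s' ≤ F (x.1, x.2.1.next (μ x.2.2 x.2.1.cur) s', ϑ')) :
    ∫⁻ x, ∑ s', ENNReal.ofReal (B.jointP x.1 x.2.1.cur (μ x.2.2 x.2.1.cur) s') * φ x s'
      ∂(B.law μ t) ≤ ∫⁻ x, F x ∂(B.law μ (t + 1)) := by
  rw [lintegral_law_succ hμ t hF]
  refine lintegral_mono_ae ?_
  filter_upwards [ae_posterior hμ t, ae_length hμ t] with x hx hlen
  rw [lintegral_step _ hF]
  refine Finset.sum_le_sum fun s' _ => ?_
  rcases hx (μ x.2.2 x.2.1.cur) s' with h0 | h0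
  · simp [h0]
  · refine mul_le_mul_right ?_ _
    have := isProbabilityMeasure_nextParam (h := x.2.1.next (μ x.2.2 x.2.1.cur) s') h0 x.2.2
    by_cases hst : StartsAt (x.2.1.next (μ x.2.2 x.2.1.cur) s').past
    · calc φ x s' = ∫⁻ _, φ x s' ∂(B.nextParam (x.2.1.next (μ x.2.2 x.2.1.cur) s') x.2.2) := by
            simp
        _ ≤ _ := lintegral_mono fun ϑ' => h x s' ϑ' hlen (Or.inl hst)
    · rw [lintegral_nextParam_of_not_startsAt hst _ (hF.fun_comp (by fun_prop))]
      exact h x s' _ hlen (Or.inr rfl)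

/-! ### Expectations of bounded functions -/

/-- A measurable function that is bounded on the histories of length `t`. -/
def BoundedAt (t : ℕ) (F : (∀ i, Θ i) × History S × (∀ i, Θ i) → ℝ) : Prop :=
  Measurable F ∧ ∃ C, ∀ x, x.2.1.past.length = t → |F x| ≤ C

theorem BoundedAt.integrable (hμ : ∀ s, Measurable fun θ => μ θ s) {t : ℕ}
    {F : (∀ i, Θ i) × History S × (∀ i, Θ i) → ℝ} (hF : BoundedAt t F) :
    Integrable F (B.law μ t) := by
  have := isProbabilityMeasure_law (B := B) hμ t
  obtain ⟨hm, C, hC⟩ := hF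
  refine Integrable.of_bound hm.aestronglyMeasurable C ?_
  filter_upwards [ae_length hμ t] with x hx
  exact hC x hx

theorem integral_le_integral_law (hμ : ∀ s, Measurable fun θ => μ θ s) {t : ℕ}
    {F G : (∀ i, Θ i) × History S × (∀ i, Θ i) → ℝ} (hF : BoundedAt t F) (hG : BoundedAt t G)
    (h : ∀ x, x.2.1.past.length = t → F x ≤ G x) :
    ∫ x, F x ∂(B.law μ t) ≤ ∫ x, G x ∂(B.law μ t) := by
  refine integral_mono_ae (hF.integrable hμ) (hG.integrable hμ) ?_
  filter_upwards [ae_length hμ t] with x hx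
  exact h x hx

/-- One step of the algorithm: the next history is drawn from the transition probabilities under
the true parameter, and the parameter in force changes only at the start of an episode. -/
theorem integral_step_le (hμ : ∀ s, Measurable fun θ => μ θ s) (t : ℕ)
    {φ : (∀ i, Θ i) × History S × (∀ i, Θ i) → (∀ i, S i) → ℝ}
    {F : (∀ i, Θ i) × History S × (∀ i, Θ i) → ℝ} (hF : BoundedAt (t + 1) F)
    (hφ : ∀ s', BoundedAt t fun x => φ x s')
    (h : ∀ x s' ϑ', x.2.1.past.length = t →
      StartsAt (x.2.1.next (μ x.2.2 x.2.1.cur) s').past ∨ ϑ' = x.2.2 →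
      φ x s' ≤ F (x.1, x.2.1.next (μ x.2.2 x.2.1.cur) s', ϑ')) :
    ∫ x, ∑ s', B.jointP x.1 x.2.1.cur (μ x.2.2 x.2.1.cur) s' * φ x s' ∂(B.law μ t) ≤
      ∫ x, F x ∂(B.law μ (t + 1)) := by
  have hp := isProbabilityMeasure_law (B := B) hμ t
  have hp' := isProbabilityMeasure_law (B := B) hμ (t + 1)
  have hFi := hF.integrable (B := B) hμ
  obtain ⟨C, hC0, hCF, hCφ⟩ : ∃ C : ℝ, 0 ≤ C ∧ (∀ x, x.2.1.past.length = t + 1 → |F x| ≤ C) ∧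
      ∀ s' x, x.2.1.past.length = t → |φ x s'| ≤ C := by
    obtain ⟨C₁, hC₁⟩ := hF.2
    choose C₂ hC₂ using fun s' => (hφ s').2
    refine ⟨|C₁| + ∑ s', |C₂ s'|, by positivity, fun x hx => ?_, fun s' x hx => ?_⟩
    · refine (hC₁ x hx).trans ((le_abs_self _).trans (le_add_of_nonneg_right (by positivity)))
    · refine (hC₂ s' x hx).trans ((le_abs_self _).trans ?_)
      refine (Finset.single_le_sum (f := fun s' => |C₂ s'|) (fun _ _ => abs_nonneg _)
        (Finset.mem_univ s')).trans (le_add_of_nonneg_left (abs_nonneg _))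
  set Ψ : (∀ i, Θ i) × History S × (∀ i, Θ i) → ℝ := fun x =>
    ∑ s', B.jointP x.1 x.2.1.cur (μ x.2.2 x.2.1.cur) s' * φ x s' with hΨ
  have hΨm : Measurable Ψ := by
    refine Finset.measurable_fun_sum _ fun s' _ => Measurable.mul ?_ (hφ s').1
    refine measurable_action_history hμ (f := fun a x => B.jointP x.1 x.2.1.cur a s') fun a =>
      measurable_of_forall_history fun h => ?_
    exact (B.measurable_jointP h.cur a s').fun_comp measurable_fst
  have hΨC : ∀ x, x.2.1.past.length = t → |Ψ x| ≤ C := by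
    intro x hx
    refine (Finset.abs_sum_le_sum_abs _ _).trans ?_
    calc _ ≤ ∑ s', B.jointP x.1 x.2.1.cur (μ x.2.2 x.2.1.cur) s' * C := by
          refine Finset.sum_le_sum fun s' _ => ?_
          rw [abs_mul, abs_of_nonneg (B.jointP_nonneg _ _ _ _)]
          exact mul_le_mul_of_nonneg_left (hCφ s' x hx) (B.jointP_nonneg _ _ _ _)
      _ = C := by rw [← Finset.sum_mul, sum_jointP, one_mul]
  have hΨi : Integrable Ψ (B.law μ t) := BoundedAt.integrable hμ ⟨hΨm, C, hΨC⟩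
  have h1 : ∫⁻ x, ENNReal.ofReal (Ψ x + C) ∂(B.law μ t) ≤
      ∫⁻ x, ENNReal.ofReal (F x + C) ∂(B.law μ (t + 1)) := by
    refine le_trans (le_of_eq (lintegral_congr_ae ?_))
      (lintegral_step_le (φ := fun x s' => ENNReal.ofReal (φ x s' + C)) hμ t
        (hF.1.add_const C).ennreal_ofReal
        fun x s' ϑ' hx hs => ENNReal.ofReal_le_ofReal (by linarith [h x s' ϑ' hx hs]))
    filter_upwards [ae_length hμ t] with x hx
    have h2 : Ψ x + C = ∑ s', B.jointP x.1 x.2.1.cur (μ x.2.2 x.2.1.cur) s' * (φ x s' + C) := by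
      simp only [mul_add, Finset.sum_add_distrib, ← Finset.sum_mul, sum_jointP, one_mul, hΨ]
    have h3 : ∀ s', 0 ≤ φ x s' + C := fun s' => by linarith [(abs_le.1 (hCφ s' x hx)).1]
    rw [h2, ENNReal.ofReal_sum_of_nonneg fun s' _ => mul_nonneg (B.jointP_nonneg _ _ _ _) (h3 s')]
    exact Finset.sum_congr rfl fun s' _ => ENNReal.ofReal_mul (B.jointP_nonneg _ _ _ _)
  have hF0 : 0 ≤ᵐ[B.law μ (t + 1)] fun x => F x + C := by
    filter_upwards [ae_length hμ (t + 1)] with x hx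
    have := (abs_le.1 (hCF x hx)).1
    simp only [Pi.zero_apply]; linarith
  have hΨ0 : 0 ≤ᵐ[B.law μ t] fun x => Ψ x + C := by
    filter_upwards [ae_length hμ t] with x hx
    have := (abs_le.1 (hΨC x hx)).1
    simp only [Pi.zero_apply]; linarith
  have hΨi' : Integrable (fun x => Ψ x + C) (B.law μ t) := hΨi.add (integrable_const C)
  have hFi' : Integrable (fun x => F x + C) (B.law μ (t + 1)) := hFi.add (integrable_const C)
  rw [← ofReal_integral_eq_lintegral_ofReal hΨi' hΨ0,
    ← ofReal_integral_eq_lintegral_ofReal hFi' hF0,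
    ENNReal.ofReal_le_ofReal_iff (integral_nonneg_of_ae hF0),
    integral_add hΨi (integrable_const C), integral_add hFi (integrable_const C)] at h1
  simpa using h1

open Classical in
/-- Real-valued form of `lintegral_sample_eq`. -/
theorem integral_sample_eq (hμ : ∀ s, Measurable fun θ => μ θ s) (t : ℕ)
    {F : History S → (∀ i, Θ i) → ℝ} (hF : ∀ h, Measurable (F h)) (hF0 : ∀ h θ, 0 ≤ F h θ) :
    ∫ x, (if StartsAt x.2.1.past then F x.2.1 x.2.2 else 0) ∂(B.law μ t) =
      ∫ x, (if StartsAt x.2.1.past then F x.2.1 x.1 else 0) ∂(B.law μ t) := by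
  have hm1 : Measurable fun x : (∀ i, Θ i) × History S × (∀ i, Θ i) =>
      if StartsAt x.2.1.past then F x.2.1 x.2.2 else 0 :=
    measurable_of_forall_history fun h => by
      by_cases hst : StartsAt h.past
      · simpa only [if_pos hst] using (hF h).fun_comp measurable_snd
      · simp [hst]
  have hm2 : Measurable fun x : (∀ i, Θ i) × History S × (∀ i, Θ i) =>
      if StartsAt x.2.1.past then F x.2.1 x.1 else 0 :=
    measurable_of_forall_history fun h => by
      by_cases hst : StartsAt h.past
      · simpa only [if_pos hst] using (hF h).fun_comp measurable_fst
      · simp [hst]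
  rw [integral_eq_lintegral_of_nonneg_ae (Eventually.of_forall fun x => by
      simp only [Pi.zero_apply]; split_ifs; exacts [hF0 _ _, le_rfl]) hm1.aestronglyMeasurable,
    integral_eq_lintegral_of_nonneg_ae (Eventually.of_forall fun x => by
      simp only [Pi.zero_apply]; split_ifs; exacts [hF0 _ _, le_rfl]) hm2.aestronglyMeasurable]
  have := lintegral_sample_eq (B := B) hμ t (F := fun h θ => ENNReal.ofReal (F h θ))
    fun h => (hF h).ennreal_ofReal
  simp only [apply_ite ENNReal.ofReal, ENNReal.ofReal_zero]
  rw [this]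

end RestlessBandit

namespace RestlessBandit

/-! ### Functions that are bounded on histories of a fixed length -/

section

variable {n : ℕ} {S : Fin n → Type u} {Θ : Fin n → Type v} [∀ i, MeasurableSpace (Θ i)]

theorem BoundedAt.add {t : ℕ} {F G : (∀ i, Θ i) × History S × (∀ i, Θ i) → ℝ}
    (hF : BoundedAt t F) (hG : BoundedAt t G) : BoundedAt t fun x => F x + G x := by
  obtain ⟨hFm, C, hC⟩ := hF
  obtain ⟨hGm, D, hD⟩ := hG
  exact ⟨hFm.add hGm, C + D, fun x hx => (abs_add_le _ _).trans (add_le_add (hC x hx) (hD x hx))⟩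

theorem BoundedAt.neg {t : ℕ} {F : (∀ i, Θ i) × History S × (∀ i, Θ i) → ℝ}
    (hF : BoundedAt t F) : BoundedAt t fun x => -F x := by
  obtain ⟨hFm, C, hC⟩ := hF
  exact ⟨hFm.neg, C, fun x hx => (abs_neg _).le.trans (hC x hx)⟩

theorem BoundedAt.sub {t : ℕ} {F G : (∀ i, Θ i) × History S × (∀ i, Θ i) → ℝ}
    (hF : BoundedAt t F) (hG : BoundedAt t G) : BoundedAt t fun x => F x - G x := by
  simpa only [sub_eq_add_neg] using hF.add hG.neg

theorem BoundedAt.mul {t : ℕ} {F G : (∀ i, Θ i) × History S × (∀ i, Θ i) → ℝ}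
    (hF : BoundedAt t F) (hG : BoundedAt t G) : BoundedAt t fun x => F x * G x := by
  obtain ⟨hFm, C, hC⟩ := hF
  obtain ⟨hGm, D, hD⟩ := hG
  refine ⟨hFm.mul hGm, C * D, fun x hx => ?_⟩
  rw [abs_mul]
  exact mul_le_mul (hC x hx) (hD x hx) (abs_nonneg _) ((abs_nonneg _).trans (hC x hx))

theorem BoundedAt.abs {t : ℕ} {F : (∀ i, Θ i) × History S × (∀ i, Θ i) → ℝ}
    (hF : BoundedAt t F) : BoundedAt t fun x => |F x| := by
  obtain ⟨hFm, C, hC⟩ := hF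
  exact ⟨hFm.abs, C, fun x hx => (abs_abs _).le.trans (hC x hx)⟩

theorem BoundedAt.trueParam (t : ℕ) {f : (∀ i, Θ i) → ℝ} (hf : Measurable f) {C : ℝ}
    (hC : ∀ θ, |f θ| ≤ C) :
    BoundedAt t fun x : (∀ i, Θ i) × History S × (∀ i, Θ i) => f x.1 :=
  ⟨hf.fun_comp measurable_fst, C, fun _ _ => hC _⟩

theorem BoundedAt.param (t : ℕ) {f : (∀ i, Θ i) → ℝ} (hf : Measurable f) {C : ℝ}
    (hC : ∀ θ, |f θ| ≤ C) :
    BoundedAt t fun x : (∀ i, Θ i) × History S × (∀ i, Θ i) => f x.2.2 :=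
  ⟨hf.fun_comp (measurable_snd.comp measurable_snd), C, fun _ _ => hC _⟩

end

variable {n : ℕ} {S : Fin n → Type u} [∀ i, Fintype (S i)]
  {Θ : Fin n → Type v} [∀ i, MeasurableSpace (Θ i)] {B : RestlessBandit S Θ}
  {μ : (∀ i, Θ i) → (∀ i, S i) → (Fin n → Bool)}

/-- There are finitely many histories of a given length, so that it is enough to bound a function
on each history. -/
theorem BoundedAt.of_forall_history (t : ℕ) {F : (∀ i, Θ i) × History S × (∀ i, Θ i) → ℝ}
    (hm : ∀ h, Measurable fun q : (∀ i, Θ i) × (∀ i, Θ i) => F (q.1, h, q.2))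
    (hb : ∀ h, ∃ C, ∀ θ ϑ, |F (θ, h, ϑ)| ≤ C) : BoundedAt t F := by
  refine ⟨measurable_of_forall_history hm, ?_⟩
  choose C hC using hb
  have hfin : {h : History S | h.past.length = t}.Finite := by
    have h1 : (({l : List ((∀ i, S i) × (Fin n → Bool)) | l.length = t}) ×ˢ
        (Set.univ : Set (∀ i, S i))).Finite := (List.finite_length_eq _ t).prod Set.finite_univ
    refine (h1.image fun z => (⟨z.1, z.2⟩ : History S)).subset ?_
    rintro ⟨l, s⟩ hl
    exact ⟨(l, s), ⟨hl, trivial⟩, rfl⟩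
  obtain ⟨M, hM⟩ := (hfin.image C).bddAbove
  exact ⟨M, fun x hx => (hC x.2.1 x.1 x.2.2).trans (hM ⟨x.2.1, hx, rfl⟩)⟩

theorem BoundedAt.history (t : ℕ) (f : History S → ℝ) :
    BoundedAt t fun x : (∀ i, Θ i) × History S × (∀ i, Θ i) => f x.2.1 :=
  .of_forall_history t (fun h => measurable_const (a := f h)) fun h => ⟨|f h|, fun _ _ => le_rfl⟩

theorem BoundedAt.const (t : ℕ) (c : ℝ) :
    BoundedAt t fun _ : (∀ i, Θ i) × History S × (∀ i, Θ i) => c := BoundedAt.history t fun _ => c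

theorem BoundedAt.sum {t : ℕ} {ι : Type*} (I : Finset ι)
    {F : ι → (∀ i, Θ i) × History S × (∀ i, Θ i) → ℝ}
    (hF : ∀ j ∈ I, BoundedAt t (F j)) : BoundedAt t fun x => ∑ j ∈ I, F j x := by
  classical
  induction I using Finset.induction_on with
  | empty => simpa using BoundedAt.const t 0
  | insert j I hj ih =>
    simp only [Finset.sum_insert hj]
    exact (hF j (Finset.mem_insert_self j I)).add
      (ih fun k hk => hF k (Finset.mem_insert_of_mem hk))

/-- The chosen action may be used as if it were one of finitely many constants. -/
theorem BoundedAt.action (hμ : ∀ s, Measurable fun θ => μ θ s) {t : ℕ}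
    {f : (Fin n → Bool) → (∀ i, Θ i) × History S × (∀ i, Θ i) → ℝ}
    (hf : ∀ a, BoundedAt t (f a)) : BoundedAt t fun x => f (μ x.2.2 x.2.1.cur) x := by
  refine ⟨measurable_action_history hμ fun a => (hf a).1, ?_⟩
  choose C hC using fun a => (hf a).2
  refine ⟨∑ a, |C a|, fun x hx => (hC _ x hx).trans ((le_abs_self _).trans ?_)⟩
  exact Finset.single_le_sum (f := fun a => |C a|) (fun _ _ => abs_nonneg _) (Finset.mem_univ _)

/-- The one-step inequality for functions that do not depend on the next state. -/
theorem integral_le_integral_law_succ (hμ : ∀ s, Measurable fun θ => μ θ s) (t : ℕ)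
    {φ F : (∀ i, Θ i) × History S × (∀ i, Θ i) → ℝ} (hF : BoundedAt (t + 1) F)
    (hφ : BoundedAt t φ)
    (h : ∀ x s' ϑ', x.2.1.past.length = t →
      StartsAt (x.2.1.next (μ x.2.2 x.2.1.cur) s').past ∨ ϑ' = x.2.2 →
      φ x ≤ F (x.1, x.2.1.next (μ x.2.2 x.2.1.cur) s', ϑ')) :
    ∫ x, φ x ∂(B.law μ t) ≤ ∫ x, F x ∂(B.law μ (t + 1)) := by
  have := integral_step_le (B := B) hμ t (φ := fun x _ => φ x) hF (fun _ => hφ) h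
  simpa only [← Finset.sum_mul, sum_jointP, one_mul] using this

/-! ### Concentration of the transition counts of one arm -/

variable (B) in
/-- The expectation of `u` after one transition of arm `i` from `x` under action `b`. -/
def armMean (i : Fin n) (u : S i → ℝ) (x : S i) (b : Bool) (θ : ∀ i, Θ i) : ℝ :=
  ∑ y, B.P i (θ i) x b y * u y

theorem measurable_armMean (i : Fin n) (u : S i → ℝ) (x : S i) (b : Bool) :
    Measurable (B.armMean i u x b) :=
  Finset.measurable_fun_sum _ fun y _ =>
    ((B.P_measurable i x b y).fun_comp (measurable_pi_apply i)).mul_const _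

theorem armMean_mem (i : Fin n) {u : S i → ℝ} (hu : ∀ y, 0 ≤ u y ∧ u y ≤ 1) (x : S i) (b : Bool)
    (θ : ∀ i, Θ i) : 0 ≤ B.armMean i u x b θ ∧ B.armMean i u x b θ ≤ 1 := by
  refine ⟨Finset.sum_nonneg fun y _ => mul_nonneg (B.P_nonneg i _ _ _ _) (hu y).1, ?_⟩
  rw [← B.P_sum i (θ i) x b]
  exact Finset.sum_le_sum fun y _ => mul_le_of_le_one_right (B.P_nonneg i _ _ _ _) (hu y).2

theorem abs_armMean_le (i : Fin n) {u : S i → ℝ} (hu : ∀ y, 0 ≤ u y ∧ u y ≤ 1) (x : S i) (b : Bool)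
    (θ : ∀ i, Θ i) : |B.armMean i u x b θ| ≤ 1 := by
  rw [abs_of_nonneg (armMean_mem i hu x b θ).1]
  exact (armMean_mem i hu x b θ).2

open Classical in
/-- The sum of `u` over the states of arm `i` that follow its visits to `(x, b)`. -/
noncomputable def cumTest (i : Fin n) (u : S i → ℝ) (x : S i) (b : Bool) :
    List ((∀ i, S i) × (Fin n → Bool)) → (∀ i, S i) → ℝ
  | [], _ => 0
  | z :: l, s => cumTest i u x b l z.1 + if z.1 i = x ∧ z.2 i = b then u (s i) else 0

variable (B) in
/-- The deviation of `cumTest` from its compensator under the parameter `θ`. -/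
noncomputable def deviation (i : Fin n) (u : S i → ℝ) (x : S i) (b : Bool) (θ : ∀ i, Θ i)
    (h : History S) : ℝ :=
  cumTest i u x b h.past h.cur - visits h.past i x b * B.armMean i u x b θ

theorem measurable_deviation (i : Fin n) (u : S i → ℝ) (x : S i) (b : Bool) (h : History S) :
    Measurable fun θ => B.deviation i u x b θ h :=
  ((measurable_armMean i u x b).const_mul _).const_sub _

theorem boundedAt_exp_deviation (t : ℕ) (i : Fin n) {u : S i → ℝ}
    (hu : ∀ y, 0 ≤ u y ∧ u y ≤ 1) (x : S i) (b : Bool) (c : ℝ) :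
    BoundedAt t fun y : (∀ i, Θ i) × History S × (∀ i, Θ i) =>
      Real.exp (c * B.deviation i u x b y.1 y.2.1 - c ^ 2 * visits y.2.1.past i x b) := by
  refine .of_forall_history t (fun h => ?_) fun h => ?_
  · exact ((((measurable_deviation (B := B) i u x b h).fun_comp measurable_fst).const_mul c).sub_const
      (c ^ 2 * visits h.past i x b)).exp
  · refine ⟨Real.exp (|c| * (|cumTest i u x b h.past h.cur| + visits h.past i x b)),
      fun θ ϑ => ?_⟩
    rw [Real.abs_exp]
    refine Real.exp_le_exp.2 ?_
    have h1 : |B.deviation i u x b θ h| ≤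
        |cumTest i u x b h.past h.cur| + visits h.past i x b := by
      refine (abs_sub _ _).trans (add_le_add le_rfl ?_)
      rw [abs_mul, Nat.abs_cast]
      exact mul_le_of_le_one_right (Nat.cast_nonneg _) (abs_armMean_le i hu x b θ)
    have h2 : c * B.deviation i u x b θ h ≤ |c| * |B.deviation i u x b θ h| := by
      rw [← abs_mul]; exact le_abs_self _
    have h3 : 0 ≤ c ^ 2 * (visits h.past i x b : ℝ) := by positivity
    have h4 := mul_le_mul_of_nonneg_left h1 (abs_nonneg c)
    dsimp only
    linarith

/-- Exponential supermartingale for the deviation under the true parameter. -/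
theorem integral_exp_deviation_le (hμ : ∀ s, Measurable fun θ => μ θ s) (t : ℕ) (i : Fin n)
    {u : S i → ℝ} (hu : ∀ y, 0 ≤ u y ∧ u y ≤ 1) (x : S i) (b : Bool) (c : ℝ) :
    ∫ y, Real.exp (c * B.deviation i u x b y.1 y.2.1 - c ^ 2 * visits y.2.1.past i x b)
      ∂(B.law μ t) ≤ 1 := by
  classical
  induction t with
  | zero =>
    have := isProbabilityMeasure_law (B := B) hμ 0
    refine (integral_le_integral_law hμ (boundedAt_exp_deviation 0 i hu x b c)
      (BoundedAt.const 0 1) fun y hy => ?_).trans (by simp)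
    have h0 : y.2.1.past = [] := List.length_eq_zero_iff.1 hy
    simp [deviation, h0, cumTest]
  | succ t ih =>
    refine le_trans ?_ ih
    set f : (∀ i, Θ i) → History S → ℝ := fun θ h =>
      Real.exp (c * B.deviation i u x b θ h - c ^ 2 * visits h.past i x b) with hf
    have hbd : ∀ t, BoundedAt t fun y : (∀ i, Θ i) × History S × (∀ i, Θ i) => f y.1 y.2.1 :=
      fun t => boundedAt_exp_deviation t i hu x b c
    have hnext : ∀ θ (h : History S) a s', f θ (h.next a s') =
        f θ h * if h.cur i = x ∧ a i = b then
          Real.exp (c * (u (s' i) - B.armMean i u x b θ)) * Real.exp (-c ^ 2) else 1 := by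
      intro θ h a s'
      simp only [hf, deviation, History.next, cumTest, visits_cons]
      split_ifs
      · rw [← Real.exp_add, ← Real.exp_add]
        congr 1
        push_cast; ring
      · simp
    have hφ : ∀ s', BoundedAt t fun y : (∀ i, Θ i) × History S × (∀ i, Θ i) =>
        -f y.1 (y.2.1.next (μ y.2.2 y.2.1.cur) s') := by
      intro s'
      refine (BoundedAt.action hμ (f := fun a y => f y.1 (y.2.1.next a s')) fun a => ?_).neg
      refine .of_forall_history t (fun h => ?_) fun h => ?_
      · have hm := (hbd 0).1
        exact hm.fun_comp (g := fun y : (∀ i, Θ i) × History S × (∀ i, Θ i) => f y.1 y.2.1)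
          (by fun_prop : Measurable fun q : (∀ i, Θ i) × (∀ i, Θ i) =>
            ((q.1, h.next a s', q.2) : (∀ i, Θ i) × History S × (∀ i, Θ i)))
      · obtain ⟨C, hC⟩ := (hbd (h.next a s').past.length).2
        exact ⟨C, fun θ ϑ => hC (θ, h.next a s', ϑ) rfl⟩
    have h1 := integral_step_le (B := B) hμ t (hbd (t + 1)).neg hφ fun y s' ϑ' _ _ => le_rfl
    have hsum : ∀ y : (∀ i, Θ i) × History S × (∀ i, Θ i),
        ∑ s', B.jointP y.1 y.2.1.cur (μ y.2.2 y.2.1.cur) s' *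
          f y.1 (y.2.1.next (μ y.2.2 y.2.1.cur) s') ≤ f y.1 y.2.1 := by
      intro y
      obtain ⟨θ, h, ϑ⟩ := y
      dsimp only
      set a := μ ϑ h.cur
      have hf0 : 0 ≤ f θ h := (Real.exp_pos _).le
      simp only [hnext]
      by_cases hv : h.cur i = x ∧ a i = b
      · simp only [if_pos hv]
        have h2 := sum_prod_mul_coord (fun j => B.P j (θ j) (h.cur j) (a j))
          (fun j => B.P_sum j _ _ _) i fun y => Real.exp (c * (u y - B.armMean i u x b θ))
        have h3 := sum_mul_exp_centered_le (fun y => B.P i (θ i) x b y) u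
          (fun y => B.P_nonneg i _ _ _ _) (B.P_sum i _ _ _) hu c
        have h4 : ∑ s', B.jointP θ h.cur a s' * Real.exp (c * (u (s' i) - B.armMean i u x b θ)) ≤
            Real.exp (c ^ 2) := by
          refine le_trans (le_of_eq h2) ?_
          rw [hv.1, hv.2]
          exact h3
        calc _ = f θ h * Real.exp (-c ^ 2) * ∑ s', B.jointP θ h.cur a s' *
              Real.exp (c * (u (s' i) - B.armMean i u x b θ)) := by
              rw [Finset.mul_sum]
              exact Finset.sum_congr rfl fun s' _ => by ring
          _ ≤ f θ h * Real.exp (-c ^ 2) * Real.exp (c ^ 2) :=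
              mul_le_mul_of_nonneg_left h4 (by positivity)
          _ = f θ h := by rw [mul_assoc, ← Real.exp_add]; simp
      · simp only [if_neg hv, mul_one, ← Finset.sum_mul, sum_jointP, one_mul, le_refl]
    have h5 : ∫ y, -f y.1 y.2.1 ∂(B.law μ t) ≤
        ∫ y, ∑ s', B.jointP y.1 y.2.1.cur (μ y.2.2 y.2.1.cur) s' *
          -f y.1 (y.2.1.next (μ y.2.2 y.2.1.cur) s') ∂(B.law μ t) := by
      refine integral_le_integral_law hμ (hbd t).neg (BoundedAt.sum _ fun s' _ => ?_) fun y _ => ?_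
      · refine BoundedAt.mul ?_ (hφ s')
        refine BoundedAt.action hμ (f := fun a y => B.jointP y.1 y.2.1.cur a s') fun a => ?_
        refine .of_forall_history t (fun h => ?_) fun h => ⟨1, fun θ ϑ => ?_⟩
        · exact (B.measurable_jointP h.cur a s').fun_comp measurable_fst
        · rw [abs_of_nonneg (B.jointP_nonneg _ _ _ _), ← B.sum_jointP θ h.cur a]
          exact Finset.single_le_sum (fun z _ => B.jointP_nonneg θ h.cur a z) (Finset.mem_univ s')
      · have := hsum y
        simp only [mul_neg, Finset.sum_neg_distrib]
        linarith
    have h6 := h5.trans h1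
    rw [integral_neg, integral_neg] at h6
    linarith

variable (B) in
/-- The parameter `θ` is outside of the confidence set of radius `β / √N` of the history `h`. -/
def Implausible (i : Fin n) (u : S i → ℝ) (β : ℝ) (θ : ∀ i, Θ i) (h : History S) : Prop :=
  ∃ z : S i × Bool, 0 < visits h.past i z.1 z.2 ∧
    β * √(visits h.past i z.1 z.2 : ℝ) < |B.deviation i u z.1 z.2 θ h|

theorem measurableSet_implausible (i : Fin n) (u : S i → ℝ) (β : ℝ) (h : History S) :
    MeasurableSet {θ | B.Implausible i u β θ h} := by
  simp only [Implausible, Set.ofPred_exists]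
  refine MeasurableSet.iUnion fun z => ?_
  by_cases hv : 0 < visits h.past i z.1 z.2
  · simp only [hv, true_and]
    exact measurableSet_lt measurable_const (measurable_deviation i u z.1 z.2 h).abs
  · simp [hv]

open Classical in
theorem measurable_implausible (i : Fin n) (u : S i → ℝ) (β : ℝ) (h : History S) :
    Measurable fun θ => if B.Implausible i u β θ h then (1 : ℝ) else 0 :=
  Measurable.ite (measurableSet_implausible i u β h) measurable_const measurable_const

open Classical in
theorem boundedAt_implausible (t : ℕ) (i : Fin n) (u : S i → ℝ) (β : ℝ) :
    BoundedAt t fun y : (∀ i, Θ i) × History S × (∀ i, Θ i) =>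
      if B.Implausible i u β y.1 y.2.1 then (1 : ℝ) else 0 :=
  .of_forall_history t (fun h => (measurable_implausible i u β h).fun_comp measurable_fst)
    fun h => ⟨1, fun θ ϑ => by dsimp only; split_ifs <;> simp⟩

open Classical in
/-- The true parameter is implausible with small probability: a union bound over the state-action
pairs and over the possible numbers of visits. -/
theorem integral_implausible_le (hμ : ∀ s, Measurable fun θ => μ θ s) (t : ℕ) (i : Fin n)
    {u : S i → ℝ} (hu : ∀ y, 0 ≤ u y ∧ u y ≤ 1) {β : ℝ} (hβ : 0 < β) :
    ∫ y, (if B.Implausible i u β y.1 y.2.1 then (1 : ℝ) else 0) ∂(B.law μ t) ≤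
      4 * Fintype.card (S i) * t * Real.exp (-(β ^ 2 / 4)) := by
  -- the exponent that is optimal for exactly `k` visits
  let c : ℕ → ℝ := fun k => β / (2 * √(k : ℝ))
  let f : ℝ → S i × Bool → (∀ i, Θ i) × History S × (∀ i, Θ i) → ℝ := fun c z y =>
    Real.exp (c * B.deviation i u z.1 z.2 y.1 y.2.1 - c ^ 2 * visits y.2.1.past i z.1 z.2)
  have hbf : ∀ c z, BoundedAt t (f c z) := fun c z => boundedAt_exp_deviation t i hu z.1 z.2 c
  have hpt : ∀ y : (∀ i, Θ i) × History S × (∀ i, Θ i), y.2.1.past.length = t →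
      (if B.Implausible i u β y.1 y.2.1 then (1 : ℝ) else 0) ≤
        ∑ z : S i × Bool, ∑ k ∈ Finset.Icc 1 t,
          Real.exp (-(β ^ 2 / 4)) * (f (c k) z y + f (-c k) z y) := by
    intro y hy
    have hnn : ∀ z k, 0 ≤ Real.exp (-(β ^ 2 / 4)) * (f (c k) z y + f (-c k) z y) := fun z k => by
      dsimp only [f]; positivity
    split_ifs with hbad
    swap
    · exact Finset.sum_nonneg fun z _ => Finset.sum_nonneg fun k _ => hnn z k
    obtain ⟨z, hz0, hz⟩ := hbad
    set k := visits y.2.1.past i z.1 z.2 with hk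
    have hkt : k ∈ Finset.Icc 1 t :=
      Finset.mem_Icc.2 ⟨hz0, hy ▸ visits_le_length y.2.1.past i z.1 z.2⟩
    refine le_trans ?_ (Finset.single_le_sum (fun z _ => Finset.sum_nonneg fun k _ => hnn z k)
      (Finset.mem_univ z))
    refine le_trans ?_ (Finset.single_le_sum (fun k _ => hnn z k) hkt)
    have hk0 : (0 : ℝ) < k := by exact_mod_cast hz0
    have hs0 : 0 < √(k : ℝ) := Real.sqrt_pos.2 hk0
    have hc2 : c k ^ 2 * k = β ^ 2 / 4 := by
      dsimp only [c]
      rw [div_pow, mul_pow, Real.sq_sqrt hk0.le]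
      field_simp; norm_num
    have hc0 : 0 < c k := by dsimp only [c]; positivity
    have hcβ : c k * (β * √(k : ℝ)) = β ^ 2 / 2 := by
      dsimp only [c]; field_simp
    have hone : ∀ e : ℝ, β ^ 2 / 2 ≤ e → 1 ≤ Real.exp (-(β ^ 2 / 4)) * Real.exp (e - β ^ 2 / 4) := by
      intro e he
      rw [← Real.exp_add]
      exact Real.one_le_exp (by linarith)
    have h1 := mul_le_mul_of_nonneg_left hz.le hc0.le
    rw [hcβ] at h1
    rw [mul_add]
    have hp1 : 0 ≤ Real.exp (-(β ^ 2 / 4)) * f (c k) z y := by dsimp only [f]; positivity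
    have hp2 : 0 ≤ Real.exp (-(β ^ 2 / 4)) * f (-c k) z y := by dsimp only [f]; positivity
    rcases abs_cases (B.deviation i u z.1 z.2 y.1 y.2.1) with ⟨hd, _⟩ | ⟨hd, _⟩
    · have := hone (c k * B.deviation i u z.1 z.2 y.1 y.2.1) (by rw [hd] at h1; linarith)
      have h2 : f (c k) z y = Real.exp (c k * B.deviation i u z.1 z.2 y.1 y.2.1 - β ^ 2 / 4) := by
        dsimp only [f]; rw [← hk, hc2]
      rw [← h2] at this
      linarith
    · have := hone (-c k * B.deviation i u z.1 z.2 y.1 y.2.1) (by rw [hd] at h1; linarith)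
      have h2 : f (-c k) z y =
          Real.exp (-c k * B.deviation i u z.1 z.2 y.1 y.2.1 - β ^ 2 / 4) := by
        dsimp only [f]; rw [← hk, neg_sq, hc2]
      rw [← h2] at this
      linarith
  have hb2 : ∀ z k, BoundedAt t fun y =>
      Real.exp (-(β ^ 2 / 4)) * (f (c k) z y + f (-c k) z y) := fun z k =>
    (BoundedAt.const t _).mul ((hbf _ z).add (hbf _ z))
  refine (integral_le_integral_law hμ (boundedAt_implausible t i u β)
    (BoundedAt.sum _ fun z _ => BoundedAt.sum _ fun k _ => hb2 z k) hpt).trans ?_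
  rw [integral_finsetSum _ fun z _ =>
    (BoundedAt.sum _ fun k _ => hb2 z k).integrable hμ]
  have hz : ∀ z : S i × Bool, ∫ y, ∑ k ∈ Finset.Icc 1 t,
      Real.exp (-(β ^ 2 / 4)) * (f (c k) z y + f (-c k) z y) ∂(B.law μ t) ≤
        t * (2 * Real.exp (-(β ^ 2 / 4))) := by
    intro z
    rw [integral_finsetSum _ fun k _ => (hb2 z k).integrable hμ]
    have : ∀ k ∈ Finset.Icc 1 t, ∫ y, Real.exp (-(β ^ 2 / 4)) * (f (c k) z y + f (-c k) z y)
        ∂(B.law μ t) ≤ 2 * Real.exp (-(β ^ 2 / 4)) := by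
      intro k _
      rw [integral_const_mul, integral_add ((hbf _ z).integrable hμ) ((hbf _ z).integrable hμ)]
      have h1 := integral_exp_deviation_le (B := B) hμ t i hu z.1 z.2 (c k)
      have h2 := integral_exp_deviation_le (B := B) hμ t i hu z.1 z.2 (-c k)
      have h3 := mul_le_mul_of_nonneg_left (add_le_add h1 h2) (Real.exp_pos (-(β ^ 2 / 4))).le
      refine h3.trans (le_of_eq (by ring))
    refine (Finset.sum_le_sum this).trans ?_
    simp
  refine (Finset.sum_le_sum fun z _ => hz z).trans (le_of_eq ?_)
  rw [Finset.sum_const, Finset.card_univ, Fintype.card_prod, Fintype.card_bool, nsmul_eq_mul]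
  push_cast; ring

open Classical in
theorem boundedAt_episode_implausible (t : ℕ) (i : Fin n) (u : S i → ℝ) (β : ℝ) :
    BoundedAt t fun y : (∀ i, Θ i) × History S × (∀ i, Θ i) =>
      if B.Implausible i u β y.1 (episodeHistory y.2.1.past y.2.1.cur) ∨
        B.Implausible i u β y.2.2 (episodeHistory y.2.1.past y.2.1.cur) then (1 : ℝ) else 0 := by
  refine .of_forall_history t (fun h => ?_) fun h => ⟨1, fun θ ϑ => by
    dsimp only; split_ifs <;> simp⟩
  refine Measurable.ite ?_ measurable_const measurable_const
  exact (measurable_fst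
      (measurableSet_implausible (B := B) i u β (episodeHistory h.past h.cur))).union
    (measurable_snd (measurableSet_implausible (B := B) i u β (episodeHistory h.past h.cur)))

open Classical in
/-- The true parameter or the sampled parameter is implausible given the history at the start of
the episode in force. The sampled parameter is as plausible as the true one at that time. -/
theorem integral_episode_implausible_le (hμ : ∀ s, Measurable fun θ => μ θ s) {T : ℕ} {t : ℕ}
    (ht : t < T) (i : Fin n) {u : S i → ℝ} (hu : ∀ y, 0 ≤ u y ∧ u y ≤ 1) {β : ℝ} (hβ : 0 < β) :
    ∫ y, (if B.Implausible i u β y.1 (episodeHistory y.2.1.past y.2.1.cur) ∨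
        B.Implausible i u β y.2.2 (episodeHistory y.2.1.past y.2.1.cur) then (1 : ℝ) else 0)
      ∂(B.law μ t) ≤ (t + 1) * (8 * Fintype.card (S i) * T * Real.exp (-(β ^ 2 / 4))) := by
  let I : (∀ i, Θ i) × History S × (∀ i, Θ i) → ℝ := fun y =>
    if B.Implausible i u β y.1 (episodeHistory y.2.1.past y.2.1.cur) ∨
      B.Implausible i u β y.2.2 (episodeHistory y.2.1.past y.2.1.cur) then (1 : ℝ) else 0
  let f : History S → (∀ i, Θ i) → ℝ := fun h θ => if B.Implausible i u β θ h then 1 else 0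
  have hf : ∀ h, Measurable (f h) := measurable_implausible i u β
  have hf0 : ∀ h θ, 0 ≤ f h θ := fun h θ => by dsimp only [f]; split_ifs <;> norm_num
  have hf1 : ∀ h θ, |f h θ| ≤ 1 := fun h θ => by dsimp only [f]; split_ifs <;> norm_num
  let G₁ : (∀ i, Θ i) × History S × (∀ i, Θ i) → ℝ := fun y =>
    if StartsAt y.2.1.past then f y.2.1 y.1 else 0
  let G₂ : (∀ i, Θ i) × History S × (∀ i, Θ i) → ℝ := fun y =>
    if StartsAt y.2.1.past then f y.2.1 y.2.2 else 0
  have hI : ∀ t, BoundedAt t I := fun t => boundedAt_episode_implausible t i u β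
  have hG₁ : ∀ t, BoundedAt t G₁ := by
    intro t
    refine .of_forall_history t (fun h => ?_) fun h => ⟨1, fun θ ϑ => by
      dsimp only [G₁]; split_ifs; exacts [hf1 _ _, by simp]⟩
    by_cases hst : StartsAt h.past
    · simpa only [G₁, if_pos hst] using (hf h).fun_comp measurable_fst
    · simp [G₁, hst]
  have hG₂ : ∀ t, BoundedAt t G₂ := by
    intro t
    refine .of_forall_history t (fun h => ?_) fun h => ⟨1, fun θ ϑ => by
      dsimp only [G₂]; split_ifs; exacts [hf1 _ _, by simp]⟩
    by_cases hst : StartsAt h.past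
    · simpa only [G₂, if_pos hst] using (hf h).fun_comp measurable_snd
    · simp [G₂, hst]
  have hG : ∀ t, t < T → ∫ y, G₁ y + G₂ y ∂(B.law μ t) ≤
      8 * Fintype.card (S i) * T * Real.exp (-(β ^ 2 / 4)) := by
    intro t ht
    rw [integral_add ((hG₁ t).integrable hμ) ((hG₂ t).integrable hμ)]
    have h1 : ∫ y, G₂ y ∂(B.law μ t) = ∫ y, G₁ y ∂(B.law μ t) :=
      integral_sample_eq hμ t hf hf0
    have h2 : ∫ y, G₁ y ∂(B.law μ t) ≤ ∫ y, f y.2.1 y.1 ∂(B.law μ t) := by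
      refine integral_le_integral_law hμ (hG₁ t) (boundedAt_implausible t i u β) fun y _ => ?_
      dsimp only [G₁]; split_ifs
      exacts [le_rfl, hf0 _ _]
    have h3 := h2.trans (integral_implausible_le (B := B) hμ t i hu hβ)
    have h4 : 4 * (Fintype.card (S i) : ℝ) * t * Real.exp (-(β ^ 2 / 4)) ≤
        4 * (Fintype.card (S i) : ℝ) * T * Real.exp (-(β ^ 2 / 4)) := by gcongr
    rw [h1]
    linarith
  have hIst : ∀ y : (∀ i, Θ i) × History S × (∀ i, Θ i), StartsAt y.2.1.past →
      I y ≤ G₁ y + G₂ y := by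
    intro y hst
    have e : episodeHistory y.2.1.past y.2.1.cur = y.2.1 := episodeHistory_of_startsAt _ hst
    dsimp only [I, G₁, G₂]
    rw [e, if_pos hst, if_pos hst]
    dsimp only [f]
    by_cases h1 : B.Implausible i u β y.1 y.2.1 <;> by_cases h2 : B.Implausible i u β y.2.2 y.2.1 <;>
      simp [h1, h2]
  change ∫ y, I y ∂(B.law μ t) ≤ _
  induction t with
  | zero =>
    refine (integral_le_integral_law hμ (hI 0) ((hG₁ 0).add (hG₂ 0)) fun y hy => ?_).trans
      ((hG 0 ht).trans (by simp))
    refine hIst y ?_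
    rw [List.length_eq_zero_iff.1 hy]
    exact startsAt_nil
  | succ t ih =>
    have h1 : ∫ y, -I y ∂(B.law μ t) ≤ ∫ y, ((G₁ y + G₂ y) - I y) ∂(B.law μ (t + 1)) := by
      refine integral_le_integral_law_succ hμ t (((hG₁ _).add (hG₂ _)).sub (hI _)) (hI t).neg
        fun y s' ϑ' _ hs => ?_
      by_cases hst : StartsAt (y.2.1.next (μ y.2.2 y.2.1.cur) s').past
      · have h2 := hIst (y.1, y.2.1.next (μ y.2.2 y.2.1.cur) s', ϑ') hst
        have h3 : 0 ≤ I y := by dsimp only [I]; split_ifs <;> norm_num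
        linarith
      · have hϑ : ϑ' = y.2.2 := hs.resolve_left hst
        subst hϑ
        have e : episodeHistory (y.2.1.next (μ y.2.2 y.2.1.cur) s').past s' =
            episodeHistory y.2.1.past y.2.1.cur := by
          have hst' : ¬ StartsAt ((y.2.1.cur, μ y.2.2 y.2.1.cur) :: y.2.1.past) := hst
          rw [History.next, episodeHistory, if_neg hst']
        have h2 : I (y.1, y.2.1.next (μ y.2.2 y.2.1.cur) s', y.2.2) = I y := by
          dsimp only [I]
          rw [show (y.2.1.next (μ y.2.2 y.2.1.cur) s').cur = s' from rfl, e]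
        have h3 : ∀ ϑ, 0 ≤ G₁ (y.1, y.2.1.next (μ y.2.2 y.2.1.cur) s', ϑ) := fun ϑ => by
          dsimp only [G₁]; rw [if_neg hst]
        have h4 : ∀ ϑ, 0 ≤ G₂ (y.1, y.2.1.next (μ y.2.2 y.2.1.cur) s', ϑ) := fun ϑ => by
          dsimp only [G₂]; rw [if_neg hst]
        have := h3 y.2.2
        have := h4 y.2.2
        linarith
    rw [integral_sub (((hG₁ _).add (hG₂ _)).integrable hμ) ((hI _).integrable hμ),
      integral_neg] at h1
    have h2 := hG (t + 1) ht
    have h3 := ih (by omega)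
    push_cast
    linarith

/-- Sum of the confidence radii along the visits of arm `i`. -/
theorem sum_integral_inv_sqrt_visits_le (hμ : ∀ s, Measurable fun θ => μ θ s) (T : ℕ)
    (i : Fin n) :
    ∑ t ∈ Finset.range T, ∫ y, 1 / √(max (visits y.2.1.past i (y.2.1.cur i)
        (μ y.2.2 y.2.1.cur i) : ℝ) 1) ∂(B.law μ t) ≤ 3 * √(2 * Fintype.card (S i) * T) := by
  classical
  let ψ : (∀ i, Θ i) × History S × (∀ i, Θ i) → ℝ := fun y =>
    ∑ z : S i × Bool, √(visits y.2.1.past i z.1 z.2 : ℝ)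
  let ρ : (∀ i, Θ i) × History S × (∀ i, Θ i) → ℝ := fun y =>
    1 / √(max (visits y.2.1.past i (y.2.1.cur i) (μ y.2.2 y.2.1.cur i) : ℝ) 1)
  have hψ : ∀ t, BoundedAt t ψ := fun t =>
    BoundedAt.history t fun h => ∑ z : S i × Bool, √(visits h.past i z.1 z.2 : ℝ)
  have hρ : ∀ t, BoundedAt t ρ := fun t =>
    BoundedAt.action hμ (f := fun a y => 1 / √(max (visits y.2.1.past i (y.2.1.cur i) (a i) : ℝ) 1))
      fun a => BoundedAt.history t fun h =>
        1 / √(max (visits h.past i (h.cur i) (a i) : ℝ) 1)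
  have hstep : ∀ t, ∫ y, (3 * ψ y + ρ y) ∂(B.law μ t) ≤ ∫ y, 3 * ψ y ∂(B.law μ (t + 1)) := by
    intro t
    refine integral_le_integral_law_succ hμ t ((BoundedAt.const _ 3).mul (hψ _))
      (((BoundedAt.const _ 3).mul (hψ _)).add (hρ t)) fun y s' ϑ' _ _ => ?_
    set a := μ y.2.2 y.2.1.cur
    dsimp only [ψ, ρ, History.next]
    set z₀ : S i × Bool := (y.2.1.cur i, a i)
    have h1 := inv_sqrt_max_le (visits y.2.1.past i z₀.1 z₀.2)
    rw [← Finset.add_sum_erase _ _ (Finset.mem_univ z₀),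
      ← Finset.add_sum_erase _ _ (Finset.mem_univ z₀)]
    have h2 : ∑ z ∈ Finset.univ.erase z₀, √(visits y.2.1.past i z.1 z.2 : ℝ) ≤
        ∑ z ∈ Finset.univ.erase z₀, √(visits ((y.2.1.cur, a) :: y.2.1.past) i z.1 z.2 : ℝ) :=
      Finset.sum_le_sum fun z _ => Real.sqrt_le_sqrt
        (Nat.cast_le.2 (visits_le_cons _ _ _ _ _))
    have h3 : (visits ((y.2.1.cur, a) :: y.2.1.past) i z₀.1 z₀.2 : ℝ) =
        visits y.2.1.past i z₀.1 z₀.2 + 1 := by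
      rw [visits_cons, if_pos ⟨rfl, rfl⟩]; push_cast; ring
    rw [h3]
    linarith
  have hind : ∀ T : ℕ, ∑ t ∈ Finset.range T, ∫ y, ρ y ∂(B.law μ t) ≤
      ∫ y, 3 * ψ y ∂(B.law μ T) := by
    intro T
    induction T with
    | zero =>
      simp only [Finset.range_zero, Finset.sum_empty]
      refine integral_nonneg fun y => ?_
      dsimp only [ψ, Pi.zero_apply]; positivity
    | succ T ih =>
      rw [Finset.sum_range_succ]
      refine le_trans ?_ (hstep T)
      rw [integral_add (((BoundedAt.const _ 3).mul (hψ _)).integrable hμ) ((hρ T).integrable hμ)]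
      linarith
  refine (hind T).trans ?_
  have := isProbabilityMeasure_law (B := B) hμ T
  refine (integral_le_integral_law hμ ((BoundedAt.const _ 3).mul (hψ _))
    (BoundedAt.const T (3 * √(2 * Fintype.card (S i) * T))) fun y hy => ?_).trans (by simp)
  dsimp only [ψ]
  rw [← hy]
  exact mul_le_mul_of_nonneg_left (sum_sqrt_visits_le y.2.1.past i) (by norm_num)

/-- If both parameters are plausible at the start of the episode, their one-step means at the
current state and action are close. -/
theorem abs_armMean_sub_le (i : Fin n) {u : S i → ℝ} (hu : ∀ y, 0 ≤ u y ∧ u y ≤ 1) {β : ℝ}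
    (hβ : 1 ≤ β) (θ ϑ : ∀ i, Θ i) (h : History S) (a : Bool)
    (h1 : ¬ B.Implausible i u β θ (episodeHistory h.past h.cur))
    (h2 : ¬ B.Implausible i u β ϑ (episodeHistory h.past h.cur)) :
    |B.armMean i u (h.cur i) a ϑ - B.armMean i u (h.cur i) a θ| ≤
      2 * √2 * β * (1 / √(max (visits h.past i (h.cur i) a : ℝ) 1)) := by
  set e := episodeHistory h.past h.cur with he
  set N := visits e.past i (h.cur i) a with hN
  have hv : visits h.past i (h.cur i) a ≤ 2 * N := by
    rw [hN, he, episodeHistory_past]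
    exact visits_le_two_mul _ _ _ _
  have hs2 : 1 ≤ √(2 : ℝ) := Real.one_le_sqrt.2 (by norm_num)
  rcases Nat.eq_zero_or_pos N with h0 | h0
  · have hv0 : visits h.past i (h.cur i) a = 0 := by omega
    rw [hv0]
    have h3 := armMean_mem (B := B) i hu (h.cur i) a ϑ
    have h4 := armMean_mem (B := B) i hu (h.cur i) a θ
    have : |B.armMean i u (h.cur i) a ϑ - B.armMean i u (h.cur i) a θ| ≤ 1 := by
      rw [abs_le]; constructor <;> linarith
    simp only [Nat.cast_zero, zero_le_one, max_eq_right, Real.sqrt_one, div_one, mul_one]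
    nlinarith
  · have hN0 : (0 : ℝ) < N := by exact_mod_cast h0
    have hN1 : (1 : ℝ) ≤ N := by exact_mod_cast h0
    have hsN : 0 < √(N : ℝ) := Real.sqrt_pos.2 hN0
    have hd : ∀ θ, ¬ B.Implausible i u β θ e →
        |B.deviation i u (h.cur i) a θ e| ≤ β * √(N : ℝ) := fun θ hθ => by
      by_contra hlt
      exact hθ ⟨(h.cur i, a), h0, not_le.1 hlt⟩
    have h3 : (N : ℝ) * |B.armMean i u (h.cur i) a ϑ - B.armMean i u (h.cur i) a θ| ≤
        2 * β * √(N : ℝ) := by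
      rw [← abs_of_pos hN0, ← abs_mul, abs_of_pos hN0]
      have : (N : ℝ) * (B.armMean i u (h.cur i) a ϑ - B.armMean i u (h.cur i) a θ) =
          B.deviation i u (h.cur i) a θ e - B.deviation i u (h.cur i) a ϑ e := by
        simp only [deviation]; ring
      rw [this]
      refine (abs_sub _ _).trans ?_
      linarith [hd θ h1, hd ϑ h2]
    have h4 : |B.armMean i u (h.cur i) a ϑ - B.armMean i u (h.cur i) a θ| ≤ 2 * β / √(N : ℝ) := by
      rw [le_div_iff₀ hsN]
      refine le_of_mul_le_mul_left ?_ hsN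
      rw [mul_left_comm, Real.mul_self_sqrt hN0.le]
      linarith
    refine h4.trans ?_
    have hm : max (visits h.past i (h.cur i) a : ℝ) 1 ≤ 2 * N := by
      refine max_le (by exact_mod_cast hv) (by linarith)
    have hm0 : 0 < max (visits h.past i (h.cur i) a : ℝ) 1 := lt_max_of_lt_right one_pos
    have h5 : √(max (visits h.past i (h.cur i) a : ℝ) 1) ≤ √2 * √(N : ℝ) := by
      rw [← Real.sqrt_mul (by norm_num)]
      exact Real.sqrt_le_sqrt hm
    rw [mul_one_div, div_le_div_iff₀ hsN (Real.sqrt_pos.2 hm0)]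
    have := mul_le_mul_of_nonneg_left h5 (show 0 ≤ 2 * β by linarith)
    linarith

theorem boundedAt_armMean_sub (hμ : ∀ s, Measurable fun θ => μ θ s) (t : ℕ) (i : Fin n)
    {u : S i → ℝ} (hu : ∀ y, 0 ≤ u y ∧ u y ≤ 1) :
    BoundedAt t fun y : (∀ i, Θ i) × History S × (∀ i, Θ i) =>
      |B.armMean i u (y.2.1.cur i) (μ y.2.2 y.2.1.cur i) y.2.2 -
        B.armMean i u (y.2.1.cur i) (μ y.2.2 y.2.1.cur i) y.1| := by
  refine BoundedAt.action hμ (f := fun a y => |B.armMean i u (y.2.1.cur i) (a i) y.2.2 -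
        B.armMean i u (y.2.1.cur i) (a i) y.1|) fun a => BoundedAt.abs ?_
  refine .of_forall_history t (fun h => ?_) fun h => ⟨2, fun θ ϑ => ?_⟩
  · exact ((measurable_armMean (B := B) i u (h.cur i) (a i)).fun_comp measurable_snd).sub
      ((measurable_armMean (B := B) i u (h.cur i) (a i)).fun_comp measurable_fst)
  · refine (abs_sub _ _).trans ?_
    linarith [abs_armMean_le (B := B) i hu (h.cur i) (a i) ϑ,
      abs_armMean_le (B := B) i hu (h.cur i) (a i) θ]

/-- The expected cumulative error in predicting a test function of arm `i`. -/
theorem sum_integral_armMean_sub_le (hμ : ∀ s, Measurable fun θ => μ θ s) {T : ℕ} (hT : 0 < T)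
    (i : Fin n) [Nonempty (S i)] {u : S i → ℝ} (hu : ∀ y, 0 ≤ u y ∧ u y ≤ 1) :
    ∑ t ∈ Finset.range T, ∫ y, |B.armMean i u (y.2.1.cur i) (μ y.2.2 y.2.1.cur i) y.2.2 -
        B.armMean i u (y.2.1.cur i) (μ y.2.2 y.2.1.cur i) y.1| ∂(B.law μ t) ≤
      49 * √(Fintype.card (S i) * T * Real.log (3 * T)) := by
  classical
  set Lg := Real.log (3 * T) with hLgdef
  have hLg : 1 ≤ Lg := one_le_log_three_mul hT
  have hT1 : (1 : ℝ) ≤ T := by exact_mod_cast hT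
  have hS1 : (1 : ℝ) ≤ Fintype.card (S i) := by exact_mod_cast Fintype.card_pos
  set c := (Fintype.card (S i) : ℝ)
  -- With this radius the failure probabilities are summable against the union bounds.
  set β := 4 * √Lg with hβdef
  have hsL : 1 ≤ √Lg := Real.one_le_sqrt.2 hLg
  have hβ1 : 1 ≤ β := by linarith
  have hexp : Real.exp (-(β ^ 2 / 4)) = 1 / (3 * T) ^ 4 := by
    have h1 : β ^ 2 / 4 = (4 : ℕ) * Lg := by
      rw [hβdef, mul_pow, Real.sq_sqrt (by linarith)]; push_cast; ring
    rw [h1, Real.exp_neg, Real.exp_nat_mul, hLgdef, Real.exp_log (by positivity), one_div]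
  let I : (∀ i, Θ i) × History S × (∀ i, Θ i) → ℝ := fun y =>
    if B.Implausible i u β y.1 (episodeHistory y.2.1.past y.2.1.cur) ∨
      B.Implausible i u β y.2.2 (episodeHistory y.2.1.past y.2.1.cur) then (1 : ℝ) else 0
  let ρ : (∀ i, Θ i) × History S × (∀ i, Θ i) → ℝ := fun y =>
    1 / √(max (visits y.2.1.past i (y.2.1.cur i) (μ y.2.2 y.2.1.cur i) : ℝ) 1)
  have hρ : ∀ t, BoundedAt t ρ := fun t =>
    BoundedAt.action hμ (f := fun a y => 1 / √(max (visits y.2.1.past i (y.2.1.cur i) (a i) : ℝ) 1))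
      fun a => BoundedAt.history t fun h =>
        1 / √(max (visits h.past i (h.cur i) (a i) : ℝ) 1)
  have hI : ∀ t, BoundedAt t I := fun t => boundedAt_episode_implausible t i u β
  have hIint : ∀ t, t < T → ∫ y, I y ∂(B.law μ t) ≤ √c / T := by
    intro t ht
    have hp := isProbabilityMeasure_law (B := B) hμ t
    have h1 : ∫ y, I y ∂(B.law μ t) ≤ 1 := by
      refine (integral_le_integral_law hμ (hI t) (BoundedAt.const t 1) fun y _ => ?_).trans
        (by simp)
      dsimp only [I]; split_ifs <;> norm_num
    have h0 : 0 ≤ ∫ y, I y ∂(B.law μ t) :=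
      integral_nonneg fun y => by dsimp only [I, Pi.zero_apply]; split_ifs <;> norm_num
    have h2 : ∫ y, I y ∂(B.law μ t) ≤ c / T ^ 2 := by
      refine (integral_episode_implausible_le hμ ht i hu (by linarith)).trans ?_
      rw [hexp]
      have h3 : ((t : ℝ) + 1) ≤ T := by exact_mod_cast ht
      calc ((t : ℝ) + 1) * (8 * c * T * (1 / (3 * T) ^ 4))
          ≤ T * (8 * c * T * (1 / (3 * T) ^ 4)) := by gcongr
        _ = 8 / 81 * (c / T ^ 2) := by field_simp; norm_num
        _ ≤ c / T ^ 2 := by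
            have : 0 ≤ c / (T : ℝ) ^ 2 := by positivity
            linarith
    have h3 : √c / T = √(c / T ^ 2) := by
      rw [Real.sqrt_div' _ (by positivity), Real.sqrt_sq (by positivity)]
    rw [h3]
    exact Real.le_sqrt_of_sq_le (by nlinarith)
  have hone : ∀ t ∈ Finset.range T,
      ∫ y, |B.armMean i u (y.2.1.cur i) (μ y.2.2 y.2.1.cur i) y.2.2 -
        B.armMean i u (y.2.1.cur i) (μ y.2.2 y.2.1.cur i) y.1| ∂(B.law μ t) ≤
      2 * √2 * β * ∫ y, ρ y ∂(B.law μ t) + √c / T := by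
    intro t ht
    have hbd := (BoundedAt.const t (2 * √2 * β)).mul (hρ t)
    refine (integral_le_integral_law hμ (boundedAt_armMean_sub hμ t i hu)
      (hbd.add (hI t)) fun y _ => ?_).trans ?_
    · have hρ0 : 0 ≤ 2 * √2 * β * ρ y := by dsimp only [ρ]; positivity
      dsimp only [I]
      split_ifs with hbad
      · have h3 := armMean_mem (B := B) i hu (y.2.1.cur i) (μ y.2.2 y.2.1.cur i) y.2.2
        have h4 := armMean_mem (B := B) i hu (y.2.1.cur i) (μ y.2.2 y.2.1.cur i) y.1
        refine le_trans (b := 1) ?_ (by linarith)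
        rw [abs_le]; constructor <;> linarith
      · rw [not_or] at hbad
        rw [add_zero]
        exact abs_armMean_sub_le i hu hβ1 y.1 y.2.2 y.2.1 _ hbad.1 hbad.2
    · rw [integral_add (hbd.integrable hμ) ((hI t).integrable hμ), integral_const_mul]
      exact add_le_add le_rfl (hIint t (Finset.mem_range.1 ht))
  refine (Finset.sum_le_sum hone).trans ?_
  rw [Finset.sum_add_distrib, ← Finset.mul_sum, Finset.sum_const, Finset.card_range, nsmul_eq_mul]
  have h1 := sum_integral_inv_sqrt_visits_le (B := B) hμ T i
  have h2 : (T : ℝ) * (√c / T) = √c := by field_simp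
  have h3 : √(c * T * Lg) = √(c * T) * √Lg := Real.sqrt_mul (by positivity) _
  have h4 : √(2 * c * T) = √2 * √(c * T) := by
    rw [mul_assoc, Real.sqrt_mul (by norm_num)]
  have h5 : √c ≤ √(c * T) * √Lg := by
    rw [← h3]
    refine Real.sqrt_le_sqrt ?_
    nlinarith [mul_le_mul hT1 hLg (by norm_num) (by linarith)]
  have h6 : √(2 : ℝ) * √2 = 2 := Real.mul_self_sqrt (by norm_num)
  rw [h2, h3]
  rw [h4] at h1
  have h7 := mul_le_mul_of_nonneg_left h1 (show 0 ≤ 2 * √2 * β by positivity)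
  have h8 : 2 * √2 * β * (3 * (√2 * √(c * T))) = 48 * (√(c * T) * √Lg) := by
    rw [hβdef]
    linear_combination 24 * √Lg * √(c * T) * h6
  linarith

end RestlessBandit

/-! ### The product metric -/

theorem productDist_update {n : ℕ} {S : Fin n → Type u} [∀ i, MetricSpace (S i)]
    {p : ℝ} (hp : 1 ≤ p) (s : ∀ i, S i)
    (i : Fin n) (y y' : S i) :
    productDist p (Function.update s i y) (Function.update s i y') = dist y y' := by
  have hp0 : p ≠ 0 := by linarith
  rw [productDist, Finset.sum_eq_single i, Function.update_self, Function.update_self, one_div,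
    Real.rpow_rpow_inv dist_nonneg hp0]
  · intro j _ hj
    rw [Function.update_of_ne hj, Function.update_of_ne hj, dist_self, Real.zero_rpow hp0]
  · simp

namespace RestlessBandit

variable {n : ℕ} {S : Fin n → Type u} [∀ i, Fintype (S i)]
  {Θ : Fin n → Type v} [∀ i, MeasurableSpace (Θ i)] {B : RestlessBandit S Θ}
  {μ : (∀ i, Θ i) → (∀ i, S i) → (Fin n → Bool)}

/-! ### Rewards and differential values -/

theorem reward_mem {Rmax : ℝ} (hR0 : 0 ≤ Rmax) (hr : ∀ i s b, 0 ≤ B.r i s b ∧ B.r i s b ≤ Rmax)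
    (s : ∀ i, S i) (a : Fin n → Bool) : 0 ≤ B.reward s a ∧ B.reward s a ≤ n * Rmax := by
  have h : ∀ i s b, 0 ≤ B.armReward i s b ∧ B.armReward i s b ≤ Rmax := by
    intro i s b
    unfold armReward
    split
    · exact hr i s b
    · split_ifs
      exacts [hr i s b, ⟨le_rfl, hR0⟩]
  refine ⟨Finset.sum_nonneg fun i _ => (h i _ _).1, ?_⟩
  refine (Finset.sum_le_sum fun i _ => (h i (s i) (a i)).2).trans ?_
  simp

theorem sum_chain (θ : ∀ i, Θ i) (s : ∀ i, S i) : ∑ s', B.chain μ θ s s' = 1 :=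
  B.sum_jointP θ s (μ θ s)

theorem measurable_chain (hμ : ∀ s, Measurable fun θ => μ θ s) (s s' : ∀ i, S i) :
    Measurable fun θ => B.chain μ θ s s' := by
  have h : Measurable fun z : (Fin n → Bool) × (∀ i, Θ i) => B.jointP z.2 s z.1 s' :=
    measurable_from_prod_countable_right fun a => B.measurable_jointP s a s'
  exact h.fun_comp ((hμ s).prodMk measurable_id)

theorem measurable_chainReward (hμ : ∀ s, Measurable fun θ => μ θ s) (s : ∀ i, S i) :
    Measurable fun θ => B.chainReward μ θ s :=
  (measurable_of_countable (B.reward s)).fun_comp (hμ s)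

section DifferentialValue

variable {Rmax lam : ℝ} {V : (∀ i, Θ i) → (∀ i, S i) → ℝ}

theorem abs_value_sub_le (hR0 : 0 ≤ Rmax) (hr : ∀ i s b, 0 ≤ B.r i s b ∧ B.r i s b ≤ Rmax)
    (hV : B.IsDifferentialValue μ V) (hlam1 : lam < 1)
    (hlam : ∀ θ, ergodicityCoeff (B.chain μ θ) ≤ lam) (θ : ∀ i, Θ i) (s s' : ∀ i, S i) :
    |V θ s - V θ s'| ≤ n * (Rmax / (1 - lam)) := by
  have h : ∀ s s', V θ s - V θ s' ≤ n * (Rmax / (1 - lam)) := fun s s' => by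
    rw [← mul_div_assoc]
    refine bellman_sub_le (fun x => sum_chain θ x) (hlam θ) hlam1 (ρ := B.chainReward μ θ)
      (fun x x' => ?_) (fun x => (hV θ x).2) s s'
    have h1 := (reward_mem hR0 hr x (μ θ x)).2
    have h2 := (reward_mem hR0 hr x' (μ θ x')).1
    unfold chainReward
    linarith
  exact abs_sub_le_iff.2 ⟨h s s', h s' s⟩

/-- Nothing is assumed on the dependence of `V` on `θ`. Its differences are nevertheless
measurable, because they are determined by the model. -/
theorem measurable_value_sub [∀ i, Nonempty (S i)] (hμ : ∀ s, Measurable fun θ => μ θ s)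
    (hV : B.IsDifferentialValue μ V) (hlam1 : lam < 1)
    (hlam : ∀ θ, ergodicityCoeff (B.chain μ θ) ≤ lam) (s s' : ∀ i, S i) :
    Measurable fun θ => V θ s - V θ s' := by
  have hit : ∀ (t : ℕ) (s : ∀ i, S i),
      Measurable fun θ => (expectNext (B.chain μ θ))^[t] (B.chainReward μ θ) s := by
    intro t
    induction t with
    | zero => exact measurable_chainReward hμ
    | succ t ih =>
      intro s
      simp only [Function.iterate_succ_apply']
      exact Finset.measurable_fun_sum _ fun z _ => (measurable_chain hμ s z).mul (ih z)
  refine measurable_of_tendsto_metrizable (f := fun (T : ℕ) θ => ∑ t ∈ Finset.range T,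
    ((expectNext (B.chain μ θ))^[t] (B.chainReward μ θ) s -
      (expectNext (B.chain μ θ))^[t] (B.chainReward μ θ) s'))
    (fun T => Finset.measurable_fun_sum _ fun t _ => (hit t s).sub (hit t s')) ?_
  rw [tendsto_pi_nhds]
  intro θ
  exact tendsto_bellman_sub (fun x => sum_chain θ x) ((hlam θ).trans_lt hlam1)
    (fun x => (hV θ x).2) s s'

theorem J_sub_chainReward_eq (hV : B.IsDifferentialValue μ V) (θ : ∀ i, Θ i) (s s₀ : ∀ i, S i) :
    B.J μ θ - B.chainReward μ θ s =
      ∑ z, B.chain μ θ s z * (V θ z - V θ s₀) - (V θ s - V θ s₀) := by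
  have h1 := (hV θ s).2
  simp only [mul_sub, Finset.sum_sub_distrib, ← Finset.sum_mul, sum_chain, one_mul]
  unfold expectNext at h1
  linarith

theorem measurable_J [∀ i, Nonempty (S i)] (hμ : ∀ s, Measurable fun θ => μ θ s)
    (hV : B.IsDifferentialValue μ V) (hlam1 : lam < 1)
    (hlam : ∀ θ, ergodicityCoeff (B.chain μ θ) ≤ lam) : Measurable (B.J μ) := by
  let s₀ : ∀ i, S i := fun i => Classical.arbitrary (S i)
  have h : B.J μ = fun θ => B.chainReward μ θ s₀ +
      (∑ z, B.chain μ θ s₀ z * (V θ z - V θ s₀) - (V θ s₀ - V θ s₀)) := by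
    funext θ
    rw [← J_sub_chainReward_eq hV θ s₀ s₀]; ring
  rw [h]
  have hm := measurable_value_sub hμ hV hlam1 hlam
  exact (measurable_chainReward hμ s₀).add ((Finset.measurable_fun_sum _ fun z _ =>
    (measurable_chain hμ s₀ z).mul (hm z s₀)).sub (hm s₀ s₀))

/-- The average reward lies between the extreme rewards: compare the Bellman equation at the
extreme points of the differential value. -/
theorem J_mem [∀ i, Nonempty (S i)] (hR0 : 0 ≤ Rmax)
    (hr : ∀ i s b, 0 ≤ B.r i s b ∧ B.r i s b ≤ Rmax)
    (hV : B.IsDifferentialValue μ V) (θ : ∀ i, Θ i) :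
    0 ≤ B.J μ θ ∧ B.J μ θ ≤ n * Rmax := by
  obtain ⟨a, -, ha⟩ := Finset.exists_max_image Finset.univ (V θ) Finset.univ_nonempty
  obtain ⟨b, -, hb⟩ := Finset.exists_min_image Finset.univ (V θ) Finset.univ_nonempty
  have hc : ∀ s s', 0 ≤ B.chain μ θ s s' := fun s s' => B.jointP_nonneg _ _ _ _
  constructor
  · have h1 := J_sub_chainReward_eq hV θ b b
    have h2 : 0 ≤ ∑ z, B.chain μ θ b z * (V θ z - V θ b) := Finset.sum_nonneg fun z hz =>
      mul_nonneg (hc b z) (sub_nonneg.2 (hb z hz))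
    have h3 : 0 ≤ B.chainReward μ θ b := (reward_mem hR0 hr b (μ θ b)).1
    linarith
  · have h1 := J_sub_chainReward_eq hV θ a a
    have h2 : ∑ z, B.chain μ θ a z * (V θ z - V θ a) ≤ 0 := Finset.sum_nonpos fun z hz =>
      mul_nonpos_of_nonneg_of_nonpos (hc a z) (sub_nonpos.2 (ha z hz))
    have h3 : B.chainReward μ θ a ≤ n * Rmax := (reward_mem hR0 hr a (μ θ a)).2
    linarith

end DifferentialValue

/-! ### Sensitivity of the one-step expectation to the parameter -/

theorem abs_sum_jointP_sub_le [∀ i, MetricSpace (S i)] {p : ℝ} (hp : 1 ≤ p) {Lv : ℝ}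
    {g : (∀ i, S i) → ℝ} (hg : ∀ s s', |g s - g s'| ≤ Lv * productDist p s s')
    {N : Fin n → ℕ} {u : ∀ i, ℕ → S i → ℝ} {w : Fin n → ℕ → ℝ}
    (hw : ∀ i (g : S i → ℝ) (L : ℝ), 0 ≤ L → (∀ x y, |g x - g y| ≤ L * dist x y) →
      ∀ d : S i → ℝ, ∑ x, d x = 0 →
        |∑ x, d x * g x| ≤ L * ∑ l ∈ Finset.range (N i), w i l * |∑ x, d x * u i l x|)
    (θ ϑ : ∀ i, Θ i) (s : ∀ i, S i) (a : Fin n → Bool) :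
    |∑ s', B.jointP ϑ s a s' * g s' - ∑ s', B.jointP θ s a s' * g s'| ≤
      ∑ i, max Lv 0 * ∑ l ∈ Finset.range (N i),
        w i l * |B.armMean i (u i l) (s i) (a i) ϑ - B.armMean i (u i l) (s i) (a i) θ| := by
  refine abs_sum_prod_sub_le (fun i => B.P i (ϑ i) (s i) (a i)) (fun i => B.P i (θ i) (s i) (a i))
    (fun i y => B.P_nonneg _ _ _ _ _) (fun i => B.P_sum _ _ _ _)
    (fun i y => B.P_nonneg _ _ _ _ _) (fun i => B.P_sum _ _ _ _) g _ fun i s₁ => ?_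
  have h := hw i (fun y => g (Function.update s₁ i y)) (max Lv 0) (le_max_right _ _)
    (fun y y' => by
      refine (hg _ _).trans ?_
      rw [productDist_update hp]
      exact mul_le_mul_of_nonneg_right (le_max_left _ _) dist_nonneg)
    (fun y => B.P i (ϑ i) (s i) (a i) y - B.P i (θ i) (s i) (a i) y)
    (by rw [Finset.sum_sub_distrib, B.P_sum, B.P_sum, sub_self])
  simpa only [armMean, sub_mul, Finset.sum_sub_distrib] using h

/-! ### Regret decomposition -/

theorem boundedAt_jointP (t : ℕ) (a : Fin n → Bool) (s' : ∀ i, S i) :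
    BoundedAt t fun y : (∀ i, Θ i) × History S × (∀ i, Θ i) => B.jointP y.1 y.2.1.cur a s' := by
  refine .of_forall_history t (fun h => ?_) fun h => ⟨1, fun θ ϑ => ?_⟩
  · exact (B.measurable_jointP h.cur a s').fun_comp measurable_fst
  · rw [abs_of_nonneg (B.jointP_nonneg _ _ _ _), ← B.sum_jointP θ h.cur a]
    exact Finset.single_le_sum (fun z _ => B.jointP_nonneg θ h.cur a z) (Finset.mem_univ s')

theorem boundedAt_reward (hμ : ∀ s, Measurable fun θ => μ θ s) (t : ℕ) :
    BoundedAt t fun y : (∀ i, Θ i) × History S × (∀ i, Θ i) =>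
      B.reward y.2.1.cur (μ y.2.2 y.2.1.cur) :=
  BoundedAt.action hμ (f := fun a y => B.reward y.2.1.cur a) fun a =>
    BoundedAt.history t fun h => B.reward h.cur a

theorem integral_trueParam (hμ : ∀ s, Measurable fun θ => μ θ s) (t : ℕ) {f : (∀ i, Θ i) → ℝ}
    (hf : Measurable f) (hf0 : ∀ θ, 0 ≤ f θ) {C : ℝ} (hC : ∀ θ, f θ ≤ C) :
    ∫ y, f y.1 ∂(B.law μ t) = ∫ θ, f θ ∂(Measure.pi B.prior) := by
  have hbd : ∀ t, BoundedAt t fun y : (∀ i, Θ i) × History S × (∀ i, Θ i) => f y.1 := fun t =>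
    .trueParam t hf fun θ => (abs_of_nonneg (hf0 θ)).le.trans (hC θ)
  induction t with
  | zero =>
    have hm : Measurable fun y : (∀ i, Θ i) × History S × (∀ i, Θ i) => f y.1 := (hbd 0).1
    rw [integral_eq_lintegral_of_nonneg_ae (Eventually.of_forall fun y => hf0 _)
        hm.aestronglyMeasurable,
      integral_eq_lintegral_of_nonneg_ae (Eventually.of_forall fun y => hf0 _)
        hf.aestronglyMeasurable, lintegral_law_zero hm.ennreal_ofReal]
    simp only [lintegral_const, measure_univ, mul_one, ← Finset.sum_mul]
    rw [← ENNReal.ofReal_sum_of_nonneg fun s _ => B.jointInit_nonneg s, sum_jointInit,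
      ENNReal.ofReal_one, one_mul]
  | succ t ih =>
    rw [← ih]
    have h1 := integral_le_integral_law_succ (B := B) hμ t (hbd (t + 1)) (hbd t)
      fun y s' ϑ' _ _ => le_rfl
    have h2 := integral_le_integral_law_succ (B := B) hμ t (hbd (t + 1)).neg (hbd t).neg
      fun y s' ϑ' _ _ => le_rfl
    rw [integral_neg, integral_neg] at h2
    linarith

open Classical in
/-- Exchange of the sampled and the true parameter over whole episodes. The length of an episode
depends on the sampled parameter through the data, but it is at most the length of the previous
episode plus one, which is known when the sample is drawn. -/
theorem sum_integral_param_le (hμ : ∀ s, Measurable fun θ => μ θ s) (T : ℕ)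
    {G : (∀ i, Θ i) → ℝ} (hG : Measurable G) (hG0 : ∀ θ, 0 ≤ G θ) {C : ℝ} (hC : ∀ θ, G θ ≤ C) :
    ∑ t ∈ Finset.range T, ∫ y, G y.2.2 ∂(B.law μ t) ≤
      T * ∫ θ, G θ ∂(Measure.pi B.prior) +
        C * (∫ y, (numStarts y.2.1.past : ℝ) ∂(B.law μ T) + 1) := by
  have hGabs : ∀ θ, |G θ| ≤ C := fun θ => (abs_of_nonneg (hG0 θ)).le.trans (hC θ)
  -- `R` is the remaining length that the first stopping criterion allows, `A` the total of the
  -- allowed lengths of the episodes before the current one, and `c` their increments.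
  let R : History S → ℝ := fun h =>
    ((episodeAt h.past).start : ℝ) + (episodeAt h.past).prevLen - h.past.length
  let A : History S → ℝ := fun h => ((episodeAt h.past).start : ℝ) - 1 + numStarts h.past
  let c : History S → ℝ := fun h =>
    if StartsAt h.past then ((episodeAt h.past).prevLen : ℝ) + 1 else 0
  have hR1 : ∀ h, 1 ≤ R h := fun h => by
    have := length_lt_start_add_prevLen h.past
    have : ((h.past.length : ℝ) + 1) ≤ (episodeAt h.past).start + (episodeAt h.past).prevLen := by
      exact_mod_cast this
    dsimp only [R]; linarith
  have hbG : ∀ t, BoundedAt t fun y : (∀ i, Θ i) × History S × (∀ i, Θ i) => G y.2.2 :=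
    fun t => .param t hG hGabs
  have hbG' : ∀ t, BoundedAt t fun y : (∀ i, Θ i) × History S × (∀ i, Θ i) => G y.1 :=
    fun t => .trueParam t hG hGabs
  have hbR : ∀ t, BoundedAt t fun y : (∀ i, Θ i) × History S × (∀ i, Θ i) =>
      R y.2.1 * G y.2.2 := fun t => (BoundedAt.history t R).mul (hbG t)
  have hbA : ∀ t, BoundedAt t fun y : (∀ i, Θ i) × History S × (∀ i, Θ i) =>
      A y.2.1 * G y.1 := fun t => (BoundedAt.history t A).mul (hbG' t)
  have hbc : ∀ t, BoundedAt t fun y : (∀ i, Θ i) × History S × (∀ i, Θ i) =>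
      c y.2.1 * G y.2.2 := fun t => (BoundedAt.history t c).mul (hbG t)
  have hbc' : ∀ t, BoundedAt t fun y : (∀ i, Θ i) × History S × (∀ i, Θ i) =>
      c y.2.1 * G y.1 := fun t => (BoundedAt.history t c).mul (hbG' t)
  have hsample : ∀ t, ∫ y, c y.2.1 * G y.2.2 ∂(B.law μ t) = ∫ y, c y.2.1 * G y.1 ∂(B.law μ t) := by
    intro t
    have := integral_sample_eq (B := B) hμ t
      (F := fun h θ => (((episodeAt h.past).prevLen : ℝ) + 1) * G θ)
      (fun h => hG.const_mul _) fun h θ => mul_nonneg (by positivity) (hG0 θ)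
    simpa only [c, ite_mul, zero_mul] using this
  have hstart : ∀ (z : (∀ i, S i) × (Fin n → Bool)) (l : List ((∀ i, S i) × (Fin n → Bool))),
      StartsAt (z :: l) → ((episodeAt (z :: l)).start : ℝ) =
        (episodeAt l).start + (episodeAt (z :: l)).prevLen := by
    intro z l hst
    have h1 := episodeAt_start_le l
    rw [episodeAt_cons_of_stops ((startsAt_cons_iff z l).1 hst)]
    have : (z :: l).length + 1 = (episodeAt l).start + ((z :: l).length + 1 - (episodeAt l).start) := by
      rw [List.length_cons]; omega
    exact_mod_cast this
  have hΦ : ∀ t, ∫ y, G y.2.2 ∂(B.law μ t) ≤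
      ∫ y, R y.2.1 * G y.2.2 ∂(B.law μ t) - ∫ y, R y.2.1 * G y.2.2 ∂(B.law μ (t + 1)) +
        ∫ y, c y.2.1 * G y.2.2 ∂(B.law μ (t + 1)) := by
    intro t
    have h1 := integral_le_integral_law_succ (B := B) hμ t
      (φ := fun y => G y.2.2 - R y.2.1 * G y.2.2)
      (F := fun y => c y.2.1 * G y.2.2 - R y.2.1 * G y.2.2)
      ((hbc _).sub (hbR _)) ((hbG t).sub (hbR t)) fun y s' ϑ' hy hs => by
        by_cases hst : StartsAt (y.2.1.next (μ y.2.2 y.2.1.cur) s').past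
        · have e : R (y.2.1.next (μ y.2.2 y.2.1.cur) s') = c (y.2.1.next (μ y.2.2 y.2.1.cur) s') := by
            dsimp only [R, c]
            rw [if_pos hst, show (episodeAt (y.2.1.next (μ y.2.2 y.2.1.cur) s').past).start =
              (y.2.1.next (μ y.2.2 y.2.1.cur) s').past.length + 1 from hst]
            push_cast; ring
          dsimp only
          rw [e, sub_self]
          nlinarith [hR1 y.2.1, hG0 y.2.2]
        · have hϑ : ϑ' = y.2.2 := hs.resolve_left hst
          subst hϑ
          have hst' : ¬ StartsAt ((y.2.1.cur, μ y.2.2 y.2.1.cur) :: y.2.1.past) := hst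
          have e1 : R (y.2.1.next (μ y.2.2 y.2.1.cur) s') = R y.2.1 - 1 := by
            dsimp only [R, History.next]
            rw [episodeAt_cons_of_not_stops fun h => hst' ((startsAt_cons_iff _ _).2 h),
              List.length_cons]
            push_cast; ring
          have e2 : c (y.2.1.next (μ y.2.2 y.2.1.cur) s') = 0 := if_neg hst
          dsimp only
          rw [e1, e2]
          linarith
    rw [integral_sub ((hbc _).integrable hμ) ((hbR _).integrable hμ),
      integral_sub ((hbG _).integrable hμ) ((hbR _).integrable hμ)] at h1
    linarith
  have hA : ∀ t, ∫ y, c y.2.1 * G y.1 ∂(B.law μ (t + 1)) ≤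
      ∫ y, A y.2.1 * G y.1 ∂(B.law μ (t + 1)) - ∫ y, A y.2.1 * G y.1 ∂(B.law μ t) := by
    intro t
    have h1 := integral_le_integral_law_succ (B := B) hμ t
      (F := fun y => A y.2.1 * G y.1 - c y.2.1 * G y.1) ((hbA _).sub (hbc' _)) (hbA t)
      fun y s' ϑ' hy hs => by
        refine le_of_eq ?_
        have e : A (y.2.1.next (μ y.2.2 y.2.1.cur) s') =
            A y.2.1 + c (y.2.1.next (μ y.2.2 y.2.1.cur) s') := by
          dsimp only [A, c, History.next]
          by_cases hst : StartsAt ((y.2.1.cur, μ y.2.2 y.2.1.cur) :: y.2.1.past)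
          · rw [if_pos hst, hstart _ _ hst, numStarts, if_pos hst]
            push_cast; ring
          · rw [if_neg hst, numStarts, if_neg hst,
              episodeAt_cons_of_not_stops fun h => hst ((startsAt_cons_iff _ _).2 h)]
            push_cast; ring
        dsimp only
        rw [e]; ring
    rw [integral_sub ((hbA _).integrable hμ) ((hbc' _).integrable hμ)] at h1
    linarith
  have hsum : ∀ T : ℕ, ∑ t ∈ Finset.range T, ∫ y, G y.2.2 ∂(B.law μ t) ≤
      (∫ y, R y.2.1 * G y.2.2 ∂(B.law μ 0) - ∫ y, R y.2.1 * G y.2.2 ∂(B.law μ T)) +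
        (∫ y, A y.2.1 * G y.1 ∂(B.law μ T) - ∫ y, A y.2.1 * G y.1 ∂(B.law μ 0)) := by
    intro T
    induction T with
    | zero => simp
    | succ T ih =>
      rw [Finset.sum_range_succ]
      linarith [hΦ T, hA T, hsample (T + 1)]
  have hp0 := isProbabilityMeasure_law (B := B) hμ 0
  have hpT := isProbabilityMeasure_law (B := B) hμ T
  have hR0 : ∫ y, R y.2.1 * G y.2.2 ∂(B.law μ 0) ≤ C := by
    refine (integral_le_integral_law hμ (hbR 0) (BoundedAt.const 0 C) fun y hy => ?_).trans
      (by simp)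
    have h0 : y.2.1.past = [] := List.length_eq_zero_iff.1 hy
    have : R y.2.1 = 1 := by simp [R, h0, episodeAt]
    rw [this, one_mul]
    exact hC _
  have hRT : 0 ≤ ∫ y, R y.2.1 * G y.2.2 ∂(B.law μ T) :=
    integral_nonneg fun y => mul_nonneg (by linarith [hR1 y.2.1]) (hG0 _)
  have hA0 : 0 ≤ ∫ y, A y.2.1 * G y.1 ∂(B.law μ 0) :=
    integral_nonneg fun y => mul_nonneg (by
      have : (1 : ℝ) ≤ (episodeAt y.2.1.past).start := by
        exact_mod_cast one_le_episodeAt_start y.2.1.past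
      dsimp only [A]
      have := Nat.cast_nonneg (α := ℝ) (numStarts y.2.1.past)
      linarith) (hG0 _)
  have hbN : BoundedAt T fun y : (∀ i, Θ i) × History S × (∀ i, Θ i) =>
      (numStarts y.2.1.past : ℝ) := BoundedAt.history T fun h => (numStarts h.past : ℝ)
  have hAT : ∫ y, A y.2.1 * G y.1 ∂(B.law μ T) ≤ T * ∫ θ, G θ ∂(Measure.pi B.prior) +
      C * ∫ y, (numStarts y.2.1.past : ℝ) ∂(B.law μ T) := by
    have hb1 := (BoundedAt.const T (T : ℝ)).mul (hbG' T)
    have hb2 := (BoundedAt.const T C).mul hbN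
    refine (integral_le_integral_law hμ (hbA T) (hb1.add hb2) fun y hy => ?_).trans ?_
    · have h1 : ((episodeAt y.2.1.past).start : ℝ) ≤ T + 1 := by
        rw [← hy]; exact_mod_cast episodeAt_start_le y.2.1.past
      have h2 := Nat.cast_nonneg (α := ℝ) (numStarts y.2.1.past)
      dsimp only [A]
      nlinarith [hG0 y.1, hC y.1]
    · rw [integral_add (hb1.integrable hμ) (hb2.integrable hμ), integral_const_mul,
        integral_const_mul, integral_trueParam hμ T hG hG0 hC]
  have := hsum T
  linarith

/-- The Bellman equation of the sampled model along the algorithm: up to the error made in the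
one-step expectation, the sums telescope within each episode. -/
theorem sum_integral_J_sub_reward_le [∀ i, Nonempty (S i)] (hμ : ∀ s, Measurable fun θ => μ θ s)
    {Rmax lam : ℝ} {V : (∀ i, Θ i) → (∀ i, S i) → ℝ} (hR0 : 0 ≤ Rmax)
    (hr : ∀ i s b, 0 ≤ B.r i s b ∧ B.r i s b ≤ Rmax)
    (hV : B.IsDifferentialValue μ V) (hlam1 : lam < 1)
    (hlam : ∀ θ, ergodicityCoeff (B.chain μ θ) ≤ lam)
    {E : ℕ → (∀ i, Θ i) × History S × (∀ i, Θ i) → ℝ} (hE : ∀ t, BoundedAt t (E t))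
    (hVE : ∀ (t : ℕ) (y : (∀ i, Θ i) × History S × (∀ i, Θ i)) (s₀ : ∀ i, S i),
      |∑ s', B.jointP y.2.2 y.2.1.cur (μ y.2.2 y.2.1.cur) s' * (V y.2.2 s' - V y.2.2 s₀) -
        ∑ s', B.jointP y.1 y.2.1.cur (μ y.2.2 y.2.1.cur) s' * (V y.2.2 s' - V y.2.2 s₀)| ≤ E t y)
    (T : ℕ) :
    ∑ t ∈ Finset.range T, ∫ y, (B.J μ y.2.2 - B.reward y.2.1.cur (μ y.2.2 y.2.1.cur))
        ∂(B.law μ t) ≤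
      2 * (n * (Rmax / (1 - lam))) * (∫ y, (numStarts y.2.1.past : ℝ) ∂(B.law μ T) + 1) +
        ∑ t ∈ Finset.range T, ∫ y, E t y ∂(B.law μ t) := by
  classical
  set H := n * (Rmax / (1 - lam)) with hH
  let s₀ : ∀ i, S i := fun i => Classical.arbitrary (S i)
  have hVH : ∀ θ s s', |V θ s - V θ s'| ≤ H := abs_value_sub_le hR0 hr hV hlam1 hlam
  have hVm := measurable_value_sub hμ hV hlam1 hlam
  have hbV : ∀ (t : ℕ) (s' : ∀ i, S i), BoundedAt t
      fun y : (∀ i, Θ i) × History S × (∀ i, Θ i) => V y.2.2 s' - V y.2.2 s₀ := fun t s' =>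
    .param t (hVm s' s₀) fun θ => hVH θ s' s₀
  let Y : (∀ i, Θ i) × History S × (∀ i, Θ i) → ℝ := fun y => V y.2.2 y.2.1.cur - V y.2.2 s₀
  have hbY : ∀ t, BoundedAt t Y := fun t =>
    .of_forall_history t (fun h => (hVm h.cur s₀).fun_comp measurable_snd)
      fun h => ⟨H, fun θ ϑ => hVH ϑ h.cur s₀⟩
  let N : (∀ i, Θ i) × History S × (∀ i, Θ i) → ℝ := fun y => 2 * H * numStarts y.2.1.past
  have hbN : ∀ t, BoundedAt t N := fun t =>
    BoundedAt.history t fun h => 2 * H * (numStarts h.past : ℝ)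
  -- the expected value of the next state under the true parameter
  let Z : (∀ i, Θ i) × History S × (∀ i, Θ i) → ℝ := fun y =>
    ∑ s', B.jointP y.1 y.2.1.cur (μ y.2.2 y.2.1.cur) s' * (V y.2.2 s' - V y.2.2 s₀)
  have hbZ : ∀ t, BoundedAt t Z := fun t => BoundedAt.sum _ fun s' _ =>
    (BoundedAt.action hμ (f := fun a y => B.jointP y.1 y.2.1.cur a s')
      fun a => boundedAt_jointP t a s').mul (hbV t s')
  have hH0 : 0 ≤ H := (abs_nonneg _).trans (hVH (Classical.choice (by
    have : Nonempty (∀ i, Θ i) := (Measure.pi B.prior).nonempty_of_neZero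
    exact this)) s₀ s₀)
  have hstep : ∀ t, ∫ y, (Z y + N y) ∂(B.law μ t) ≤ ∫ y, (Y y + N y) ∂(B.law μ (t + 1)) := by
    intro t
    have h1 := integral_step_le (B := B) hμ t
      (φ := fun y s' => (V y.2.2 s' - V y.2.2 s₀) + N y) ((hbY _).add (hbN _))
      (fun s' => (hbV t s').add (hbN t)) fun y s' ϑ' _ hs => by
        dsimp only [Y, N, History.next]
        by_cases hst : StartsAt ((y.2.1.cur, μ y.2.2 y.2.1.cur) :: y.2.1.past)
        · rw [numStarts, if_pos hst]
          have h2 := (abs_le.1 (hVH ϑ' s' s₀)).1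
          have h3 := (abs_le.1 (hVH y.2.2 s' s₀)).2
          push_cast
          linarith
        · rw [numStarts, if_neg hst, hs.resolve_left hst, add_zero]
    simpa only [mul_add, Finset.sum_add_distrib, ← Finset.sum_mul, sum_jointP, one_mul] using h1
  have hone : ∀ t, ∫ y, (B.J μ y.2.2 - B.reward y.2.1.cur (μ y.2.2 y.2.1.cur)) ∂(B.law μ t) ≤
      ∫ y, (Y y + N y) ∂(B.law μ (t + 1)) - ∫ y, (Y y + N y) ∂(B.law μ t) +
        ∫ y, E t y ∂(B.law μ t) := by
    intro t
    have hbJ : BoundedAt t fun y : (∀ i, Θ i) × History S × (∀ i, Θ i) => B.J μ y.2.2 :=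
      .param t (measurable_J hμ hV hlam1 hlam) (C := n * Rmax) fun θ => by
        rw [abs_of_nonneg (J_mem hR0 hr hV θ).1]; exact (J_mem hR0 hr hV θ).2
    have h1 : ∫ y, (B.J μ y.2.2 - B.reward y.2.1.cur (μ y.2.2 y.2.1.cur)) ∂(B.law μ t) ≤
        ∫ y, ((Z y + N y) - (Y y + N y) + E t y) ∂(B.law μ t) := by
      refine integral_le_integral_law hμ (hbJ.sub (boundedAt_reward hμ t))
        ((((hbZ t).add (hbN t)).sub ((hbY t).add (hbN t))).add (hE t)) fun y _ => ?_
      have h2 := J_sub_chainReward_eq hV y.2.2 y.2.1.cur s₀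
      have h3 := (abs_le.1 (hVE t y s₀)).2
      unfold chainReward chain at h2
      dsimp only [Y, Z]
      linarith
    rw [integral_add ((((hbZ t).add (hbN t)).sub ((hbY t).add (hbN t))).integrable hμ)
      ((hE t).integrable hμ), integral_sub (((hbZ t).add (hbN t)).integrable hμ)
      (((hbY t).add (hbN t)).integrable hμ)] at h1
    linarith [hstep t]
  refine (Finset.sum_le_sum fun t _ => hone t).trans ?_
  rw [Finset.sum_add_distrib, Finset.sum_range_sub (fun t => ∫ y, (Y y + N y) ∂(B.law μ t))]
  have hp0 := isProbabilityMeasure_law (B := B) hμ 0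
  have hpT := isProbabilityMeasure_law (B := B) hμ T
  have h0 : -H ≤ ∫ y, (Y y + N y) ∂(B.law μ 0) := by
    refine le_trans (by simp) (integral_le_integral_law hμ (BoundedAt.const 0 (-H))
      ((hbY 0).add (hbN 0)) fun y _ => ?_)
    have h1 := (abs_le.1 (hVH y.2.2 y.2.1.cur s₀)).1
    have h2 : 0 ≤ N y := by dsimp only [N]; positivity
    dsimp only [Y]
    linarith
  have hT : ∫ y, (Y y + N y) ∂(B.law μ T) ≤
      H + 2 * H * ∫ y, (numStarts y.2.1.past : ℝ) ∂(B.law μ T) := by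
    rw [integral_add ((hbY T).integrable hμ) ((hbN T).integrable hμ), ← integral_const_mul]
    refine add_le_add ?_ le_rfl
    refine (integral_le_integral_law hμ (hbY T) (BoundedAt.const T H) fun y _ => ?_).trans
      (by simp)
    exact (abs_le.1 (hVH y.2.2 y.2.1.cur s₀)).2
  linarith

/-! ### The regret bound -/

/-- The episodes contribute `24`, since there are at most `8 √(S̄ T log (3 T))` of them and each costs
at most `3 n max (…)`. The estimation of the transition probabilities contributes `49 (M + 1)`. -/
theorem regret_le [∀ i, Nonempty (S i)] [∀ i, MetricSpace (S i)] (hn : 0 < n) {M : ℕ}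
    (hS : ∀ i, Fintype.card (S i) ≤ M ∨ ∃ e : S i → ℝ, Isometry e)
    (hμ : ∀ s, Measurable fun θ => μ θ s)
    {Rmax lam : ℝ} {V : (∀ i, Θ i) → (∀ i, S i) → ℝ} (hR0 : 0 < Rmax)
    (hr : ∀ i s b, 0 ≤ B.r i s b ∧ B.r i s b ≤ Rmax)
    (hV : B.IsDifferentialValue μ V) (hlam1 : lam < 1)
    (hlam : ∀ θ, ergodicityCoeff (B.chain μ θ) ≤ lam) {p : ℝ} (hp : 1 ≤ p) {Lv : ℝ}
    (hLip : ∀ θ s s', |V θ s - V θ s'| ≤ Lv * productDist p s s') {T : ℕ} (hT : 0 < T) :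
    B.regret μ T ≤ (73 + 49 * M) * n * max (Rmax / (1 - lam))
        ((⨆ i, Metric.diam (Set.univ : Set (S i))) * Lv) *
      √((∑ i, (Fintype.card (S i) : ℝ)) * T * Real.log (3 * T)) := by
  classical
  choose N u w hu hw0 hwsum hw using fun i => exists_testFunctions M (hS i)
  set Sb := ∑ i, (Fintype.card (S i) : ℝ) with hSb
  set Lg := Real.log (3 * T) with hLgdef
  set C := max (Rmax / (1 - lam)) ((⨆ i, Metric.diam (Set.univ : Set (S i))) * Lv) with hC
  set X := √(Sb * T * Lg) with hX
  have hn1 : (1 : ℝ) ≤ n := by exact_mod_cast hn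
  have hLg : 1 ≤ Lg := one_le_log_three_mul hT
  have hT1 : (1 : ℝ) ≤ T := by exact_mod_cast hT
  have hcard : ∀ i, (1 : ℝ) ≤ Fintype.card (S i) := fun i => by exact_mod_cast Fintype.card_pos
  have hcardSb : ∀ i, (Fintype.card (S i) : ℝ) ≤ Sb := fun i =>
    Finset.single_le_sum (f := fun i => (Fintype.card (S i) : ℝ)) (fun _ _ => Nat.cast_nonneg _)
      (Finset.mem_univ i)
  have hSb1 : 1 ≤ Sb := (hcard ⟨0, hn⟩).trans (hcardSb _)
  have hX1 : 1 ≤ X := by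
    refine Real.one_le_sqrt.2 ?_
    exact one_le_mul_of_one_le_of_one_le (one_le_mul_of_one_le_of_one_le hSb1 hT1) hLg
  have hlam0 : 0 ≤ lam := by
    have : Nonempty (∀ i, Θ i) := (Measure.pi B.prior).nonempty_of_neZero
    obtain ⟨θ⟩ := this
    exact (ergodicityCoeff_nonneg (sum_chain θ)).trans (hlam θ)
  have hRC : Rmax / (1 - lam) ≤ C := le_max_left _ _
  have hRR : Rmax ≤ Rmax / (1 - lam) := by
    rw [le_div_iff₀ (by linarith)]; nlinarith
  have hC0 : 0 < C := hR0.trans_le (hRR.trans hRC)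
  -- the error of the one-step expectation, arm by arm
  let E : ℕ → (∀ i, Θ i) × History S × (∀ i, Θ i) → ℝ := fun _ y =>
    ∑ i, max Lv 0 * ∑ l ∈ Finset.range (N i), w i l *
      |B.armMean i (u i l) (y.2.1.cur i) (μ y.2.2 y.2.1.cur i) y.2.2 -
        B.armMean i (u i l) (y.2.1.cur i) (μ y.2.2 y.2.1.cur i) y.1|
  have hbD := fun t i l => boundedAt_armMean_sub (B := B) hμ t i (hu i l)
  have hbE1 := fun t i => BoundedAt.sum (Finset.range (N i)) fun l _ =>
    (BoundedAt.const t (w i l)).mul (hbD t i l)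
  have hbE2 := fun t i => (BoundedAt.const t (max Lv 0)).mul (hbE1 t i)
  have hbE : ∀ t, BoundedAt t (E t) := fun t => BoundedAt.sum Finset.univ fun i _ => hbE2 t i
  have hVE : ∀ (t : ℕ) (y : (∀ i, Θ i) × History S × (∀ i, Θ i)) (s₀ : ∀ i, S i),
      |∑ s', B.jointP y.2.2 y.2.1.cur (μ y.2.2 y.2.1.cur) s' * (V y.2.2 s' - V y.2.2 s₀) -
        ∑ s', B.jointP y.1 y.2.1.cur (μ y.2.2 y.2.1.cur) s' * (V y.2.2 s' - V y.2.2 s₀)| ≤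
          E t y := fun t y s₀ =>
    abs_sum_jointP_sub_le hp (g := fun s' => V y.2.2 s' - V y.2.2 s₀)
      (fun s s' => by simpa only [sub_sub_sub_cancel_right] using hLip y.2.2 s s')
      hw y.1 y.2.2 y.2.1.cur (μ y.2.2 y.2.1.cur)
  have hLvD : ∀ i, max Lv 0 * Metric.diam (Set.univ : Set (S i)) ≤ C := by
    intro i
    rcases le_total Lv 0 with h | h
    · rw [max_eq_right h, zero_mul]; exact hC0.le
    · rw [max_eq_left h, mul_comm]
      refine (mul_le_mul_of_nonneg_right ?_ h).trans (le_max_right _ _)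
      exact le_ciSup (f := fun i => Metric.diam (Set.univ : Set (S i)))
        (Set.finite_range _).bddAbove i
  have hEsum : ∑ t ∈ Finset.range T, ∫ y, E t y ∂(B.law μ t) ≤ 49 * (M + 1) * n * C * X := by
    have h1 : ∀ t, ∫ y, E t y ∂(B.law μ t) = ∑ i, max Lv 0 * ∑ l ∈ Finset.range (N i), w i l *
        ∫ y, |B.armMean i (u i l) (y.2.1.cur i) (μ y.2.2 y.2.1.cur i) y.2.2 -
          B.armMean i (u i l) (y.2.1.cur i) (μ y.2.2 y.2.1.cur i) y.1| ∂(B.law μ t) := by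
      intro t
      rw [integral_finsetSum _ fun i _ => (hbE2 t i).integrable hμ]
      refine Finset.sum_congr rfl fun i _ => ?_
      rw [integral_const_mul, integral_finsetSum _ fun l _ =>
        ((BoundedAt.const t (w i l)).mul (hbD t i l)).integrable hμ]
      simp only [integral_const_mul]
    simp_rw [h1]
    rw [Finset.sum_comm]
    have h2 : ∀ i ∈ (Finset.univ : Finset (Fin n)), ∑ t ∈ Finset.range T, max Lv 0 *
        ∑ l ∈ Finset.range (N i), w i l *
          ∫ y, |B.armMean i (u i l) (y.2.1.cur i) (μ y.2.2 y.2.1.cur i) y.2.2 -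
            B.armMean i (u i l) (y.2.1.cur i) (μ y.2.2 y.2.1.cur i) y.1| ∂(B.law μ t) ≤
        49 * (M + 1) * C * X := by
      intro i _
      rw [← Finset.mul_sum, Finset.sum_comm]
      simp_rw [← Finset.mul_sum]
      have h3 : √(Fintype.card (S i) * T * Lg) ≤ X := Real.sqrt_le_sqrt (by
        have := hcardSb i
        gcongr)
      have h4 : ∀ l, ∑ t ∈ Finset.range T,
          ∫ y, |B.armMean i (u i l) (y.2.1.cur i) (μ y.2.2 y.2.1.cur i) y.2.2 -
            B.armMean i (u i l) (y.2.1.cur i) (μ y.2.2 y.2.1.cur i) y.1| ∂(B.law μ t) ≤ 49 * X :=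
        fun l => (sum_integral_armMean_sub_le hμ hT i (hu i l)).trans
          (mul_le_mul_of_nonneg_left h3 (by norm_num))
      calc _ ≤ max Lv 0 * ∑ l ∈ Finset.range (N i), w i l * (49 * X) := by
            refine mul_le_mul_of_nonneg_left (Finset.sum_le_sum fun l _ => ?_) (le_max_right _ _)
            exact mul_le_mul_of_nonneg_left (h4 l) (hw0 i l)
        _ = max Lv 0 * (∑ l ∈ Finset.range (N i), w i l) * (49 * X) := by
            rw [← Finset.sum_mul, mul_assoc]
        _ ≤ max Lv 0 * ((M + 1) * Metric.diam (Set.univ : Set (S i))) * (49 * X) := by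
            refine mul_le_mul_of_nonneg_right ?_ (by positivity)
            exact mul_le_mul_of_nonneg_left (hwsum i) (le_max_right _ _)
        _ = 49 * (M + 1) * (max Lv 0 * Metric.diam (Set.univ : Set (S i))) * X := by ring
        _ ≤ 49 * (M + 1) * C * X := by
            refine mul_le_mul_of_nonneg_right ?_ (by positivity)
            exact mul_le_mul_of_nonneg_left (hLvD i) (by positivity)
    refine (Finset.sum_le_sum h2).trans (le_of_eq ?_)
    rw [Finset.sum_const, Finset.card_univ, Fintype.card_fin, nsmul_eq_mul]
    ring
  have hpT := isProbabilityMeasure_law (B := B) hμ T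
  have hK : ∫ y, (numStarts y.2.1.past : ℝ) ∂(B.law μ T) + 1 ≤ 8 * X := by
    have h1 : ∫ y, (numStarts y.2.1.past : ℝ) ∂(B.law μ T) ≤ 3 * √(5 * Sb * T * Lg) := by
      refine (integral_le_integral_law hμ (BoundedAt.history T fun h => (numStarts h.past : ℝ))
        (BoundedAt.const T (3 * √(5 * Sb * T * Lg))) fun y hy => ?_).trans (by simp)
      exact numStarts_le_sqrt y.2.1.past hT hy.le hSb1
    have h2 : √(5 * Sb * T * Lg) = √5 * X := by
      rw [hX, ← Real.sqrt_mul (by norm_num)]; congr 1; ring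
    have h3 : √(5 : ℝ) ≤ 7 / 3 := by
      rw [Real.sqrt_le_left (by norm_num)]; norm_num
    rw [h2] at h1
    nlinarith [mul_le_mul_of_nonneg_right h3 (show 0 ≤ X by linarith)]
  set K := ∫ y, (numStarts y.2.1.past : ℝ) ∂(B.law μ T)
  have hJm := measurable_J hμ hV hlam1 hlam
  have hJ := J_mem hR0.le hr hV
  have hbJ : ∀ t, BoundedAt t fun y : (∀ i, Θ i) × History S × (∀ i, Θ i) => B.J μ y.2.2 :=
    fun t => .param t hJm (C := n * Rmax) fun θ => by
      rw [abs_of_nonneg (hJ θ).1]; exact (hJ θ).2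
  have hJi : Integrable (B.J μ) (Measure.pi B.prior) :=
    Integrable.of_bound hJm.aestronglyMeasurable (n * Rmax) (Eventually.of_forall fun θ => by
      rw [Real.norm_eq_abs, abs_of_nonneg (hJ θ).1]; exact (hJ θ).2)
  have h1 := sum_integral_param_le (B := B) hμ T (G := fun θ => n * Rmax - B.J μ θ)
    (hJm.const_sub _) (fun θ => sub_nonneg.2 (hJ θ).2) (C := n * Rmax)
    (fun θ => sub_le_self _ (hJ θ).1)
  have h2 := sum_integral_J_sub_reward_le hμ hR0.le hr hV hlam1 hlam hbE hVE T
  have h3 : ∑ t ∈ Finset.range T, ∫ y, (n * Rmax - B.J μ y.2.2) ∂(B.law μ t) =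
      T * (n * Rmax) - ∑ t ∈ Finset.range T, ∫ y, B.J μ y.2.2 ∂(B.law μ t) := by
    have : ∀ t, ∫ y, (n * Rmax - B.J μ y.2.2) ∂(B.law μ t) =
        n * Rmax - ∫ y, B.J μ y.2.2 ∂(B.law μ t) := fun t => by
      have := isProbabilityMeasure_law (B := B) hμ t
      rw [integral_sub (integrable_const _) ((hbJ t).integrable hμ)]; simp
    simp only [this, Finset.sum_sub_distrib, Finset.sum_const, Finset.card_range, nsmul_eq_mul]
  have h4 : ∫ θ, (n * Rmax - B.J μ θ) ∂(Measure.pi B.prior) =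
      n * Rmax - ∫ θ, B.J μ θ ∂(Measure.pi B.prior) := by
    rw [integral_sub (integrable_const _) hJi]; simp
  have h5 : ∑ t ∈ Finset.range T, ∫ y, (B.J μ y.2.2 - B.reward y.2.1.cur (μ y.2.2 y.2.1.cur))
      ∂(B.law μ t) = ∑ t ∈ Finset.range T, ∫ y, B.J μ y.2.2 ∂(B.law μ t) -
        ∑ t ∈ Finset.range T, ∫ y, B.reward y.2.1.cur (μ y.2.2 y.2.1.cur) ∂(B.law μ t) := by
    rw [← Finset.sum_sub_distrib]
    exact Finset.sum_congr rfl fun t _ =>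
      integral_sub ((hbJ t).integrable hμ) ((boundedAt_reward hμ t).integrable hμ)
  rw [h3, h4] at h1
  rw [h5] at h2
  have hK1 : 0 ≤ K + 1 := by
    have : 0 ≤ K := integral_nonneg fun y => Nat.cast_nonneg _
    linarith
  have h6 : n * Rmax * (K + 1) + 2 * (n * (Rmax / (1 - lam))) * (K + 1) ≤ 3 * (n * C) * (8 * X) := by
    have e1 : n * Rmax * (K + 1) ≤ n * C * (K + 1) :=
      mul_le_mul_of_nonneg_right
        (mul_le_mul_of_nonneg_left (hRR.trans hRC) (by linarith)) hK1
    have e2 : n * (Rmax / (1 - lam)) * (K + 1) ≤ n * C * (K + 1) :=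
      mul_le_mul_of_nonneg_right (mul_le_mul_of_nonneg_left hRC (by linarith)) hK1
    have e3 : n * C * (K + 1) ≤ n * C * (8 * X) := mul_le_mul_of_nonneg_left hK (by positivity)
    linarith
  unfold regret
  linarith

end RestlessBandit

theorem theorem2 (Smax : ℕ) :
    ∃ K₁ K₂ : ℝ, 0 < K₁ ∧ 0 < K₂ ∧
      ∀ (n : ℕ) (_ : 0 < n)
        (S : Fin n → Type u) [∀ i, Fintype (S i)] [∀ i, Nonempty (S i)] [∀ i, MetricSpace (S i)]
        (Θ : Fin n → Type v) [∀ i, MeasurableSpace (Θ i)]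
        (B : RestlessBandit S Θ)
        (_ : ∀ i, Fintype.card (S i) ≤ Smax ∨ ∃ e : S i → ℝ, Isometry e)
        (Rmax : ℝ) (_ : 0 < Rmax) (_ : ∀ i s b, 0 ≤ B.r i s b ∧ B.r i s b ≤ Rmax)
        (π : ∀ i, Θ i → ℝ → S i → Bool) (_ : B.OptimalFamily π)
        (_ : ∀ i θ, Indexable (π i θ))
        (μ : (∀ i, Θ i) → (∀ i, S i) → (Fin n → Bool)) (_ : B.IsWhittlePolicy π μ)
        (_ : ∀ s, Measurable fun θ => μ θ s)
        (V : (∀ i, Θ i) → (∀ i, S i) → ℝ) (_ : B.IsDifferentialValue μ V)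
        (lamStar : ℝ) (_ : lamStar < 1) (_ : ∀ θ, ergodicityCoeff (B.chain μ θ) ≤ lamStar)
        (p : ℝ) (_ : 1 ≤ p)
        (Lv : ℝ) (_ : ∀ θ s s', |V θ s - V θ s'| ≤ Lv * productDist p s s')
        (T : ℕ) (_ : 0 < T),
        B.regret μ T <
            24 * n * max (Rmax / (1 - lamStar))
                ((⨆ i, Metric.diam (Set.univ : Set (S i))) * Lv) *
              √(K₁ * (∑ i, (Fintype.card (S i) : ℝ)) * T * Real.log (K₂ * T)) ∧
        ∀ b : ℕ, (∀ i, Fintype.card (S i) ≤ b) →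
          B.regret μ T <
            24 * max (Rmax / (1 - lamStar))
                ((⨆ i, Metric.diam (Set.univ : Set (S i))) * Lv) *
              (n : ℝ) ^ (3 / 2 : ℝ) * √(K₁ * b * T * Real.log (K₂ * T)) := by
  -- `24 (4 + 3 M)` exceeds the constant `73 + 49 M` of the regret bound.
  refine ⟨(4 + 3 * Smax) ^ 2, 3, by positivity, by norm_num, ?_⟩
  intro n hn S _ _ _ Θ _ B hS Rmax hR0 hr π _ _ μ _ hμ V hV lam hlam1 hlam p hp Lv hLip T hT
  have hreg := RestlessBandit.regret_le hn hS hμ hR0 hr hV hlam1 hlam hp hLip hT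
  set C := max (Rmax / (1 - lam)) ((⨆ i, Metric.diam (Set.univ : Set (S i))) * Lv)
  set Lg := Real.log (3 * T)
  set Sb := ∑ i, (Fintype.card (S i) : ℝ)
  have hn0 : (0 : ℝ) < n := by exact_mod_cast hn
  have hLg : 0 < Lg := by linarith [one_le_log_three_mul hT]
  have hT0 : (0 : ℝ) < T := by exact_mod_cast hT
  have hC0 : 0 < C := lt_max_of_lt_left (div_pos hR0 (by linarith))
  have hM : (0 : ℝ) ≤ Smax := Nat.cast_nonneg _
  have hcard : ∀ i, 0 < (Fintype.card (S i) : ℝ) := fun i => by exact_mod_cast Fintype.card_pos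
  have hSb : 0 < Sb := Finset.sum_pos (fun i _ => hcard i) ⟨⟨0, hn⟩, Finset.mem_univ _⟩
  have hsqrt : ∀ c : ℝ, √((4 + 3 * (Smax : ℝ)) ^ 2 * c * T * Lg) =
      (4 + 3 * Smax) * √(c * T * Lg) := fun c => by
    rw [mul_assoc, mul_assoc, Real.sqrt_mul (by positivity), Real.sqrt_sq (by positivity),
      mul_assoc]
  have hconst : (73 + 49 * (Smax : ℝ)) < 24 * (4 + 3 * Smax) := by linarith
  refine ⟨?_, fun b hb => ?_⟩
  · rw [hsqrt]
    refine hreg.trans_lt ?_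
    have hX : 0 < n * C * √(Sb * T * Lg) := by positivity
    nlinarith [mul_lt_mul_of_pos_right hconst hX]
  · have hb0 : (0 : ℝ) < b := (hcard ⟨0, hn⟩).trans_le (by exact_mod_cast hb ⟨0, hn⟩)
    have hSbb : Sb ≤ n * b := by
      refine (Finset.sum_le_sum fun i _ => (Nat.cast_le (α := ℝ)).2 (hb i)).trans (le_of_eq ?_)
      simp
    have hX : √(Sb * T * Lg) ≤ √(n : ℝ) * √(b * T * Lg) := by
      rw [← Real.sqrt_mul hn0.le]
      refine Real.sqrt_le_sqrt ?_
      have := mul_le_mul_of_nonneg_right hSbb (mul_pos hT0 hLg).le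
      linarith
    have hpow : (n : ℝ) ^ (3 / 2 : ℝ) = n * √(n : ℝ) := by
      rw [show (3 / 2 : ℝ) = 1 + 1 / 2 by norm_num, Real.rpow_add hn0, Real.rpow_one,
        Real.sqrt_eq_rpow]
    rw [hsqrt, hpow]
    have hpos : 0 < n * C * (√(n : ℝ) * √(b * T * Lg)) := by positivity
    have h1 : (73 + 49 * (Smax : ℝ)) * n * C * √(Sb * T * Lg) ≤
        (73 + 49 * Smax) * (n * C * (√(n : ℝ) * √(b * T * Lg))) := by
      have := mul_le_mul_of_nonneg_left hX (show 0 ≤ (73 + 49 * (Smax : ℝ)) * n * C by positivity)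
      linarith
    refine (hreg.trans h1).trans_lt ?_
    nlinarith [mul_lt_mul_of_pos_right hconst hpos]
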